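/- Let $\beta$, $a_1,a_2,\dots$, $b_1,b_2,\dots$, $x_1,x_2,\dots$ be commuting indeterminates, and put $s\oplus t=s+t+\beta st$, $s\ominus t=(s-t)/(1+\beta t)$, $\bar t=0\ominus t$. Let $W(B)=W(C)$ be the group of signed permutations generated by $s_0,s_1,s_2,\dots$, where $s_0$ changes the sign of $1$ and $s_i$ ($i\ge 1$) exchanges $i$ and $i+1$, and let $W(D)$ be its subgroup generated by $s_{\hat 1}=s_0s_1s_0,s_1,s_2,\dots$. For $X=B,C,D$ let $\ell$ be the length on $W(X)$ with respect to these generators, and let $W(X_n)$ be the subgroup generated by the generators acting on $\{\pm1,\dots,\pm n\}$ (with $n\ge 2$ if $X=D$). The algebra $\mathrm{Id}_\beta(W(X))$ is generated by elements $u_i$, one for each generator $s_i$, with the relations $u_i^2=\beta u_i$ and $u_iu_ju_i\cdots=u_ju_iu_j\cdots$ ($m_{ij}$ factors on each side, $m_{ij}$ the order of $s_is_j$); for $w=s_{i_1}\cdots s_{i_l}$ reduced put $u_w=u_{i_1}\cdots u_{i_l}$. The $u_w$ form a basis. Put $h_i(t)=1+tu_i$, $A_i^{(n)}(t)=h_{n-1}(t)h_{n-2}(t)\cdots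 h_i(t)$ and $$F^B_n(t)=h_{n-1}(t)\cdots h_1(t)\,h_0(t)\,h_1(t)\cdots h_{n-1}(t),$$ $$F^C_n(t)=h_{n-1}(t)\cdots h_1(t)\,h_0(t)^2\,h_1(t)\cdots h_{n-1}(t),$$ $$F^D_n(t)=h_{n-1}(t)\cdots h_2(t)\,h_1(t)h_{\hat 1}(t)\,h_2(t)\cdots h_{n-1}(t),$$ $G_{A_{n-1}}(c_1,\dots,c_{n-1})=A_1^{(n)}(c_1)A_2^{(n)}(c_2)\cdots A_{n-1}^{(n)}(c_{n-1})$. For $w\in W(X_n)$ let $\mathcal G^X_{n,w}(a,b;x)$ be the coefficient of $u_w$ in $$G_{A_{n-1}}(\bar b_1,\dots,\bar b_{n-1})^{-1}\,F^X_n(x_1)\cdots F^X_n(x_n)\,G_{A_{n-1}}(a_1,\dots,a_{n-1}),$$ and let the double Grothendieck polynomial $\mathcal G^X_w(a,b;x)$ be the inverse limit of the $\mathcal G^X_{n,w}(a,b;x)$ (over all $n$ with $w\in W(X_n)$, along the substitutions $x_{n+1}=0$). For a strict partition $\lambda=(\lambda_1>\dots>\lambda_r>0)$, a sequence $c=(c_1,c_2,\dots)$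 and $n\ge r$ let $$GP_\lambda(x_1,\dots,x_n|c)=\frac1{(n-r)!}\sum_{\sigma\in S_n}\sigma\Bigl(\prod_{i=1}^r\Bigl([x_i|c]^{\lambda_i}\prod_{i<j\le n}\frac{x_i\oplus x_j}{x_i\ominus x_j}\Bigr)\Bigr),$$ where $[t|c]^k=(t\oplus c_1)\cdots(t\oplus c_k)$ and $\sigma$ permutes the indices of the $x_i$, and let $GQ_\lambda(x_1,\dots,x_n|c)$ be given by the same formula with $[x_i|c]^{\lambda_i}$ replaced by $[[x_i|c]]^{\lambda_i}$, where $[[t|c]]^k=(t\oplus t)(t\oplus c_1)\cdots(t\oplus c_{k-1})$. Let $GP_\lambda(x|c)$ be the inverse limit of the $GP_\lambda(x_1,\dots,x_{2m}|c)$, and $GQ_\lambda(x|c)$ the inverse limit of the $GQ_\lambda(x_1,\dots,x_n|c)$. Let $w\in W(X)$ be a (maximal) Grassmannian element, that is, an element of minimal length in its coset $wS_\infty$, $S_\infty=\langle s_1,s_2,\dots\rangle$. Its one-line notation is $[\bar i_1,\dots,\bar i_\ell,i_{\ell+1},i_{\ell+2},\dots]$ with $i_1>\dots>i_\ell$ and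 $i_{\ell+1}<i_{\ell+2}<\cdots$; put $\lambda_B(w)=\lambda_C(w)=(i_1,\dots,i_\ell)$ if $X=B,C$, and $\lambda_D(w)=(i_1-1,\dots,i_\ell-1)$ if $X=D$, an entry $0$ being omitted. Then all the limits involved exist, and $$\mathcal G^B_w(a,b;x)=GP_{\lambda_B(w)}(x|0,b),\qquad \mathcal G^C_w(a,b;x)=GQ_{\lambda_C(w)}(x|b),\qquad \mathcal G^D_w(a,b;x)=GP_{\lambda_D(w)}(x|b),$$ for $w$ Grassmannian of type $B$, $C$, $D$ respectively, where $(0,b)=(0,b_1,b_2,\dots)$. -/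

import Mathlib

noncomputable section

namespace KGroth

/-! ### Coefficient ring -/

/-- The variables `β`, `a₁, a₂, …`, `b₁, b₂, …`, `x₁, x₂, …`.  The index is shifted by one:
`Var.a k`, `Var.b k`, `Var.x k` stand for `a_{k+1}`, `b_{k+1}`, `x_{k+1}`. -/
inductive Var : Type
  | beta : Var
  | a : ℕ → Var
  | b : ℕ → Var
  | x : ℕ → Var

/-- The polynomial ring `ℤ[β][a₁, a₂, …; b₁, b₂, …; x₁, x₂, …]`. -/
abbrev P : Type := MvPolynomial Var ℤ

/-- Its field of fractions, in which `⊖` and the summands of `GP` and `GQ` live. -/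
abbrev K : Type := FractionRing P

def β : K := algebraMap P K (MvPolynomial.X Var.beta)
/-- `a k` is the variable `a_{k+1}`. -/
def a (k : ℕ) : K := algebraMap P K (MvPolynomial.X (Var.a k))
/-- `b k` is the variable `b_{k+1}`. -/
def b (k : ℕ) : K := algebraMap P K (MvPolynomial.X (Var.b k))
/-- `x k` is the variable `x_{k+1}`. -/
def x (k : ℕ) : K := algebraMap P K (MvPolynomial.X (Var.x k))

/-- `s ⊕ t = s + t + β s t`. -/
def oplus (s t : K) : K := s + t + β * s * t
/-- `s ⊖ t = (s - t) / (1 + β t)`. -/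
def ominus (s t : K) : K := (s - t) / (1 + β * t)
/-- `t̄ = ⊖ t`. -/
def bar (t : K) : K := ominus 0 t

/-! ### Weyl groups -/

/-- The classical types `B`, `C`, `D`. -/
inductive CType : Type
  | B : CType
  | C : CType
  | D : CType

/-- `s₀ : 1 ↦ -1`, and for `i ≥ 1` the simple reflection `s_i` exchanging `i` and `i + 1`,
as signed permutations, that is, permutations `w` of `ℤ` with `w (-z) = - w z`. -/
def sB : ℕ → Equiv.Perm ℤ
  | 0 => Equiv.swap (-1) 1
  | k + 1 => Equiv.swap ((k : ℤ) + 1) (k + 2) * Equiv.swap (-((k : ℤ) + 1)) (-((k : ℤ) + 2))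

/-- The simple reflections of type `X`: `s₀, s₁, s₂, …` for `B` and `C`;
`s_{1̂} = s₀ s₁ s₀` (with index `0`), `s₁, s₂, …` for `D`. -/
def gen : CType → ℕ → Equiv.Perm ℤ
  | CType.D, 0 => sB 0 * sB 1 * sB 0
  | _, i => sB i

/-- The Weyl group `W(X) = W(X_∞)`. -/
abbrev W (X : CType) : Subgroup (Equiv.Perm ℤ) := Subgroup.closure (Set.range (gen X))

/-- The simple reflections as elements of `W(X)`. -/
def s (X : CType) (i : ℕ) : W X := ⟨gen X i, Subgroup.subset_closure ⟨i, rfl⟩⟩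

/-- The finite Weyl group `W(X_n)` inside `W(X)`, generated by the simple reflections of
index `< n` (for type `D` to be used for `n ≥ 2` only). -/
def Wfin (X : CType) (n : ℕ) : Subgroup (W X) := Subgroup.closure (s X '' {i | i < n})

/-- The parabolic subgroup `S_∞ = ⟨s₁, s₂, …⟩`. -/
def Sinf (X : CType) : Subgroup (W X) := Subgroup.closure (s X '' {i | 1 ≤ i})

/-- The product in `W(X)` of the simple reflections listed in a word. -/
def wordProd (X : CType) (ω : List ℕ) : W X := (ω.map (s X)).prod

/-- Length with respect to the simple reflections. -/
def len (X : CType) (w : W X) : ℕ := sInf {l | ∃ ω : List ℕ, ω.length = l ∧ wordProd X ω = w}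

/-- (Maximal) Grassmannian elements: minimal length representatives of the cosets `w S_∞`. -/
def IsGrassmannian (X : CType) (w : W X) : Prop := ∀ v ∈ Sinf X, len X w ≤ len X (w * v)

/-- The number of barred entries in the one-line notation `[w(1), w(2), …]`. -/
def numBars (w : Equiv.Perm ℤ) : ℕ := Set.ncard {j : ℕ | 1 ≤ j ∧ w (j : ℤ) < 0}

/-- For a Grassmannian element `w = [ī₁, …, ī_ℓ, i_{ℓ+1}, …]` of type `B` or `C`, the strict
partition `(i₁, …, i_ℓ)`. -/
def lamBC (w : Equiv.Perm ℤ) : List ℕ :=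
  (List.range (numBars w)).map fun k => (-w ((k : ℤ) + 1)).toNat

/-- For a Grassmannian element `w = [ī₁, …, ī_ℓ, i_{ℓ+1}, …]` of type `D`, the strict
partition `(i₁ - 1, …, i_ℓ - 1)`, the entry `0` being omitted. -/
def lamD (w : Equiv.Perm ℤ) : List ℕ :=
  ((lamBC w).map fun i => i - 1).filter fun i => i ≠ 0

/-! ### The idCoxeter algebra -/

/-- The alternating product `u v u ⋯` with `m` factors. -/
def alt {M : Type*} [Monoid M] (u v : M) : ℕ → M
  | 0 => 1
  | m + 1 => u * alt v u m

/-- The defining relations of the idCoxeter algebra. -/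
inductive IdRel (X : CType) : FreeAlgebra K ℕ → FreeAlgebra K ℕ → Prop
  | quad (i : ℕ) : IdRel X (FreeAlgebra.ι K i * FreeAlgebra.ι K i) (β • FreeAlgebra.ι K i)
  | braid (i j : ℕ) : IdRel X
      (alt (FreeAlgebra.ι K i) (FreeAlgebra.ι K j) (orderOf (s X i * s X j)))
      (alt (FreeAlgebra.ι K j) (FreeAlgebra.ι K i) (orderOf (s X i * s X j)))

/-- The idCoxeter algebra `Id_β(W(X))` with coefficients extended to `K`. -/
abbrev IdAlg (X : CType) : Type := RingQuot (IdRel X)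

/-- The generator `u_i`. -/
def u (X : CType) (i : ℕ) : IdAlg X := RingQuot.mkAlgHom K (IdRel X) (FreeAlgebra.ι K i)

/-! ### The coefficient of `u_w`

The coefficient of `u_w` is read off from the left regular representation, in which
`u_i e_v = e_{s_i v}` if `ℓ(s_i v) > ℓ(v)` and `u_i e_v = β e_v` otherwise. -/

/-- A word is reduced if no shorter word has the same product. -/
def IsReducedWord (X : CType) (ω : List ℕ) : Prop :=
  ∀ ω' : List ℕ, wordProd X ω' = wordProd X ω → ω.length ≤ ω'.length

open Classical in
/-- The operator by which `u_i` acts in the left regular representation. -/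
def regOp (X : CType) (i : ℕ) : Module.End K (W X →₀ K) :=
  Finsupp.linearCombination K fun v : W X =>
    if len X (s X i * v) < len X v then β • Finsupp.single v (1 : K)
    else Finsupp.single (s X i * v) (1 : K)

/-! Facts on signed permutations needed for the operators to respect the relations. -/

theorem sB_zero_apply (z : ℤ) : sB 0 z = if z = -1 then 1 else if z = 1 then -1 else z := by
  simp only [sB, Equiv.swap_apply_def]

theorem sB_succ_apply (k : ℕ) (z : ℤ) : sB (k + 1) z =
    if z = k + 1 then (k : ℤ) + 2 else if z = k + 2 then (k : ℤ) + 1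
    else if z = -(k + 1) then -((k : ℤ) + 2) else if z = -(k + 2) then -((k : ℤ) + 1)
    else z := by
  simp only [sB, Equiv.Perm.mul_apply, Equiv.swap_apply_def]
  split_ifs <;> omega

theorem gen_D_zero_apply (z : ℤ) : gen CType.D 0 z =
    if z = 1 then -2 else if z = 2 then -1 else if z = -1 then 2 else if z = -2 then 1
    else z := by
  have h : gen CType.D 0 = sB 0 * sB (0 + 1) * sB 0 := rfl
  rw [h]
  simp only [Equiv.Perm.mul_apply, sB_zero_apply, sB_succ_apply]
  split_ifs <;> omega

theorem gen_succ_apply (X : CType) (k : ℕ) (z : ℤ) : gen X (k + 1) z =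
    if z = k + 1 then (k : ℤ) + 2 else if z = k + 2 then (k : ℤ) + 1
    else if z = -(k + 1) then -((k : ℤ) + 2) else if z = -(k + 2) then -((k : ℤ) + 1)
    else z := by
  cases X <;> exact sB_succ_apply k z

theorem gen_B_zero_apply (z : ℤ) :
    gen CType.B 0 z = if z = -1 then 1 else if z = 1 then -1 else z := sB_zero_apply z

theorem gen_C_zero_apply (z : ℤ) :
    gen CType.C 0 z = if z = -1 then 1 else if z = 1 then -1 else z := sB_zero_apply z

theorem gen_gen (X : CType) (i : ℕ) (z : ℤ) : gen X i (gen X i z) = z := by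
  obtain ⟨y, hy⟩ : ∃ y, gen X i z = y := ⟨_, rfl⟩
  rw [hy]
  cases i with
  | zero =>
    cases X
    · rw [gen_B_zero_apply] at hy ⊢; split_ifs at hy ⊢ <;> omega
    · rw [gen_C_zero_apply] at hy ⊢; split_ifs at hy ⊢ <;> omega
    · rw [gen_D_zero_apply] at hy ⊢; split_ifs at hy ⊢ <;> omega
  | succ k => rw [gen_succ_apply] at hy ⊢; split_ifs at hy ⊢ <;> omega

theorem gen_neg (X : CType) (i : ℕ) (z : ℤ) : gen X i (-z) = -gen X i z := by
  cases i with
  | zero =>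
    cases X
    · simp only [gen_B_zero_apply]; split_ifs <;> omega
    · simp only [gen_C_zero_apply]; split_ifs <;> omega
    · simp only [gen_D_zero_apply]; split_ifs <;> omega
  | succ k => simp only [gen_succ_apply]; split_ifs <;> omega

theorem s_mul_s (X : CType) (i : ℕ) : s X i * s X i = 1 := by
  ext z
  exact gen_gen X i z

theorem s_mul_cancel (X : CType) (i : ℕ) (v : W X) : s X i * (s X i * v) = v := by
  rw [← mul_assoc, s_mul_s, one_mul]

/-- The simple root of index `i`, as the pair `rl < rr` of exchanged integers. -/
def rl : CType → ℕ → ℤ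
  | CType.D, 0 => -2
  | _, 0 => -1
  | _, k + 1 => k + 1

/-- The larger member of the pair. -/
def rr : ℕ → ℤ
  | 0 => 1
  | k + 1 => k + 2

theorem gen_rl (X : CType) (i : ℕ) : gen X i (rl X i) = rr i := by
  cases i with
  | zero => cases X <;> simp [gen_B_zero_apply, gen_C_zero_apply, gen_D_zero_apply, rl, rr]
  | succ k => cases X <;> simp [gen_succ_apply, rl, rr]

theorem gen_rr (X : CType) (i : ℕ) : gen X i (rr i) = rl X i := by
  rw [← gen_rl X i, gen_gen]

/-- The map exchanging `p, q` and `-p, -q`. -/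
def tr (p q z : ℤ) : ℤ :=
  if z = p then q else if z = q then p else if z = -p then -q else if z = -q then -p else z

theorem gen_tr (X : CType) (i : ℕ) (p q z : ℤ) :
    gen X i (tr p q z) = tr (gen X i p) (gen X i q) (gen X i z) := by
  have hinj := (gen X i).injective
  simp only [tr]
  by_cases h1 : z = p
  · simp [h1]
  by_cases h2 : z = q
  · subst h2
    simp [h1, hinj.eq_iff]
  by_cases h3 : z = -p
  · subst h3
    simp only [← gen_neg, hinj.eq_iff, h1, h2, if_true, if_false]
  by_cases h4 : z = -q
  · subst h4
    simp only [← gen_neg, hinj.eq_iff, h1, h2, h3, if_true, if_false]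
  simp only [← gen_neg, hinj.eq_iff, h1, h2, h3, h4, if_false]

theorem gen_eq_tr (X : CType) (i : ℕ) (z : ℤ) : gen X i z = tr (rl X i) (rr i) z := by
  cases i with
  | zero =>
    cases X
    · simp only [gen_B_zero_apply, tr, rl, rr]; split_ifs <;> omega
    · simp only [gen_C_zero_apply, tr, rl, rr]; split_ifs <;> omega
    · simp only [gen_D_zero_apply, tr, rl, rr]; split_ifs <;> omega
  | succ k => cases X <;> · simp only [gen_succ_apply, tr, rl, rr]; split_ifs <;> omega

theorem tr_neg (p q z : ℤ) (h : p ≠ 0) (h' : q ≠ 0) (hpq : p < q) :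
    tr (-q) (-p) z = tr p q z := by
  simp only [tr]; split_ifs <;> omega

/-- Pairs that are roots. -/
def IsRoot : CType → ℤ → ℤ → Prop
  | CType.D, p, q => p ≠ 0 ∧ q ≠ 0 ∧ p ≠ -q
  | _, p, q => p ≠ 0 ∧ q ≠ 0

theorem IsRoot.ne {X : CType} {p q : ℤ} (h : IsRoot X p q) : p ≠ 0 ∧ q ≠ 0 := by
  cases X
  · exact h
  · exact h
  · exact ⟨h.1, h.2.1⟩

theorem isRoot_simple (X : CType) (i : ℕ) : IsRoot X (rl X i) (rr i) ∧ rl X i < rr i := by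
  cases i <;> cases X <;> simp only [IsRoot, rl, rr] <;> omega

/-- A simple reflection makes no positive root negative except its own. -/
theorem gen_pos (X : CType) (i : ℕ) (p q : ℤ) (h : IsRoot X p q) (hpq : p < q) :
    (p = rl X i ∧ q = rr i) ∨ (p = -rr i ∧ q = -rl X i) ∨
      (IsRoot X (gen X i p) (gen X i q) ∧ gen X i p < gen X i q) := by
  cases i with
  | zero =>
    cases X
    · simp only [IsRoot, gen_B_zero_apply, rl, rr] at *; split_ifs <;> omega
    · simp only [IsRoot, gen_C_zero_apply, rl, rr] at *; split_ifs <;> omega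
    · simp only [IsRoot, gen_D_zero_apply, rl, rr] at *; split_ifs <;> omega
  | succ k =>
    cases X <;> (simp only [IsRoot, gen_succ_apply, rl, rr] at *; split_ifs <;> omega)

theorem wordProd_cons (X : CType) (i : ℕ) (ω : List ℕ) :
    wordProd X (i :: ω) = s X i * wordProd X ω := by
  simp [wordProd]

theorem s_coe_apply (X : CType) (i : ℕ) (v : W X) (z : ℤ) :
    (s X i * v : W X).1 z = gen X i (v.1 z) := rfl

theorem s_mul_symm_apply (X : CType) (i : ℕ) (v : W X) (z : ℤ) :
    (s X i * v : W X).1.symm z = v.1.symm (gen X i z) := by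
  rw [Equiv.symm_apply_eq, s_coe_apply, Equiv.apply_symm_apply, gen_gen]

theorem exchange (X : CType) (ω : List ℕ) : ∀ p q : ℤ, IsRoot X p q → p < q →
    (wordProd X ω).1.symm q < (wordProd X ω).1.symm p →
    ∃ ω' : List ℕ, ω'.length + 1 = ω.length ∧
      ∀ z, (wordProd X ω').1 z = tr p q ((wordProd X ω).1 z) := by
  induction ω with
  | nil =>
    intro p q _ hpq h
    have h' : q < p := h
    omega
  | cons j ω ih =>
    intro p q hr hpq h
    rw [wordProd_cons, s_mul_symm_apply, s_mul_symm_apply] at h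
    rcases gen_pos X j p q hr hpq with ⟨rfl, rfl⟩ | ⟨rfl, rfl⟩ | ⟨hr', hlt⟩
    · refine ⟨ω, rfl, fun z => ?_⟩
      rw [← gen_eq_tr, wordProd_cons, s_coe_apply, gen_gen]
    · refine ⟨ω, rfl, fun z => ?_⟩
      obtain ⟨h1, h2⟩ := isRoot_simple X j
      rw [tr_neg _ _ _ h1.ne.1 h1.ne.2 h2, ← gen_eq_tr, wordProd_cons, s_coe_apply, gen_gen]
    · obtain ⟨ω', hl, hω'⟩ := ih _ _ hr' hlt h
      refine ⟨j :: ω', by simp [hl], fun z => ?_⟩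
      rw [wordProd_cons, wordProd_cons, s_coe_apply, s_coe_apply, hω', gen_tr, gen_gen, gen_gen]

theorem s_inv (X : CType) (i : ℕ) : (s X i)⁻¹ = s X i :=
  inv_eq_of_mul_eq_one_left (s_mul_s X i)

theorem exists_word (X : CType) (w : W X) : ∃ ω : List ℕ, wordProd X ω = w := by
  obtain ⟨w, hw⟩ := w
  induction hw using Subgroup.closure_induction_left with
  | one => exact ⟨[], rfl⟩
  | mul_left g hg y hy ih =>
    obtain ⟨i, rfl⟩ := hg
    obtain ⟨ω, hω⟩ := ih
    exact ⟨i :: ω, by rw [wordProd_cons, hω]; rfl⟩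
  | inv_mul_cancel g hg y hy ih =>
    obtain ⟨i, rfl⟩ := hg
    obtain ⟨ω, hω⟩ := ih
    refine ⟨i :: ω, ?_⟩
    rw [wordProd_cons, hω, ← s_inv]
    rfl

theorem exists_word_len (X : CType) (w : W X) :
    ∃ ω : List ℕ, ω.length = len X w ∧ wordProd X ω = w := by
  obtain ⟨ω, hω⟩ := exists_word X w
  exact Nat.sInf_mem (s := {l | ∃ ω : List ℕ, ω.length = l ∧ wordProd X ω = w}) ⟨_, ω, rfl, hω⟩

theorem len_le (X : CType) (ω : List ℕ) : len X (wordProd X ω) ≤ ω.length :=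
  Nat.sInf_le ⟨ω, rfl, rfl⟩

theorem len_lt_of_descent (X : CType) (i : ℕ) (v : W X)
    (h : v.1.symm (rr i) < v.1.symm (rl X i)) : len X (s X i * v) < len X v := by
  obtain ⟨ω, hl, rfl⟩ := exists_word_len X v
  obtain ⟨hr, hlt⟩ := isRoot_simple X i
  obtain ⟨ω', hl', hω'⟩ := exchange X ω _ _ hr hlt h
  have : s X i * wordProd X ω = wordProd X ω' := by
    ext z
    rw [hω', ← gen_eq_tr, s_coe_apply]
  rw [this, ← hl]
  have := len_le X ω'
  omega

theorem descent_iff (X : CType) (i : ℕ) (v : W X) :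
    len X (s X i * v) < len X v ↔ v.1.symm (rr i) < v.1.symm (rl X i) := by
  refine ⟨fun h => ?_, len_lt_of_descent X i v⟩
  by_contra hn
  have hne : v.1.symm (rr i) ≠ v.1.symm (rl X i) := fun e =>
    absurd (v.1.symm.injective e) (isRoot_simple X i).2.ne'
  have h2 := len_lt_of_descent X i (s X i * v) (by
    rw [s_mul_symm_apply, s_mul_symm_apply, gen_rl, gen_rr]
    omega)
  rw [s_mul_cancel] at h2
  omega

theorem symm_neg (X : CType) (v : W X) (z : ℤ) : v.1.symm (-z) = -v.1.symm z := by
  obtain ⟨ω, rfl⟩ := exists_word X v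
  induction ω generalizing z with
  | nil => rfl
  | cons j ω ih => rw [wordProd_cons, s_mul_symm_apply, s_mul_symm_apply, gen_neg, ih]

theorem symm_ne (X : CType) (v : W X) {y z : ℤ} (h : y ≠ z) : v.1.symm y ≠ v.1.symm z :=
  fun e => h (v.1.symm.injective e)

theorem regOp_single (X : CType) (i : ℕ) (v : W X) (c : K) :
    regOp X i (Finsupp.single v c) = if len X (s X i * v) < len X v
      then Finsupp.single v (β * c) else Finsupp.single (s X i * v) c := by
  rw [regOp, Finsupp.linearCombination_single]
  split_ifs <;> simp [mul_comm]

theorem regOp_desc (X : CType) (i : ℕ) (v : W X) (c : K)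
    (h : v.1.symm (rr i) < v.1.symm (rl X i)) :
    regOp X i (Finsupp.single v c) = Finsupp.single v (β * c) := by
  rw [regOp_single, if_pos ((descent_iff X i v).2 h)]

theorem regOp_asc (X : CType) (i : ℕ) (v : W X) (c : K)
    (h : ¬ v.1.symm (rr i) < v.1.symm (rl X i)) :
    regOp X i (Finsupp.single v c) = Finsupp.single (s X i * v) c := by
  rw [regOp_single, if_neg fun h' => h ((descent_iff X i v).1 h')]

theorem regOp_quad (X : CType) (i : ℕ) : regOp X i * regOp X i = β • regOp X i := by
  refine Finsupp.lhom_ext fun v c => ?_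
  rw [Module.End.mul_apply, LinearMap.smul_apply]
  by_cases h : v.1.symm (rr i) < v.1.symm (rl X i)
  · rw [regOp_desc X i v _ h, regOp_desc X i v _ h, Finsupp.smul_single, smul_eq_mul]
  · rw [regOp_asc X i v _ h, regOp_desc, Finsupp.smul_single, smul_eq_mul]
    rw [s_mul_symm_apply, s_mul_symm_apply, gen_rl, gen_rr]
    have := symm_ne X v (isRoot_simple X i).2.ne
    omega

theorem s_mul_comm_of (X : CType) (i j : ℕ) (h1 : gen X i (rl X j) = rl X j)
    (h2 : gen X i (rr j) = rr j) : s X i * s X j = s X j * s X i := by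
  ext z
  change gen X i (gen X j z) = gen X j (gen X i z)
  rw [gen_eq_tr X j z, gen_tr, h1, h2, ← gen_eq_tr]

/-- The relation for two simple reflections that commute. -/
theorem regOp_comm (X : CType) (i j : ℕ) (hs : s X i * s X j = s X j * s X i)
    (hi : ∀ v : W X, (s X j * v).1.symm (rr i) < (s X j * v).1.symm (rl X i) ↔
      v.1.symm (rr i) < v.1.symm (rl X i))
    (hj : ∀ v : W X, (s X i * v).1.symm (rr j) < (s X i * v).1.symm (rl X j) ↔
      v.1.symm (rr j) < v.1.symm (rl X j)) :
    regOp X i * regOp X j = regOp X j * regOp X i := by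
  refine Finsupp.lhom_ext fun v c => ?_
  rw [Module.End.mul_apply, Module.End.mul_apply]
  by_cases h1 : v.1.symm (rr i) < v.1.symm (rl X i) <;>
    by_cases h2 : v.1.symm (rr j) < v.1.symm (rl X j)
  · simp only [regOp_desc X j v _ h2, regOp_desc X i v _ h1]
  · rw [regOp_asc X j v _ h2, regOp_desc X i v _ h1, regOp_asc X j v _ h2,
      regOp_desc X i _ _ ((hi v).2 h1)]
  · rw [regOp_desc X j v _ h2, regOp_asc X i v _ h1, regOp_asc X i v _ h1,
      regOp_desc X j _ _ ((hj v).2 h2)]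
  · rw [regOp_asc X j v _ h2, regOp_asc X i v _ h1, regOp_asc X j _ _ (mt (hj v).1 h2),
      regOp_asc X i _ _ (mt (hi v).1 h1), ← mul_assoc, ← mul_assoc, hs]

/-- The relation for two simple reflections whose product has order `3`. -/
theorem regOp_braid3 (X : CType) (i j : ℕ) (p q r : ℤ) (hpq : p ≠ q) (hqr : q ≠ r) (hpr : p ≠ r)
    (ip : gen X i p = q) (iq : gen X i q = p) (ir : gen X i r = r)
    (jp : gen X j p = p) (jq : gen X j q = r) (jr : gen X j r = q)
    (hs : s X i * (s X j * s X i) = s X j * (s X i * s X j))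
    (hi : ∀ v : W X, v.1.symm (rr i) < v.1.symm (rl X i) ↔ v.1.symm q < v.1.symm p)
    (hj : ∀ v : W X, v.1.symm (rr j) < v.1.symm (rl X j) ↔ v.1.symm r < v.1.symm q) :
    regOp X i * (regOp X j * regOp X i) = regOp X j * (regOp X i * regOp X j) := by
  have di : ∀ (v : W X) (c : K), v.1.symm q < v.1.symm p →
      regOp X i (Finsupp.single v c) = Finsupp.single v (β * c) :=
    fun v c h => regOp_desc X i v c ((hi v).2 h)
  have ai : ∀ (v : W X) (c : K), ¬ v.1.symm q < v.1.symm p →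
      regOp X i (Finsupp.single v c) = Finsupp.single (s X i * v) c :=
    fun v c h => regOp_asc X i v c (mt (hi v).1 h)
  have dj : ∀ (v : W X) (c : K), v.1.symm r < v.1.symm q →
      regOp X j (Finsupp.single v c) = Finsupp.single v (β * c) :=
    fun v c h => regOp_desc X j v c ((hj v).2 h)
  have aj : ∀ (v : W X) (c : K), ¬ v.1.symm r < v.1.symm q →
      regOp X j (Finsupp.single v c) = Finsupp.single (s X j * v) c :=
    fun v c h => regOp_asc X j v c (mt (hj v).1 h)
  have hs' : ∀ v : W X, s X i * (s X j * (s X i * v)) = s X j * (s X i * (s X j * v)) := by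
    intro v
    simpa only [mul_assoc] using congrArg (· * v) hs
  refine Finsupp.lhom_ext fun v c => ?_
  simp only [Module.End.mul_apply]
  have n1 := symm_ne X v hpq
  have n2 := symm_ne X v hqr
  have n3 := symm_ne X v hpr
  by_cases h1 : v.1.symm q < v.1.symm p <;> by_cases h2 : v.1.symm r < v.1.symm q <;>
    by_cases h3 : v.1.symm r < v.1.symm p <;> first
    | omega
    | (simp (disch := ((try simp only [s_mul_symm_apply, ip, iq, ir, jp, jq, jr]); omega))
        only [di, ai, dj, aj, hs'])

/-- The relation for `s₀` and `s₁` in types `B` and `C`. -/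
theorem regOp_braid4 (X : CType) (i j : ℕ)
    (i1 : gen X i 1 = -1) (i2 : gen X i 2 = 2)
    (j1 : gen X j 1 = 2) (j2 : gen X j 2 = 1)
    (hs : s X i * (s X j * (s X i * s X j)) = s X j * (s X i * (s X j * s X i)))
    (hi : ∀ v : W X, v.1.symm (rr i) < v.1.symm (rl X i) ↔ v.1.symm 1 < 0)
    (hj : ∀ v : W X, v.1.symm (rr j) < v.1.symm (rl X j) ↔ v.1.symm 2 < v.1.symm 1) :
    regOp X i * (regOp X j * (regOp X i * regOp X j)) =
      regOp X j * (regOp X i * (regOp X j * regOp X i)) := by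
  have di : ∀ (v : W X) (c : K), v.1.symm 1 < 0 →
      regOp X i (Finsupp.single v c) = Finsupp.single v (β * c) :=
    fun v c h => regOp_desc X i v c ((hi v).2 h)
  have ai : ∀ (v : W X) (c : K), ¬ v.1.symm 1 < 0 →
      regOp X i (Finsupp.single v c) = Finsupp.single (s X i * v) c :=
    fun v c h => regOp_asc X i v c (mt (hi v).1 h)
  have dj : ∀ (v : W X) (c : K), v.1.symm 2 < v.1.symm 1 →
      regOp X j (Finsupp.single v c) = Finsupp.single v (β * c) :=
    fun v c h => regOp_desc X j v c ((hj v).2 h)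
  have aj : ∀ (v : W X) (c : K), ¬ v.1.symm 2 < v.1.symm 1 →
      regOp X j (Finsupp.single v c) = Finsupp.single (s X j * v) c :=
    fun v c h => regOp_asc X j v c (mt (hj v).1 h)
  have hs' : ∀ v : W X, s X i * (s X j * (s X i * (s X j * v))) =
      s X j * (s X i * (s X j * (s X i * v))) := by
    intro v
    simpa only [mul_assoc] using congrArg (· * v) hs
  refine Finsupp.lhom_ext fun v c => ?_
  simp only [Module.End.mul_apply]
  have n1 : v.1.symm 1 ≠ v.1.symm 2 := symm_ne X v (by norm_num)
  have n2 : v.1.symm 1 ≠ v.1.symm (-1) := symm_ne X v (by norm_num)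
  have n3 : v.1.symm 2 ≠ v.1.symm (-2) := symm_ne X v (by norm_num)
  have n4 : v.1.symm 1 ≠ v.1.symm (-2) := symm_ne X v (by norm_num)
  rw [symm_neg] at n2 n3 n4
  by_cases h1 : v.1.symm 1 < 0 <;> by_cases h2 : v.1.symm 2 < v.1.symm 1 <;>
    by_cases h3 : v.1.symm 2 < 0 <;> by_cases h4 : v.1.symm 1 + v.1.symm 2 < 0 <;> first
    | omega
    | (simp (disch := ((try simp only [s_mul_symm_apply, gen_neg, symm_neg, i1, i2, j1, j2]); omega))
        only [di, ai, dj, aj, hs'])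

theorem s_mul_ne_one (X : CType) (i j : ℕ) (z : ℤ) (h : gen X i z ≠ gen X j z) :
    s X i * s X j ≠ 1 := by
  intro e
  have e' := mul_eq_one_iff_eq_inv.1 e
  rw [s_inv] at e'
  exact h (congrArg (fun w : W X => w.1 z) e')

/-- The operators satisfy the relation for `i` and `j`. -/
def Braids (X : CType) (i j : ℕ) : Prop :=
  alt (regOp X i) (regOp X j) (orderOf (s X i * s X j)) =
    alt (regOp X j) (regOp X i) (orderOf (s X i * s X j))

theorem Braids.symm {X : CType} {i j : ℕ} (h : Braids X i j) : Braids X j i := by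
  have e : orderOf (s X j * s X i) = orderOf (s X i * s X j) := by
    rw [← orderOf_inv, mul_inv_rev, s_inv, s_inv]
  rw [Braids, e]
  exact Eq.symm h

theorem braids_comm (X : CType) (i j : ℕ) (z : ℤ) (hz : gen X i z ≠ gen X j z)
    (hs : s X i * s X j = s X j * s X i)
    (hi : ∀ v : W X, (s X j * v).1.symm (rr i) < (s X j * v).1.symm (rl X i) ↔
      v.1.symm (rr i) < v.1.symm (rl X i))
    (hj : ∀ v : W X, (s X i * v).1.symm (rr j) < (s X i * v).1.symm (rl X j) ↔
      v.1.symm (rr j) < v.1.symm (rl X j)) : Braids X i j := by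
  have e : orderOf (s X i * s X j) = 2 := by
    refine orderOf_eq_prime ?_ (s_mul_ne_one X i j z hz)
    rw [sq, mul_assoc, hs, s_mul_cancel, s_mul_s]
  rw [Braids, e]
  simpa only [alt, mul_one] using regOp_comm X i j hs hi hj

theorem braids_comm_fix (X : CType) (i j : ℕ) (h1 : gen X i (rl X j) = rl X j)
    (h2 : gen X i (rr j) = rr j) (h3 : gen X j (rl X i) = rl X i)
    (h4 : gen X j (rr i) = rr i) : Braids X i j := by
  refine braids_comm X i j (rl X j) ?_ (s_mul_comm_of X i j h1 h2) ?_ ?_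
  · rw [h1, gen_rl]
    exact (isRoot_simple X j).2.ne
  · intro v
    rw [s_mul_symm_apply, s_mul_symm_apply, h3, h4]
  · intro v
    rw [s_mul_symm_apply, s_mul_symm_apply, h1, h2]

theorem braids_three (X : CType) (i j : ℕ) (p q r : ℤ) (hpq : p ≠ q) (hqr : q ≠ r) (hpr : p ≠ r)
    (ip : gen X i p = q) (iq : gen X i q = p) (ir : gen X i r = r)
    (jp : gen X j p = p) (jq : gen X j q = r) (jr : gen X j r = q)
    (hs : s X i * (s X j * s X i) = s X j * (s X i * s X j))
    (hi : ∀ v : W X, v.1.symm (rr i) < v.1.symm (rl X i) ↔ v.1.symm q < v.1.symm p)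
    (hj : ∀ v : W X, v.1.symm (rr j) < v.1.symm (rl X j) ↔ v.1.symm r < v.1.symm q) :
    Braids X i j := by
  have e : orderOf (s X i * s X j) = 3 := by
    refine orderOf_eq_prime ?_ (s_mul_ne_one X i j p (by rw [ip, jp]; exact hpq.symm))
    have : (s X i * s X j) ^ 3 = (s X i * (s X j * s X i)) * (s X j * (s X i * s X j)) := by
      simp only [pow_succ, pow_zero, one_mul, mul_assoc]
    rw [this, ← hs, mul_assoc, mul_assoc, s_mul_cancel, s_mul_cancel, s_mul_s]
  rw [Braids, e]
  simpa only [alt, mul_one] using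
    regOp_braid3 X i j p q r hpq hqr hpr ip iq ir jp jq jr hs hi hj

theorem braids_four (X : CType) (i j : ℕ)
    (i1 : gen X i 1 = -1) (i2 : gen X i 2 = 2)
    (j1 : gen X j 1 = 2) (j2 : gen X j 2 = 1)
    (hs : s X i * (s X j * (s X i * s X j)) = s X j * (s X i * (s X j * s X i)))
    (hi : ∀ v : W X, v.1.symm (rr i) < v.1.symm (rl X i) ↔ v.1.symm 1 < 0)
    (hj : ∀ v : W X, v.1.symm (rr j) < v.1.symm (rl X j) ↔ v.1.symm 2 < v.1.symm 1) :
    Braids X i j := by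
  have e : orderOf (s X i * s X j) = 4 := by
    refine orderOf_eq_prime_pow (p := 2) (n := 1) ?_ ?_
    · intro h
      have h' := congrArg (fun w : W X => w.1 1) h
      have h'' : gen X i (gen X j (gen X i (gen X j 1))) = 1 := h'
      rw [j1, i2, j2, i1] at h''
      omega
    · have : (s X i * s X j) ^ 2 ^ (1 + 1) =
          (s X i * (s X j * (s X i * s X j))) * (s X i * (s X j * (s X i * s X j))) := by
        norm_num only [pow_succ, pow_zero, one_mul, mul_assoc]
      rw [this]
      nth_rw 2 [hs]
      simp only [mul_assoc, s_mul_cancel, s_mul_s]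
  rw [Braids, e]
  simpa only [alt, mul_one] using regOp_braid4 X i j i1 i2 j1 j2 hs hi hj

theorem braids_zero_one_BC (X : CType)
    (h0 : ∀ z, gen X 0 z = if z = -1 then 1 else if z = 1 then -1 else z)
    (hl : rl X 0 = -1) (hl1 : rl X 1 = 1) : Braids X 0 1 := by
  have h1 := gen_succ_apply X 0
  simp only [zero_add, Nat.cast_zero] at h1
  refine braids_four X 0 1 (by simp [h0]) (by simp [h0]) (by simp [h1]) (by simp [h1]) ?_ ?_ ?_
  · ext z
    change gen X 0 (gen X 1 (gen X 0 (gen X 1 z))) = gen X 1 (gen X 0 (gen X 1 (gen X 0 z)))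
    by_cases c1 : z = 1
    · subst c1; simp [h0, h1]
    by_cases c2 : z = 2
    · subst c2; simp [h0, h1]
    by_cases c3 : z = -1
    · subst c3; simp [h0, h1]
    by_cases c4 : z = -2
    · subst c4; simp [h0, h1]
    · simp [h0, h1, c1, c2, c3, c4]
  · intro v
    rw [hl, symm_neg]
    simp only [rr]
    omega
  · intro v
    rw [hl1]
    simp [rr]

theorem braids_zero_two_add (X : CType) (k : ℕ) (hX : X ≠ CType.D ∨ 1 ≤ k) :
    Braids X 0 (k + 2) := by
  apply braids_comm_fix
  · cases X <;> simp only [gen_B_zero_apply, gen_C_zero_apply, gen_D_zero_apply, rl] <;>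
      split_ifs <;> simp at hX <;> omega
  · cases X <;> simp only [gen_B_zero_apply, gen_C_zero_apply, gen_D_zero_apply, rr] <;>
      split_ifs <;> simp at hX <;> omega
  · cases X <;> simp only [gen_succ_apply, rl] <;> split_ifs <;> simp at hX <;> omega
  · cases X <;> simp only [gen_succ_apply, rr] <;> split_ifs <;> omega

theorem braids_zero_one_D : Braids CType.D 0 1 := by
  have h1 := gen_succ_apply CType.D 0
  simp only [zero_add, Nat.cast_zero] at h1
  have h0 := gen_D_zero_apply
  refine braids_comm CType.D 0 1 1 (by simp [h0, h1]) ?_ ?_ ?_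
  · ext z
    change gen CType.D 0 (gen CType.D 1 z) = gen CType.D 1 (gen CType.D 0 z)
    by_cases c1 : z = 1
    · subst c1; simp [h0, h1]
    by_cases c2 : z = 2
    · subst c2; simp [h0, h1]
    by_cases c3 : z = -1
    · subst c3; simp [h0, h1]
    by_cases c4 : z = -2
    · subst c4; simp [h0, h1]
    · simp [h0, h1, c1, c2, c3, c4]
  · intro v
    rw [s_mul_symm_apply, s_mul_symm_apply]
    simp only [rl, rr, gen_neg, symm_neg]
    simp [h1]
    omega
  · intro v
    rw [s_mul_symm_apply, s_mul_symm_apply]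
    have e1 : rl CType.D 1 = 1 := rfl
    have e2 : rr 1 = 2 := rfl
    rw [e1, e2]
    simp [h0, symm_neg]

theorem braids_two_zero_D : Braids CType.D 2 0 := by
  have h1 := gen_succ_apply CType.D 1
  simp only [Nat.reduceAdd, Nat.cast_one] at h1
  have h0 := gen_D_zero_apply
  refine braids_three CType.D 2 0 (-3) (-2) 1 (by norm_num) (by norm_num) (by norm_num)
    (by simp [h1]) (by simp [h1]) (by simp [h1]) (by simp [h0]) (by simp [h0]) (by simp [h0])
    ?_ ?_ ?_
  · ext z
    change gen CType.D 2 (gen CType.D 0 (gen CType.D 2 z)) =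
      gen CType.D 0 (gen CType.D 2 (gen CType.D 0 z))
    by_cases c1 : z = 1
    · subst c1; simp [h0, h1]
    by_cases c2 : z = 2
    · subst c2; simp [h0, h1]
    by_cases c3 : z = -1
    · subst c3; simp [h0, h1]
    by_cases c4 : z = -2
    · subst c4; simp [h0, h1]
    by_cases c5 : z = 3
    · subst c5; simp [h0, h1]
    by_cases c6 : z = -3
    · subst c6; simp [h0, h1]
    · simp [h0, h1, c1, c2, c3, c4, c5, c6]
  · intro v
    have e1 : rl CType.D 2 = 2 := rfl
    have e2 : rr 2 = 3 := rfl
    rw [e1, e2, symm_neg, symm_neg]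
    omega
  · intro v
    rfl

theorem braids_succ_succ (X : CType) (k l : ℕ) (h : k < l) : Braids X (k + 1) (l + 1) := by
  by_cases hl : l = k + 1
  · subst hl
    have h1 := gen_succ_apply X k
    have h2 := gen_succ_apply X (k + 1)
    push_cast at h2
    refine braids_three X (k + 1) (k + 1 + 1) (k + 1) (k + 2) (k + 3)
      (by omega) (by omega) (by omega) ?_ ?_ ?_ ?_ ?_ ?_ ?_ ?_ ?_
    · rw [h1]; split_ifs <;> omega
    · rw [h1]; split_ifs <;> omega
    · rw [h1]; split_ifs <;> omega
    · rw [h2]; split_ifs <;> omega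
    · rw [h2]; split_ifs <;> omega
    · rw [h2]; split_ifs <;> omega
    · ext z
      change gen X (k + 1) (gen X (k + 1 + 1) (gen X (k + 1) z)) =
        gen X (k + 1 + 1) (gen X (k + 1) (gen X (k + 1 + 1) z))
      have e1 : rl X (k + 1 + 1) = k + 2 := by cases X <;> simp only [rl] <;> push_cast <;> ring
      have e2 : rr (k + 1 + 1) = k + 3 := by simp only [rr]; push_cast; ring
      have e3 : rl X (k + 1) = k + 1 := by cases X <;> rfl
      have e4 : rr (k + 1) = k + 2 := rfl
      rw [gen_eq_tr X (k + 1 + 1) (gen X (k + 1) z), gen_tr, gen_gen,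
        gen_eq_tr X (k + 1) (gen X (k + 1 + 1) z), gen_tr, gen_gen, e1, e2, e3, e4]
      have f1 : gen X (k + 1) (k + 2) = k + 1 := by rw [h1]; split_ifs <;> omega
      have f2 : gen X (k + 1) (k + 3) = k + 3 := by rw [h1]; split_ifs <;> omega
      have f3 : gen X (k + 1 + 1) (k + 1) = k + 1 := by rw [h2]; split_ifs <;> omega
      have f4 : gen X (k + 1 + 1) (k + 2) = k + 3 := by rw [h2]; split_ifs <;> omega
      rw [f1, f2, f3, f4]
    · intro v
      cases X <;> rfl
    · intro v
      have e1 : rl X (k + 1 + 1) = k + 2 := by cases X <;> simp only [rl] <;> push_cast <;> ring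
      have e2 : rr (k + 1 + 1) = k + 3 := by simp only [rr]; push_cast; ring
      rw [e1, e2]
  · apply braids_comm_fix
    · cases X <;> simp only [gen_succ_apply, rl] <;> split_ifs <;> omega
    · cases X <;> simp only [gen_succ_apply, rr] <;> split_ifs <;> omega
    · cases X <;> simp only [gen_succ_apply, rl] <;> split_ifs <;> omega
    · cases X <;> simp only [gen_succ_apply, rr] <;> split_ifs <;> omega

theorem braids_of_lt (X : CType) (i j : ℕ) (h : i < j) : Braids X i j := by
  match i, j, h with
  | k + 1, l + 1, h => exact braids_succ_succ X k l (by omega)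
  | 0, 1, _ =>
    cases X
    · exact braids_zero_one_BC _ gen_B_zero_apply rfl rfl
    · exact braids_zero_one_BC _ gen_C_zero_apply rfl rfl
    · exact braids_zero_one_D
  | 0, 2, _ =>
    cases X
    · exact braids_zero_two_add _ 0 (by simp)
    · exact braids_zero_two_add _ 0 (by simp)
    · exact braids_two_zero_D.symm
  | 0, k + 3, _ => exact braids_zero_two_add X (k + 1) (by simp)

theorem braids (X : CType) (i j : ℕ) : Braids X i j := by
  rcases lt_trichotomy i j with h | rfl | h
  · exact braids_of_lt X i j h
  · rfl
  · exact (braids_of_lt X j i h).symm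

theorem map_alt {M N H : Type*} [Monoid M] [Monoid N] [FunLike H M N] [MonoidHomClass H M N]
    (f : H) (y z : M) (m : ℕ) :
    f (alt y z m) = alt (f y) (f z) m := by
  induction m generalizing y z with
  | zero => exact map_one f
  | succ m ih => rw [alt, alt, map_mul, ih]

theorem lift_regOp_rel (X : CType) ⦃y z : FreeAlgebra K ℕ⦄ (h : IdRel X y z) :
    FreeAlgebra.lift K (regOp X) y = FreeAlgebra.lift K (regOp X) z := by
  cases h with
  | quad i => simpa using regOp_quad X i
  | braid i j =>
    rw [map_alt, map_alt, FreeAlgebra.lift_ι_apply, FreeAlgebra.lift_ι_apply]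
    exact braids X i j

/-- The left regular representation of the idCoxeter algebra. -/
def reg (X : CType) : IdAlg X →ₐ[K] Module.End K (W X →₀ K) :=
  RingQuot.liftAlgHom K ⟨FreeAlgebra.lift K (regOp X), lift_regOp_rel X⟩

theorem reg_u (X : CType) (i : ℕ) : reg X (u X i) = regOp X i := by
  rw [reg, u, RingQuot.liftAlgHom_mkAlgHom_apply, FreeAlgebra.lift_ι_apply]

/-- The coefficient of `u_w`, see `coeff_reduced`. -/
def coeff (X : CType) (w : W X) : IdAlg X →ₗ[K] K :=
  (Finsupp.lapply w).comp ((LinearMap.applyₗ (Finsupp.single (1 : W X) (1 : K))).comp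
    (reg X).toLinearMap)

/-- If `v = s_{i₁} ⋯ s_{i_l}` is reduced, then `u_v = u_{i₁} ⋯ u_{i_l}` has coefficient `1` at
`v` and `0` at all other elements: the functional `coeff X w` is dual to the basis `(u_v)`. -/
theorem coeff_reduced (X : CType) (w : W X) (ω : List ℕ) (h : IsReducedWord X ω) :
    coeff X w (ω.map (u X)).prod = (Finsupp.single (wordProd X ω) (1 : K)) w := by
  have key : reg X (ω.map (u X)).prod (Finsupp.single 1 1) =
      Finsupp.single (wordProd X ω) (1 : K) := by
    induction ω with
    | nil => simp [wordProd]
    | cons i ω ih =>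
      have hω : IsReducedWord X ω := by
        intro ω' e
        have := h (i :: ω') (by rw [wordProd_cons, wordProd_cons, e])
        simpa using this
      rw [List.map_cons, List.prod_cons, map_mul, Module.End.mul_apply, ih hω, reg_u,
        regOp_single, if_neg, wordProd_cons]
      intro hlt
      obtain ⟨ω', hl, hω'⟩ := exists_word_len X (s X i * wordProd X ω)
      have h1 := h ω' (by rw [wordProd_cons, hω'])
      have h2 := len_le X ω
      rw [List.length_cons] at h1
      omega
  exact congrArg (fun f : W X →₀ K => f w) key

/-! ### Double Grothendieck polynomials -/

/-- `h_i(t) = 1 + t u_i`. -/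
def h (X : CType) (i : ℕ) (t : K) : IdAlg X := 1 + t • u X i

/-- `h_i(t) h_{i+1}(t) ⋯ h_{n-1}(t)`. -/
def ascProd (X : CType) (n i : ℕ) (t : K) : IdAlg X :=
  ((List.range' i (n - i)).map fun k => h X k t).prod

/-- `A_i^{(n)}(t) = h_{n-1}(t) h_{n-2}(t) ⋯ h_i(t)`. -/
def A (X : CType) (n i : ℕ) (t : K) : IdAlg X :=
  ((List.range' i (n - i)).reverse.map fun k => h X k t).prod

/-- `F_n^X(t)`; for type `D`, `n ≥ 2`. -/
def F (X : CType) (n : ℕ) (t : K) : IdAlg X :=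
  match X with
  | CType.B => A CType.B n 1 t * h CType.B 0 t * ascProd CType.B n 1 t
  | CType.C => A CType.C n 1 t * h CType.C 0 t ^ 2 * ascProd CType.C n 1 t
  | CType.D => A CType.D n 2 t * (h CType.D 1 t * h CType.D 0 t) * ascProd CType.D n 2 t

/-- `F_n^X(x₁, …, x_n) = F_n^X(x₁) ⋯ F_n^X(x_n)`. -/
def Fx (X : CType) (n : ℕ) : IdAlg X := ((List.range n).map fun k => F X n (x k)).prod

/-- `G_{A_{n-1}}(c₁, …, c_{n-1}) = A_1^{(n)}(c₁) A_2^{(n)}(c₂) ⋯ A_{n-1}^{(n)}(c_{n-1})`,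
where `c k` is `c_{k+1}`. -/
def GA (X : CType) (n : ℕ) (c : ℕ → K) : IdAlg X :=
  ((List.range (n - 1)).map fun k => A X n (k + 1) (c k)).prod

/-- `G_n^X(a, b; x) = G_{A_{n-1}}(b̄)⁻¹ F_n^X(x₁, …, x_n) G_{A_{n-1}}(a)`. -/
def G (X : CType) (n : ℕ) : IdAlg X :=
  Ring.inverse (GA X n fun k => bar (b k)) * Fx X n * GA X n a

/-- `𝒢^X_{n,w}(a, b; x)`, the coefficient of `u_w` in `G_n^X(a, b; x)`. -/
def GPoly (X : CType) (n : ℕ) (w : W X) : K := coeff X w (G X n)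

/-! ### Inverse limits -/

open Classical in
/-- The substitution `x_{m+1} = x_{m+2} = ⋯ = 0`. -/
def trunc (m : ℕ) : P →ₐ[ℤ] P :=
  MvPolynomial.aeval fun v : Var =>
    match v with
    | Var.x k => if k < m then MvPolynomial.X (Var.x k) else 0
    | v => MvPolynomial.X v

/-- Elements of the inverse limit over `m` of the rings `ℤ[β, a, b][x₁, …, x_m]` along the
substitutions `x_{m+1} = 0`: families `f` with `f m` the component in `x₁, …, x_m`. -/
structure InvLim where
  /-- The component in `x₁, …, x_m`. -/
  comp : ℕ → P
  /-- Setting `x_{m+1} = x_{m+2} = ⋯ = 0` in a later component gives the `m`-th one. -/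
  compat : ∀ ⦃m n : ℕ⦄, m ≤ n → trunc m (comp n) = comp m

/-- `f` is `𝒢^X_w(a, b; x)`, the limit of the `𝒢^X_{n,w}(a, b; x)` over all `n` with
`w ∈ W(X_n)`. -/
def IsDoubleGrothendieck (X : CType) (w : W X) (f : InvLim) : Prop :=
  ∀ n : ℕ, 1 ≤ n → (X = CType.D → 2 ≤ n) → w ∈ Wfin X n →
    algebraMap P K (f.comp n) = GPoly X n w

/-! ### The functions `GP` and `GQ` -/

/-- `[t|c]^k = (t ⊕ c₁) ⋯ (t ⊕ c_k)`, where `c i` is `c_{i+1}`. -/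
def powP (c : ℕ → K) (t : K) (k : ℕ) : K := ∏ i ∈ Finset.range k, oplus t (c i)

/-- `[[t|c]]^k = (t ⊕ t) (t ⊕ c₁) ⋯ (t ⊕ c_{k-1})`, for `k ≥ 1`. -/
def powQ (c : ℕ → K) (t : K) (k : ℕ) : K :=
  oplus t t * ∏ i ∈ Finset.range (k - 1), oplus t (c i)

/-- The symmetrization common to `GP` and `GQ`, for `λ` of length `r ≤ n`:
`1/(n-r)! ∑_{σ ∈ S_n} σ (∏_{i ≤ r} (pow x_i λ_i ∏_{i < j ≤ n} (x_i ⊕ x_j) / (x_i ⊖ x_j)))`. -/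
def symmetrize (pow : K → ℕ → K) (n : ℕ) (lam : List ℕ) : K :=
  (((n - lam.length).factorial : ℕ) : K)⁻¹ *
    ∑ σ : Equiv.Perm (Fin n), ∏ i ∈ Finset.univ.filter fun i : Fin n => (i : ℕ) < lam.length,
      (pow (x (σ i)) (lam.getD i 0) *
        ∏ j ∈ Finset.Ioi i, oplus (x (σ i)) (x (σ j)) / ominus (x (σ i)) (x (σ j)))

/-- `GP_λ(x₁, …, x_n | c)`. -/
def GPfin (n : ℕ) (lam : List ℕ) (c : ℕ → K) : K := symmetrize (powP c) n lam

/-- `GQ_λ(x₁, …, x_n | c)`. -/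
def GQfin (n : ℕ) (lam : List ℕ) (c : ℕ → K) : K := symmetrize (powQ c) n lam

/-- `f` is `GP_λ(x|c)`, the limit of the `GP_λ(x₁, …, x_{2m} | c)`. -/
def IsGP (lam : List ℕ) (c : ℕ → K) (f : InvLim) : Prop :=
  ∀ m : ℕ, lam.length ≤ 2 * m → algebraMap P K (f.comp (2 * m)) = GPfin (2 * m) lam c

/-- `f` is `GQ_λ(x|c)`, the limit of the `GQ_λ(x₁, …, x_n | c)`. -/
def IsGQ (lam : List ℕ) (c : ℕ → K) (f : InvLim) : Prop :=
  ∀ n : ℕ, lam.length ≤ n → algebraMap P K (f.comp n) = GQfin n lam c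

/-- The sequence `0, b₁, b₂, …`. -/
def zeroB : ℕ → K
  | 0 => 0
  | k + 1 => b k

end KGroth

end

/-!
The functions on sign patterns (sets of integers containing one of `z`, `-z` for each `z ≠ 0`)
carry an action of the idCoxeter algebra, obtained from the regular representation by dividing by
the left ideal generated by `u₁, u₂, …`.  The coefficients of `u_w` for Grassmannian `w` survive:
they are the values at the sign pattern of `w`, and a Grassmannian `w` is determined by its sign
pattern (`proj`, `proj_regOp`, `proj_apply_negSet`).  The factor `G_A(a)` fixes the vector of the
identity, so the `𝒢_w` do not depend on `a`, and the inverse of `G_A(b̄)` is the product of the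
`Ã_i(b_i) = h_i(b_i) ⋯ h_{n-1}(b_i)` for decreasing `i`.

Write `F_n(t) = A₁(t) T(t) Ã₁(t)`, where `T(t)` is `h₀(t)`, `h₀(t ⊕ t)` in types `B`, `C`.  In type
`D` the diagram automorphism `τ` acts on sign patterns by the change of sign of `1`, one has
`h_{1̂}(t) = τ h₁(t) τ`, and, up to a factor `τ` which cancels for an even number of variables, the
same holds with `T(t) = τ`.  By the Yang–Baxter equation (`ascs_desc_asc`)
`Ã_{n-1}(b_{n-1}) ⋯ Ã₁(b₁) F_n(t) = h_{n-1}(b_{n-1} ⊕ t) ⋯ h₁(b₁ ⊕ t) T(t) Ã_{n-1}(b_{n-2}) ⋯ Ã₁(t)`,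
so a variable `t` is removed at the price of putting `t` in front of the parameters `b`.

The vector of the functions `GP` or `GQ` (`symSum`) obeys the same recursion (`symSum_insert`).
Exchanging the neighbouring parameters `c_i`, `c_{i+1}` amounts to applying `h_i(c_i ⊖ c_{i+1})`
(`symSum_swap`), and if `c₁ = ⊖ t` for a variable `t`, then removing `t` and changing `c₁` to `t`
amounts to applying `T(t)` (`symSum_insert_bar`); the latter reduces to one-row functions, which
partial fractions give in closed form (`wtSum`).  As rank `n` involves only `c₁, …, c_{n-1}`, one
may take `c_n = ⊖ t` and move it to the front.  Induction on the number of variables then shows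
`ascs_foldr_eq_symSum`.  The symmetrized sums are visibly independent of the rank, and the factors
`F_n(t)` are `1` at `t = 0`, so the inverse limits exist.
-/

noncomputable section

namespace KGroth

/-! ### Sign patterns and the operators of the simple reflections -/

/-- A sign pattern: a set of integers containing exactly one of `z`, `-z` for each `z ≠ 0`, and
not `0`.  The pattern of a signed permutation `v` is `{z | v⁻¹ z < 0}`; its positive members are
the barred entries in the one-line notation of `v`. -/
@[ext] structure Signs where
  /-- The underlying set of integers. -/
  carrier : Set ℤ
  zero_notMem : (0 : ℤ) ∉ carrier
  neg_mem_iff' : ∀ z : ℤ, z ≠ 0 → (-z ∈ carrier ↔ z ∉ carrier)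

instance : Membership ℤ Signs := ⟨fun J z => z ∈ J.carrier⟩

theorem Signs.neg_mem_iff (J : Signs) {z : ℤ} (hz : z ≠ 0) : -z ∈ J ↔ z ∉ J :=
  J.neg_mem_iff' z hz

theorem Signs.ext_mem {J J' : Signs} (h : ∀ z, z ∈ J ↔ z ∈ J') : J = J' :=
  Signs.ext (Set.ext h)

theorem Signs.ext_pos {J J' : Signs} (h : ∀ k : ℕ, 1 ≤ k → ((k : ℤ) ∈ J ↔ (k : ℤ) ∈ J')) :
    J = J' := by
  refine Signs.ext_mem fun z => ?_
  rcases lt_trichotomy z 0 with hz | rfl | hz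
  · obtain ⟨k, hk⟩ := Int.exists_eq_neg_ofNat hz.le
    subst hk
    rw [J.neg_mem_iff (by omega), J'.neg_mem_iff (by omega), h k (by omega)]
  · exact iff_of_false J.zero_notMem J'.zero_notMem
  · obtain ⟨k, rfl⟩ := Int.eq_ofNat_of_zero_le hz.le
    exact h k (by omega)

/-- The simple reflection `s_i` acting on sign patterns. -/
def act (X : CType) (i : ℕ) (J : Signs) : Signs where
  carrier := gen X i ⁻¹' J.carrier
  zero_notMem := by
    have h0 : gen X i 0 = 0 := by
      have := gen_neg X i 0
      rw [neg_zero] at this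
      omega
    rw [Set.mem_preimage, h0]
    exact J.zero_notMem
  neg_mem_iff' z hz := by
    have h0 : gen X i 0 = 0 := by
      have := gen_neg X i 0
      rw [neg_zero] at this
      omega
    rw [Set.mem_preimage, Set.mem_preimage, gen_neg]
    exact J.neg_mem_iff' _ fun e => hz ((gen X i).injective (e.trans h0.symm))

@[simp] theorem mem_act {X : CType} {i : ℕ} {J : Signs} {z : ℤ} :
    z ∈ act X i J ↔ gen X i z ∈ J := Iff.rfl

@[simp] theorem act_act (X : CType) (i : ℕ) (J : Signs) : act X i (act X i J) = J :=
  Signs.ext_mem fun z => by rw [mem_act, mem_act, gen_gen]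

open Classical in
/-- The operator by which `h_i(t) = 1 + t u_i` acts on functions of sign patterns. -/
def hop {R : Type*} [CommRing R] (β₀ : R) (X : CType) (i : ℕ) (t : R) (f : Signs → R) :
    Signs → R :=
  fun J => if rr i ∈ J ∧ rl X i ∉ J then (1 + β₀ * t) * f J + t * f (act X i J) else f J

section Hop

variable {R : Type*} [CommRing R] (β₀ : R) (X : CType)

theorem hop_of_mem {i : ℕ} {t : R} {f : Signs → R} {J : Signs} (h : rr i ∈ J ∧ rl X i ∉ J) :
    hop β₀ X i t f J = (1 + β₀ * t) * f J + t * f (act X i J) := if_pos h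

theorem hop_of_notMem {i : ℕ} {t : R} {f : Signs → R} {J : Signs}
    (h : ¬ (rr i ∈ J ∧ rl X i ∉ J)) : hop β₀ X i t f J = f J := if_neg h

theorem hop_zero (i : ℕ) (f : Signs → R) : hop β₀ X i 0 f = f := by
  funext J
  simp [hop]

theorem hop_map {R' : Type*} [CommRing R'] (φ : R →+* R') (i : ℕ) (t : R) (f : Signs → R) :
    φ ∘ hop β₀ X i t f = hop (φ β₀) X i (φ t) (φ ∘ f) := by
  funext J
  simp only [hop, Function.comp_apply]
  split_ifs <;> simp

/-- `h_i(s) h_i(t) = h_i(s ⊕ t)`. -/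
theorem hop_hop (i : ℕ) (s t : R) (f : Signs → R) :
    hop β₀ X i s (hop β₀ X i t f) = hop β₀ X i (s + t + β₀ * s * t) f := by
  funext J
  by_cases h : rr i ∈ J ∧ rl X i ∉ J
  · have h' : ¬ (rr i ∈ act X i J ∧ rl X i ∉ act X i J) := by
      rw [mem_act, mem_act, gen_rr, gen_rl]
      exact fun h'' => h.2 h''.1
    rw [hop_of_mem _ _ h, hop_of_mem _ _ h, hop_of_mem _ _ h, hop_of_notMem _ _ h']
    ring
  · rw [hop_of_notMem _ _ h, hop_of_notMem _ _ h, hop_of_notMem _ _ h]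

theorem hop_comm_of {i j : ℕ} (hs : ∀ J, act X i (act X j J) = act X j (act X i J))
    (hi : ∀ J, (rr i ∈ act X j J ∧ rl X i ∉ act X j J) ↔ (rr i ∈ J ∧ rl X i ∉ J))
    (hj : ∀ J, (rr j ∈ act X i J ∧ rl X j ∉ act X i J) ↔ (rr j ∈ J ∧ rl X j ∉ J))
    (s t : R) (f : Signs → R) :
    hop β₀ X i s (hop β₀ X j t f) = hop β₀ X j t (hop β₀ X i s f) := by
  funext J
  by_cases h1 : rr i ∈ J ∧ rl X i ∉ J <;> by_cases h2 : rr j ∈ J ∧ rl X j ∉ J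
  · rw [hop_of_mem _ _ h1, hop_of_mem _ _ h2, hop_of_mem _ _ h2, hop_of_mem _ _ h1,
      hop_of_mem _ _ ((hj J).2 h2), hop_of_mem _ _ ((hi J).2 h1), hs]
    ring
  · rw [hop_of_mem _ _ h1, hop_of_notMem _ _ h2, hop_of_notMem _ _ h2, hop_of_mem _ _ h1,
      hop_of_notMem _ _ (mt (hj J).1 h2)]
  · rw [hop_of_notMem _ _ h1, hop_of_mem _ _ h2, hop_of_mem _ _ h2, hop_of_notMem _ _ h1,
      hop_of_notMem _ _ (mt (hi J).1 h1)]
  · rw [hop_of_notMem _ _ h1, hop_of_notMem _ _ h2, hop_of_notMem _ _ h2, hop_of_notMem _ _ h1]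

theorem act_comm_of_fix {i j : ℕ} (h1 : gen X i (rl X j) = rl X j) (h2 : gen X i (rr j) = rr j)
    (J : Signs) : act X i (act X j J) = act X j (act X i J) :=
  Signs.ext_mem fun z => by
    have := congrArg (fun w : W X => w.1 z) (s_mul_comm_of X i j h1 h2)
    have e : gen X i (gen X j z) = gen X j (gen X i z) := this
    rw [mem_act, mem_act, mem_act, mem_act, e]

theorem hop_comm_of_fix {i j : ℕ} (h1 : gen X i (rl X j) = rl X j) (h2 : gen X i (rr j) = rr j)
    (h3 : gen X j (rl X i) = rl X i) (h4 : gen X j (rr i) = rr i) (s t : R) (f : Signs → R) :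
    hop β₀ X i s (hop β₀ X j t f) = hop β₀ X j t (hop β₀ X i s f) := by
  refine hop_comm_of β₀ X (act_comm_of_fix X h1 h2) (fun J => ?_) (fun J => ?_) s t f
  · rw [mem_act, mem_act, h3, h4]
  · rw [mem_act, mem_act, h1, h2]

/-- Distant simple reflections commute.  In type `D` the node `0` is adjacent to the node `2`. -/
theorem hop_comm {i j : ℕ} (h : i + 2 ≤ j) (hX : X = CType.D → 1 ≤ i ∨ 3 ≤ j) (s t : R)
    (f : Signs → R) : hop β₀ X i s (hop β₀ X j t f) = hop β₀ X j t (hop β₀ X i s f) := by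
  obtain ⟨l, rfl⟩ : ∃ l, j = l + 2 := ⟨j - 2, by omega⟩
  cases i with
  | zero =>
    cases X with
    | D =>
      have := hX rfl
      apply hop_comm_of_fix <;> simp only [gen_D_zero_apply, gen_succ_apply, rl, rr] <;>
        split_ifs <;> omega
    | B => apply hop_comm_of_fix <;> simp only [gen_B_zero_apply, gen_succ_apply, rl, rr] <;>
        split_ifs <;> omega
    | C => apply hop_comm_of_fix <;> simp only [gen_C_zero_apply, gen_succ_apply, rl, rr] <;>
        split_ifs <;> omega
  | succ k =>
    apply hop_comm_of_fix <;> cases X <;> simp only [gen_succ_apply, rl, rr] <;>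
      split_ifs <;> omega

/-- The Yang–Baxter equation
`h_i(s) h_{i+1}(s ⊕ t) h_i(t) = h_{i+1}(t) h_i(s ⊕ t) h_{i+1}(s)`. -/
theorem hop_yang_baxter (i : ℕ) (hi : 1 ≤ i) (s t : R) (f : Signs → R) :
    hop β₀ X i s (hop β₀ X (i + 1) (s + t + β₀ * s * t) (hop β₀ X i t f)) =
      hop β₀ X (i + 1) t (hop β₀ X i (s + t + β₀ * s * t) (hop β₀ X (i + 1) s f)) := by
  obtain ⟨k, rfl⟩ : ∃ k, i = k + 1 := ⟨i - 1, by omega⟩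
  have h1 := gen_succ_apply X k
  have h2 := gen_succ_apply X (k + 1)
  push_cast at h2
  have e1 : rl X (k + 1 + 1) = k + 2 := by cases X <;> simp only [rl] <;> push_cast <;> ring
  have e2 : rr (k + 1 + 1) = k + 3 := by simp only [rr]; push_cast; ring
  have e3 : rl X (k + 1) = k + 1 := by cases X <;> rfl
  have e4 : rr (k + 1) = k + 2 := rfl
  have f1 : gen X (k + 1) (k + 1) = k + 2 := by rw [h1]; split_ifs <;> omega
  have f2 : gen X (k + 1) (k + 2) = k + 1 := by rw [h1]; split_ifs <;> omega
  have f3 : gen X (k + 1) (k + 3) = k + 3 := by rw [h1]; split_ifs <;> omega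
  have f4 : gen X (k + 1 + 1) (k + 1) = k + 1 := by rw [h2]; split_ifs <;> omega
  have f5 : gen X (k + 1 + 1) (k + 2) = k + 3 := by rw [h2]; split_ifs <;> omega
  have f6 : gen X (k + 1 + 1) (k + 3) = k + 2 := by rw [h2]; split_ifs <;> omega
  have hb : ∀ J, act X (k + 1) (act X (k + 1 + 1) (act X (k + 1) J)) =
      act X (k + 1 + 1) (act X (k + 1) (act X (k + 1 + 1) J)) := fun J =>
    Signs.ext_mem fun z => by
      simp only [mem_act]
      rw [gen_eq_tr X (k + 1 + 1) (gen X (k + 1) z), gen_tr, gen_gen,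
        gen_eq_tr X (k + 1) (gen X (k + 1 + 1) z), gen_tr, gen_gen, e1, e2, e3, e4, f2, f3, f4, f5]
  funext J
  by_cases c1 : (k + 1 : ℤ) ∈ J <;> by_cases c2 : (k + 2 : ℤ) ∈ J <;>
    by_cases c3 : (k + 3 : ℤ) ∈ J <;>
    simp only [hop, e1, e2, e3, e4, mem_act, f1, f2, f3, f4, f5, f6, c1, c2, c3, not_true,
      not_false_iff, and_true, and_false, if_true, if_false, hb,
      act_act] <;> ring

end Hop

/-! ### Products of the operators -/

section Products

variable {R : Type*} [CommRing R] (β₀ : R) (X : CType)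

/-- `h_i(t) h_{i+1}(t) ⋯ h_{i+k-1}(t)`. -/
def asc : ℕ → ℕ → R → (Signs → R) → Signs → R
  | _, 0, _, f => f
  | i, k + 1, t, f => hop β₀ X i t (asc (i + 1) k t f)

/-- `h_{i+k-1}(t) ⋯ h_{i+1}(t) h_i(t)`. -/
def desc : ℕ → ℕ → R → (Signs → R) → Signs → R
  | _, 0, _, f => f
  | i, k + 1, t, f => desc (i + 1) k t (hop β₀ X i t f)

/-- With `Ã_j(t) = h_j(t) h_{j+1}(t) ⋯ h_{i+k-1}(t)`, the product
`Ã_{i+k-1}(c_{k-1}) ⋯ Ã_{i+1}(c₁) Ã_i(c₀)`. -/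
def ascs : ℕ → ℕ → (ℕ → R) → (Signs → R) → Signs → R
  | _, 0, _, f => f
  | i, k + 1, c, f => ascs (i + 1) k (fun j => c (j + 1)) (asc β₀ X i (k + 1) (c 0) f)

/-- `h_{i+k-1}(c_{k-1} ⊕ t) ⋯ h_{i+1}(c₁ ⊕ t) h_i(c₀ ⊕ t)`. -/
def descSum : ℕ → ℕ → (ℕ → R) → R → (Signs → R) → Signs → R
  | _, 0, _, _, f => f
  | i, k + 1, c, t, f =>
    descSum (i + 1) k (fun j => c (j + 1)) t (hop β₀ X i (c 0 + t + β₀ * c 0 * t) f)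

/-- Operators that commute with `h_i, h_{i+1}, …`. -/
def CommutesFrom (T : (Signs → R) → Signs → R) (i : ℕ) : Prop :=
  ∀ j, i ≤ j → ∀ (t : R) (f : Signs → R), T (hop β₀ X j t f) = hop β₀ X j t (T f)

variable {β₀ X} {T : (Signs → R) → Signs → R} {i : ℕ}

theorem commutesFrom_hop (i : ℕ) (hi : 1 ≤ i) (t : R) :
    CommutesFrom β₀ X (hop β₀ X i t) (i + 2) := fun _ hj _ _ =>
  hop_comm β₀ X hj (fun _ => Or.inl hi) _ _ _

theorem CommutesFrom.asc (h : CommutesFrom β₀ X T i) {j : ℕ} (hj : i ≤ j) (k : ℕ) (t : R)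
    (f : Signs → R) : T (asc β₀ X j k t f) = KGroth.asc β₀ X j k t (T f) := by
  induction k generalizing j with
  | zero => rfl
  | succ k ih => rw [KGroth.asc, h j hj, ih (by omega), KGroth.asc]

theorem CommutesFrom.desc (h : CommutesFrom β₀ X T i) {j : ℕ} (hj : i ≤ j) (k : ℕ) (t : R)
    (f : Signs → R) : T (desc β₀ X j k t f) = KGroth.desc β₀ X j k t (T f) := by
  induction k generalizing j f with
  | zero => rfl
  | succ k ih => rw [KGroth.desc, ih (by omega), h j hj, KGroth.desc]

theorem CommutesFrom.ascs (h : CommutesFrom β₀ X T i) {j : ℕ} (hj : i ≤ j) (k : ℕ) (c : ℕ → R)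
    (f : Signs → R) : T (ascs β₀ X j k c f) = KGroth.ascs β₀ X j k c (T f) := by
  induction k generalizing j c f with
  | zero => rfl
  | succ k ih => rw [KGroth.ascs, ih (by omega), h.asc hj, KGroth.ascs]

/-- `Ã_i(s) A_i(t) = A_{i+1}(t) h_i(s ⊕ t) Ã_{i+1}(s)`. -/
theorem asc_desc (i : ℕ) (hi : 1 ≤ i) (k : ℕ) (s t : R) (f : Signs → R) :
    asc β₀ X i (k + 1) s (desc β₀ X i (k + 1) t f) =
      desc β₀ X (i + 1) k t
        (hop β₀ X i (s + t + β₀ * s * t) (asc β₀ X (i + 1) k s f)) := by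
  induction k generalizing i f with
  | zero => simp only [asc, desc, hop_hop]
  | succ k ih =>
    rw [asc, desc, ih (i + 1) (by omega), (commutesFrom_hop i hi s).desc (by omega),
      ← (commutesFrom_hop i hi t).asc (by omega), hop_yang_baxter β₀ X i hi]
    rfl

/-- The product `Ã_{i+k}(c_k) ⋯ Ã_i(c₀) A_i(t)` equals
`h_{i+k}(c_k ⊕ t) ⋯ h_i(c₀ ⊕ t) Ã_{i+k}(c_{k-1}) ⋯ Ã_{i+1}(c₀)`. -/
theorem ascs_desc (i : ℕ) (hi : 1 ≤ i) (k : ℕ) (c : ℕ → R) (t : R) (f : Signs → R) :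
    ascs β₀ X i (k + 1) c (desc β₀ X i (k + 1) t f) =
      descSum β₀ X i (k + 1) c t (ascs β₀ X (i + 1) k c f) := by
  induction k generalizing i c f with
  | zero => simp only [ascs, descSum, asc, desc, hop_hop]
  | succ k ih =>
    rw [ascs, asc_desc i hi, ih (i + 1) (by omega), ← (commutesFrom_hop i hi _).ascs (by omega)]
    rfl

/-- If `T` commutes with `h₂, h₃, …`, the factor `A₁(t) T Ã₁(t)` can be moved to the left of the
product `Ã_k(c_{k-1}) ⋯ Ã₁(c₀)` at the price of adding `t` to the parameters. -/
theorem ascs_desc_asc (hT : CommutesFrom β₀ X T 2) (m : ℕ) (c c' : ℕ → R) (t : R)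
    (h0 : c' 0 = t) (hc : ∀ j, c' (j + 1) = c j) (f : Signs → R) :
    ascs β₀ X 1 m c (desc β₀ X 1 m t (T (asc β₀ X 1 m t f))) =
      descSum β₀ X 1 m c t (T (ascs β₀ X 1 m c' f)) := by
  cases m with
  | zero => rfl
  | succ k =>
    obtain rfl : (fun j => c' (j + 1)) = c := funext hc
    rw [ascs_desc 1 le_rfl, ← hT.ascs le_rfl]
    conv_rhs => rw [ascs, h0]

theorem descSum_succ (i k : ℕ) (c : ℕ → R) (t : R) (f : Signs → R) :
    descSum β₀ X i (k + 1) c t f =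
      hop β₀ X (i + k) (c k + t + β₀ * c k * t) (descSum β₀ X i k c t f) := by
  induction k generalizing i c f with
  | zero => rfl
  | succ k ih =>
    rw [descSum, ih, descSum]
    congr 1
    omega

theorem asc_zero (i k : ℕ) (f : Signs → R) : asc β₀ X i k 0 f = f := by
  induction k generalizing i with
  | zero => rfl
  | succ k ih => rw [asc, ih, hop_zero]

theorem desc_zero (i k : ℕ) (f : Signs → R) : desc β₀ X i k 0 f = f := by
  induction k generalizing i with
  | zero => rfl
  | succ k ih => rw [desc, hop_zero, ih]

section Map

variable {R' : Type*} [CommRing R'] (φ : R →+* R')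

theorem asc_map (i k : ℕ) (t : R) (f : Signs → R) :
    φ ∘ asc β₀ X i k t f = asc (φ β₀) X i k (φ t) (φ ∘ f) := by
  induction k generalizing i with
  | zero => rfl
  | succ k ih => rw [asc, hop_map, ih, asc]

theorem desc_map (i k : ℕ) (t : R) (f : Signs → R) :
    φ ∘ desc β₀ X i k t f = desc (φ β₀) X i k (φ t) (φ ∘ f) := by
  induction k generalizing i f with
  | zero => rfl
  | succ k ih => rw [desc, ih, hop_map, desc]

theorem ascs_map (i k : ℕ) (c : ℕ → R) (f : Signs → R) :
    φ ∘ ascs β₀ X i k c f = ascs (φ β₀) X i k (φ ∘ c) (φ ∘ f) := by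
  induction k generalizing i c f with
  | zero => rfl
  | succ k ih => rw [ascs, ih, asc_map]; rfl

end Map

end Products

/-! ### The factors `F_n(t)` -/

/-- The action of `F_n^X(t)`. -/
def Fop {R : Type*} [CommRing R] (β₀ : R) (X : CType) (n : ℕ) (t : R) (f : Signs → R) :
    Signs → R :=
  match X with
  | CType.B => desc β₀ CType.B 1 (n - 1) t (hop β₀ CType.B 0 t (asc β₀ CType.B 1 (n - 1) t f))
  | CType.C => desc β₀ CType.C 1 (n - 1) t
      (hop β₀ CType.C 0 t (hop β₀ CType.C 0 t (asc β₀ CType.C 1 (n - 1) t f)))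
  | CType.D => desc β₀ CType.D 2 (n - 2) t
      (hop β₀ CType.D 1 t (hop β₀ CType.D 0 t (asc β₀ CType.D 2 (n - 2) t f)))

theorem Fop_zero {R : Type*} [CommRing R] (β₀ : R) (X : CType) (n : ℕ) (f : Signs → R) :
    Fop β₀ X n 0 f = f := by
  cases X <;> simp only [Fop, asc_zero, desc_zero, hop_zero]

theorem Fop_map {R R' : Type*} [CommRing R] [CommRing R'] (φ : R →+* R') (β₀ : R) (X : CType)
    (n : ℕ) (t : R) (f : Signs → R) :
    φ ∘ Fop β₀ X n t f = Fop (φ β₀) X n (φ t) (φ ∘ f) := by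
  cases X <;> simp only [Fop, asc_map, desc_map, hop_map]

/-- The change of sign of `1`, acting on sign patterns. -/
def flip (J : Signs) : Signs := act CType.B 0 J

theorem mem_flip {J : Signs} {z : ℤ} :
    z ∈ flip J ↔ (if z = -1 then 1 else if z = 1 then -1 else z) ∈ J := by
  rw [flip, mem_act, gen_B_zero_apply]

theorem one_mem_flip {J : Signs} : 1 ∈ flip J ↔ 1 ∉ J := by
  rw [mem_flip, if_neg (by norm_num), if_pos rfl, J.neg_mem_iff one_ne_zero]

theorem mem_flip_of_two_le {J : Signs} {z : ℤ} (hz : 2 ≤ z) : z ∈ flip J ↔ z ∈ J := by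
  rw [mem_flip, if_neg (by omega), if_neg (by omega)]

@[simp] theorem flip_flip (J : Signs) : flip (flip J) = J := act_act _ _ _

/-- The factor of `[[t|c]]^k`, `[t|0,c]^k` or `[t|c]^{k-1}` that does not involve `c`. -/
def wt : CType → K → K
  | CType.B, t => t
  | CType.C, t => oplus t t
  | CType.D, _ => 1

/-- The middle factor of `F_n(t)`: `h₀(t)`, `h₀(t)² = h₀(t ⊕ t)`, or, in type `D`, the diagram
automorphism `τ`, in terms of which `h_{1̂}(t) = τ h₁(t) τ`. -/
def bop : CType → K → (Signs → K) → Signs → K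
  | CType.B, t, f => hop β CType.B 0 t f
  | CType.C, t, f => hop β CType.C 0 (oplus t t) f
  | CType.D, _, f => fun J => f (flip J)

theorem bop_BC {X : CType} (hX : X ≠ CType.D) (t : K) (f : Signs → K) :
    bop X t f = hop β X 0 (wt X t) f := by
  cases X <;> first | rfl | exact absurd rfl hX

theorem flip_act {X : CType} {j : ℕ} (hj : 2 ≤ j) (J : Signs) :
    flip (act X j J) = act X j (flip J) := by
  obtain ⟨k, rfl⟩ : ∃ k, j = k + 1 := ⟨j - 1, by omega⟩
  refine Signs.ext_mem fun z => ?_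
  rw [flip, flip, mem_act, mem_act, mem_act, mem_act]
  have : gen X (k + 1) (gen CType.B 0 z) = gen CType.B 0 (gen X (k + 1) z) := by
    simp only [gen_succ_apply, gen_B_zero_apply]
    split_ifs <;> omega
  rw [this]

theorem rl_rr_mem_flip {X : CType} {j : ℕ} (hj : 2 ≤ j) (J : Signs) :
    (rr j ∈ flip J ∧ rl X j ∉ flip J) ↔ (rr j ∈ J ∧ rl X j ∉ J) := by
  obtain ⟨k, rfl⟩ : ∃ k, j = k + 1 := ⟨j - 1, by omega⟩
  have e : rl X (k + 1) = k + 1 := by cases X <;> rfl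
  rw [e, mem_flip_of_two_le (by simp only [rr]; omega), mem_flip_of_two_le (by omega)]

theorem commutesFrom_flip {R : Type*} [CommRing R] (β₀ : R) (X : CType) :
    CommutesFrom β₀ X (fun f J => f (flip J)) 2 := by
  intro j hj t f
  funext J
  dsimp only
  by_cases h : rr j ∈ J ∧ rl X j ∉ J
  · rw [hop_of_mem _ _ h, hop_of_mem _ _ ((rl_rr_mem_flip hj J).2 h), flip_act hj]
  · rw [hop_of_notMem _ _ h, hop_of_notMem _ _ (mt (rl_rr_mem_flip hj J).1 h)]

theorem commutesFrom_bop (X : CType) (t : K) : CommutesFrom β X (bop X t) 2 := by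
  cases X with
  | B => exact fun j hj _ _ => hop_comm β _ (by omega) (fun h => by cases h) _ _ _
  | C => exact fun j hj _ _ => hop_comm β _ (by omega) (fun h => by cases h) _ _ _
  | D => exact commutesFrom_flip β CType.D

/-- In type `D`, `h_{1̂}(t) = τ h₁(t) τ`. -/
theorem hop_D_zero {R : Type*} [CommRing R] (β₀ : R) (t : R) (f : Signs → R) (J : Signs) :
    hop β₀ CType.D 0 t f J = hop β₀ CType.D 1 t (fun J => f (flip J)) (flip J) := by
  have e1 : rl CType.D 1 = 1 := rfl
  have e2 : rr 1 = 2 := rfl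
  have e3 : rl CType.D 0 = -2 := rfl
  have e4 : rr 0 = 1 := rfl
  have n2 := J.neg_mem_iff (z := 2) (by norm_num)
  have ha : act CType.D 0 J = flip (act CType.D 1 (flip J)) := by
    refine Signs.ext_mem fun z => ?_
    simp only [flip, mem_act]
    rfl
  have hc : (rr 0 ∈ J ∧ rl CType.D 0 ∉ J) ↔ (rr 1 ∈ flip J ∧ rl CType.D 1 ∉ flip J) := by
    rw [e1, e2, e3, e4, n2, one_mem_flip, mem_flip_of_two_le le_rfl, not_not, not_not, and_comm]
  by_cases h : rr 0 ∈ J ∧ rl CType.D 0 ∉ J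
  · rw [hop_of_mem _ _ h, hop_of_mem _ _ (hc.1 h), flip_flip, ha]
  · rw [hop_of_notMem _ _ h, hop_of_notMem _ _ (mt hc.2 h), flip_flip]

theorem hop_D_zero_one_comm {R : Type*} [CommRing R] (β₀ : R) (s t : R) (f : Signs → R) :
    hop β₀ CType.D 0 s (hop β₀ CType.D 1 t f) = hop β₀ CType.D 1 t (hop β₀ CType.D 0 s f) := by
  have e1 : rl CType.D 1 = 1 := rfl
  have e2 : rr 1 = 2 := rfl
  have e3 : rl CType.D 0 = -2 := rfl
  have e4 : rr 0 = 1 := rfl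
  have g1 := gen_succ_apply CType.D 0
  simp only [zero_add, Nat.cast_zero] at g1
  refine hop_comm_of β₀ CType.D (fun J => Signs.ext_mem fun z => ?_) (fun J => ?_)
    (fun J => ?_) s t f
  · have : gen CType.D 1 (gen CType.D 0 z) = gen CType.D 0 (gen CType.D 1 z) := by
      simp only [gen_D_zero_apply, g1]
      split_ifs <;> omega
    simp only [mem_act, this]
  · have n1 := J.neg_mem_iff (z := 1) (by norm_num)
    have n2 := J.neg_mem_iff (z := 2) (by norm_num)
    simp [e3, e4, g1, n1, n2, and_comm]
  · have n1 := J.neg_mem_iff (z := 1) (by norm_num)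
    have n2 := J.neg_mem_iff (z := 2) (by norm_num)
    simp [e1, e2, gen_D_zero_apply, n1, n2, and_comm]

theorem Fop_D_flip {R : Type*} [CommRing R] (β₀ : R) (n : ℕ) (t : R) (f : Signs → R) :
    Fop β₀ CType.D n t (fun J => f (flip J)) = fun J => Fop β₀ CType.D n t f (flip J) := by
  have hT := commutesFrom_flip β₀ CType.D
  have h0 : ∀ (g : Signs → R), hop β₀ CType.D 0 t (fun J => g (flip J)) =
      fun J => hop β₀ CType.D 1 t g (flip J) := fun g => funext fun J => by
    rw [hop_D_zero]
    simp only [flip_flip]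
  have h1 : ∀ (g : Signs → R), hop β₀ CType.D 1 t (fun J => g (flip J)) =
      fun J => hop β₀ CType.D 0 t g (flip J) := fun g => funext fun J => by
    rw [hop_D_zero, flip_flip]
  simp only [Fop]
  rw [← hT.asc le_rfl, h0, h1, hop_D_zero_one_comm]
  exact (hT.desc le_rfl _ _ _).symm

/-- `F_n(t) = A₁(t) T(t) Ã₁(t)` with the middle factor `T(t)`, up to `τ` in type `D`. -/
theorem desc_bop_asc (X : CType) (m : ℕ) (hm : X = CType.D → 1 ≤ m) (t : K) (f : Signs → K) :
    desc β X 1 m t (bop X t (asc β X 1 m t f)) =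
      match X with
      | CType.B => Fop β CType.B (m + 1) t f
      | CType.C => Fop β CType.C (m + 1) t f
      | CType.D => Fop β CType.D (m + 1) t fun J => f (flip J) := by
  cases X with
  | B => rfl
  | C =>
    simp only [Fop, hop_hop]
    rfl
  | D =>
    obtain ⟨k, rfl⟩ : ∃ k, m = k + 1 := ⟨m - 1, by have := hm rfl; omega⟩
    have hT := commutesFrom_flip β CType.D
    simp only [Fop, Nat.reduceSubDiff, ← hT.asc le_rfl, desc, asc, bop]
    congr 2
    funext J
    rw [hop_D_zero]
    simp only [flip_flip]

/-! ### Partial fraction identities -/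

section PartialFractions

open Polynomial

variable {F : Type*} [Field F] [DecidableEq F]

/-- The sum of `z^k ∏_{w ≠ z} w (z w - 1) / (z - w)` over a finite set, `k ≤ 2`: Lagrange
interpolation of `T^k ∏_w (w T - 1)` at the points of the set and `0, 1, -1`. -/
theorem sum_pow_mul_prod_div (h2 : (2 : F) ≠ 0) (U : Finset F) (h0 : ∀ z ∈ U, z ≠ 0)
    (hU : ∀ z ∈ U, z * z ≠ 1) (k : ℕ) (hk : k ≤ 2) :
    ∑ z ∈ U, z ^ k * ∏ w ∈ U.erase z, (w * (z * w - 1) / (z - w)) =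
      (∏ w ∈ U, w) * ((if k = 2 then ∏ w ∈ U, w else 0) - (-1) ^ U.card / 2 - (-1) ^ k / 2) +
        0 ^ k := by
  have n1 : (1 : F) ∉ U := fun h => hU 1 h (by ring)
  have n2 : (-1 : F) ∉ U := fun h => hU _ h (by ring)
  have n0 : (0 : F) ∉ U := fun h => h0 0 h rfl
  have h11 : (1 : F) ≠ -1 := fun h => h2 (by linear_combination h)
  have n1' : (1 : F) ∉ insert (-1) U := by simp [n1, h11]
  have n0' : (0 : F) ∉ insert 1 (insert (-1) U) := by simp [n0]
  set q : F[X] := ∏ w ∈ U, (C w * X - 1) with hq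
  have hdeg1 : ∀ w ∈ U, (C w * X - 1 : F[X]).natDegree = 1 := fun w hw => by
    have := natDegree_linear (b := -1) (h0 w hw)
    rwa [map_neg, map_one, ← sub_eq_add_neg] at this
  have hlc1 : ∀ w ∈ U, (C w * X - 1 : F[X]).leadingCoeff = w := fun w hw => by
    have := leadingCoeff_linear (b := -1) (h0 w hw)
    rwa [map_neg, map_one, ← sub_eq_add_neg] at this
  have hne1 : ∀ w ∈ U, (C w * X - 1 : F[X]) ≠ 0 := fun w hw h => by
    have := hlc1 w hw
    rw [h, leadingCoeff_zero] at this
    exact h0 w hw this.symm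
  have hqdeg : q.natDegree = U.card := by
    rw [hq, natDegree_prod _ _ hne1, Finset.sum_congr rfl hdeg1]
    simp
  have hqlc : q.leadingCoeff = ∏ w ∈ U, w := by
    rw [hq, leadingCoeff_prod, Finset.prod_congr rfl hlc1]
  have hq0 : q ≠ 0 := Finset.prod_ne_zero_iff.2 hne1
  have hev : ∀ z, q.eval z = ∏ w ∈ U, (z * w - 1) := fun z => by
    rw [hq, eval_prod]
    exact Finset.prod_congr rfl fun w _ => by
      rw [eval_sub, eval_mul, eval_C, eval_X, eval_one, mul_comm]
  set N : Finset F := insert 0 (insert 1 (insert (-1) U)) with hN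
  have hcard : N.card = U.card + 3 := by
    rw [hN, Finset.card_insert_of_notMem n0', Finset.card_insert_of_notMem n1',
      Finset.card_insert_of_notMem n2]
  have hnat : (q * X ^ k).natDegree = U.card + k := by
    rw [natDegree_mul hq0 (pow_ne_zero _ X_ne_zero), hqdeg, natDegree_X_pow]
  have hlag := Lagrange.coeff_eq_sum (s := N) (v := id) (Set.injOn_id _) (P := q * X ^ k) (by
    refine lt_of_le_of_lt degree_le_natDegree ?_
    rw [hnat, hcard]
    exact_mod_cast (by omega : U.card + k < U.card + 3))
  have hcoeff : (q * X ^ k).coeff (N.card - 1) = if k = 2 then ∏ w ∈ U, w else 0 := by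
    rw [hcard]
    split_ifs with h
    · subst h
      rw [Nat.add_sub_assoc (by norm_num), coeff_mul_X_pow, ← hqlc, ← hqdeg, coeff_natDegree]
    · exact coeff_eq_zero_of_natDegree_lt (by rw [hnat]; omega)
  rw [hcoeff, hN, Finset.sum_insert n0', Finset.sum_insert n1', Finset.sum_insert n2] at hlag
  simp only [id, eval_mul, hev, eval_pow, eval_X] at hlag
  rw [Finset.erase_insert n0', Finset.prod_insert n1', Finset.prod_insert n2] at hlag
  rw [Finset.erase_insert_of_ne (by norm_num), Finset.erase_insert n1',
    Finset.prod_insert (by simp [n0]), Finset.prod_insert n2] at hlag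
  rw [Finset.erase_insert_of_ne (by norm_num), Finset.erase_insert_of_ne h11,
    Finset.erase_insert n2, Finset.prod_insert (by simp [n0]), Finset.prod_insert n1] at hlag
  set Q := ∏ w ∈ U, w with hQ
  have hQ0 : Q ≠ 0 := Finset.prod_ne_zero_iff.2 h0
  have e0 : (∏ w ∈ U, ((0 : F) * w - 1)) = (-1) ^ U.card := by simp
  have e0' : (∏ w ∈ U, ((0 : F) - w)) = (-1) ^ U.card * Q := by
    simp [hQ, ← Finset.prod_neg]
  have e1 : (∏ w ∈ U, ((1 : F) * w - 1)) = (-1) ^ U.card * ∏ w ∈ U, (1 - w) := by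
    rw [← Finset.prod_const, ← Finset.prod_mul_distrib]
    exact Finset.prod_congr rfl fun w _ => by ring
  have e2 : (∏ w ∈ U, ((-1 : F) * w - 1)) = ∏ w ∈ U, (-1 - w) :=
    Finset.prod_congr rfl fun w _ => by ring
  have d1 : (∏ w ∈ U, (1 - w)) ≠ 0 :=
    Finset.prod_ne_zero_iff.2 fun w hw h => n1 (by rwa [sub_eq_zero.1 h])
  have d2 : (∏ w ∈ U, (-1 - w)) ≠ 0 :=
    Finset.prod_ne_zero_iff.2 fun w hw h => n2 (by rwa [sub_eq_zero.1 h])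
  have hterm : ∀ z ∈ U, z ^ k * ∏ w ∈ U.erase z, (w * (z * w - 1) / (z - w)) =
      Q * ((∏ w ∈ U, (z * w - 1)) * z ^ k /
        ∏ w ∈ (insert 0 (insert 1 (insert (-1) U)) : Finset F).erase z, (z - w)) := by
    intro z hz
    have z0 := h0 z hz
    have z1 := hU z hz
    have z11 : z ≠ 1 := fun h => n1 (h ▸ hz)
    have z12 : z ≠ -1 := fun h => n2 (h ▸ hz)
    rw [Finset.erase_insert_of_ne z0.symm, Finset.erase_insert_of_ne z11.symm,
      Finset.erase_insert_of_ne z12.symm, Finset.prod_insert (by simp [n0]),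
      Finset.prod_insert (by simp [n1, h11]), Finset.prod_insert (by simp [n2]),
      ← Finset.mul_prod_erase U (fun w => z * w - 1) hz, hQ, ← Finset.mul_prod_erase U _ hz,
      Finset.prod_div_distrib, Finset.prod_mul_distrib]
    have d3 : (∏ w ∈ U.erase z, (z - w)) ≠ 0 := Finset.prod_ne_zero_iff.2 fun w hw h =>
      Finset.ne_of_mem_erase hw (sub_eq_zero.1 h).symm
    have z13 : z * z - 1 ≠ 0 := sub_ne_zero.2 z1
    have z14 : z - 1 ≠ 0 := sub_ne_zero.2 z11
    have z15 : z - -1 ≠ 0 := sub_ne_zero.2 z12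
    rw [sub_zero]
    field_simp
    ring
  rw [Finset.sum_congr rfl hterm, ← Finset.mul_sum]
  rw [e0, e0', e1, e2] at hlag
  have hs : (-1 : F) ^ U.card ≠ 0 := pow_ne_zero _ (by norm_num)
  have t0 : (-1 : F) ^ U.card * 0 ^ k / ((0 - 1) * ((0 - -1) * ((-1) ^ U.card * Q))) =
      - (0 ^ k / Q) := by
    field_simp
    ring
  have t1 : (-1 : F) ^ U.card * (∏ w ∈ U, (1 - w)) * 1 ^ k /
      ((1 - 0) * ((1 - -1) * ∏ w ∈ U, (1 - w))) = (-1) ^ U.card / 2 := by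
    have : (1 : F) - -1 = 2 := by norm_num
    rw [this, one_pow]
    field_simp
    ring
  have t2 : (∏ w ∈ U, (-1 - w)) * (-1 : F) ^ k /
      ((-1 - 0) * ((-1 - 1) * ∏ w ∈ U, (-1 - w))) = (-1) ^ k / 2 := by
    have : ((-1 : F) - 0) * ((-1 - 1) * ∏ w ∈ U, (-1 - w)) = 2 * ∏ w ∈ U, (-1 - w) := by ring
    rw [this]
    field_simp
  rw [t0, t1, t2] at hlag
  have := congrArg (Q * ·) hlag
  simp only [mul_add, mul_neg, mul_div_cancel₀ _ hQ0] at this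
  linear_combination -this

end PartialFractions

/-! ### The symmetrized sums -/

instance : DecidableEq K := Classical.decEq K

theorem beta_ne_zero : β ≠ 0 := by
  rw [β, Ne, map_eq_zero_iff _ (IsFractionRing.injective P K)]
  exact MvPolynomial.X_ne_zero _

/-- The factor `(v ⊕ w) / (v ⊖ w)`. -/
def cof (v w : K) : K := oplus v w / ominus v w

/-- The factor `∏_{w ∈ V, w ≠ v} (v ⊕ w) / (v ⊖ w)`. -/
def prodCof (V : Finset K) (v : K) : K := ∏ w ∈ V.erase v, cof v w

/-- The factor `[v|0,c]^{k+1}`, `[[v|c]]^{k+1}` or `[v|c]^k` belonging to a barred entry `k + 1`,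
for `X = B, C, D`. -/
def rowFactor (X : CType) (c : ℕ → K) (k : ℕ) (v : K) : K :=
  wt X v * ∏ j ∈ Finset.range k, oplus v (c j)

open Classical in
/-- The function `GP` or `GQ` in the finite set `V` of variables that belongs to the positive
members `≤ n` of the sign pattern `J`.  The symmetrization is written recursively, the first step
choosing the variable for the largest part.  In type `D` a part `0` is allowed. -/
def symSum (X : CType) (c : ℕ → K) : ℕ → Signs → Finset K → K
  | 0, _, _ => 1
  | n + 1, J, V =>
    if ((n + 1 : ℕ) : ℤ) ∈ J then
      ∑ v ∈ V, rowFactor X c n v * prodCof V v * symSum X c n J (V.erase v)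
    else symSum X c n J V

section

variable {X : CType} {c d : ℕ → K} {n : ℕ} {J J' : Signs} {V : Finset K}

theorem symSum_succ_of_mem (h : ((n + 1 : ℕ) : ℤ) ∈ J) : symSum X c (n + 1) J V =
    ∑ v ∈ V, rowFactor X c n v * prodCof V v * symSum X c n J (V.erase v) := by
  rw [symSum, if_pos h]

theorem symSum_succ_of_notMem (h : ((n + 1 : ℕ) : ℤ) ∉ J) :
    symSum X c (n + 1) J V = symSum X c n J V := by
  rw [symSum, if_neg h]

theorem rowFactor_congr {k : ℕ} (h : ∀ j, j < k → c j = d j) (v : K) :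
    rowFactor X c k v = rowFactor X d k v := by
  rw [rowFactor, rowFactor, Finset.prod_congr rfl fun j hj => by rw [h j (Finset.mem_range.1 hj)]]

theorem rowFactor_succ (k : ℕ) (v : K) :
    rowFactor X c (k + 1) v = rowFactor X c k v * oplus v (c k) := by
  rw [rowFactor, rowFactor, Finset.prod_range_succ, mul_assoc]

theorem symSum_congr (hJ : ∀ k : ℕ, 1 ≤ k → k ≤ n → ((k : ℤ) ∈ J ↔ (k : ℤ) ∈ J'))
    (hc : ∀ j, j + 1 < n → c j = d j) : symSum X c n J V = symSum X d n J' V := by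
  induction n generalizing V with
  | zero => rfl
  | succ n ih =>
    have ih' := fun V => ih (V := V) (fun k h1 h2 => hJ k h1 (by omega))
      (fun j hj => hc j (by omega))
    have h := hJ (n + 1) (by omega) le_rfl
    by_cases hm : ((n + 1 : ℕ) : ℤ) ∈ J
    · rw [symSum_succ_of_mem hm, symSum_succ_of_mem (h.1 hm)]
      refine Finset.sum_congr rfl fun v _ => ?_
      rw [ih', rowFactor_congr fun j hj => hc j (by omega)]
    · rw [symSum_succ_of_notMem hm, symSum_succ_of_notMem (mt h.2 hm), ih']

end

theorem cof_antisymm (v w : K) : (1 + β * v) * cof v w = -((1 + β * w) * cof w v) := by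
  have e : oplus w v = oplus v w := by simp only [oplus]; ring
  rw [cof, cof, e, ominus, ominus, div_div_eq_mul_div, div_div_eq_mul_div, ← neg_sub v w, div_neg]
  ring

/-- A sum over pairs of distinct elements vanishes if the summand is antisymmetric. -/
theorem sum_sum_erase_eq_zero (V : Finset K) (g : K → K → K) (hg : ∀ v w, g v w = -g w v) :
    ∑ v ∈ V, ∑ w ∈ V.erase v, g v w = 0 := by
  have h0 : ∀ v, g v v = 0 := fun v => self_eq_neg.1 (hg v v)
  have h1 : ∀ v, ∑ w ∈ V.erase v, g v w = ∑ w ∈ V, g v w := fun v => Finset.sum_erase V (h0 v)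
  simp only [h1]
  refine self_eq_neg.1 ?_
  conv_rhs => rw [Finset.sum_comm]
  rw [← Finset.sum_neg_distrib]
  refine Finset.sum_congr rfl fun v _ => ?_
  rw [← Finset.sum_neg_distrib]
  exact Finset.sum_congr rfl fun w _ => hg v w

/-- Two adjacent rows with the factors `(1 + β v) ρ(v)` and `ρ(w)` contribute `0`, since
`(1 + β v) (v ⊕ w) / (v ⊖ w)` is antisymmetric. -/
theorem sum_adjacent_rows (V : Finset K) (ρ : K → K) (T : Finset K → K) :
    ∑ v ∈ V, (1 + β * v) * ρ v * prodCof V v *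
      ∑ w ∈ V.erase v, ρ w * prodCof (V.erase v) w * T ((V.erase v).erase w) = 0 := by
  have key : ∀ v, ∀ w ∈ V.erase v, prodCof V v = cof v w * ∏ z ∈ (V.erase v).erase w, cof v z :=
    fun v w hw => (Finset.mul_prod_erase _ (cof v) hw).symm
  rw [← sum_sum_erase_eq_zero V fun v w => (1 + β * v) * cof v w *
    (ρ v * ρ w * (∏ z ∈ (V.erase v).erase w, cof v z) * (∏ z ∈ (V.erase v).erase w, cof w z) *
      T ((V.erase v).erase w))]
  · refine Finset.sum_congr rfl fun v _ => ?_
    rw [Finset.mul_sum]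
    refine Finset.sum_congr rfl fun w hw => ?_
    rw [key v w hw, prodCof]
    ring
  · intro v w
    rw [cof_antisymm v w, Finset.erase_right_comm (a := v) (b := w)]
    ring

/-! ### Exchanging two parameters -/

theorem prod_oplus_swap {c d : ℕ → K} {j : ℕ} (h1 : d j = c (j + 1)) (h2 : d (j + 1) = c j)
    (hd : ∀ k, k ≠ j → k ≠ j + 1 → d k = c k) (v : K) {k : ℕ} (hk : j + 2 ≤ k) :
    ∏ l ∈ Finset.range k, oplus v (c l) = ∏ l ∈ Finset.range k, oplus v (d l) := by
  induction k, hk using Nat.le_induction with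
  | base =>
    rw [Finset.prod_range_succ, Finset.prod_range_succ, Finset.prod_range_succ,
      Finset.prod_range_succ, h1, h2, Finset.prod_congr rfl fun l hl => by
        rw [← hd l (by have := Finset.mem_range.1 hl; omega)
          (by have := Finset.mem_range.1 hl; omega)]]
    ring
  | succ k hk ih => rw [Finset.prod_range_succ, ih, Finset.prod_range_succ, hd k] <;> omega

/-- If `c_j = s ⊕ c_{j+1}`, then `h_{j+1}(s)` maps the vector of the symmetrized sums with `c_j`
and `c_{j+1}` exchanged to the original one. -/
theorem symSum_swap {X : CType} {c d : ℕ → K} {j : ℕ} {s : K} (hs : c j = oplus s (c (j + 1)))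
    (h1 : d j = c (j + 1)) (h2 : d (j + 1) = c j) (hd : ∀ k, k ≠ j → k ≠ j + 1 → d k = c k)
    {n : ℕ} (hn : j + 2 ≤ n) (J : Signs) (V : Finset K) :
    symSum X c n J V = hop β X (j + 1) s (fun J => symSum X d n J V) J := by
  have hl : rl X (j + 1) = ((j + 1 : ℕ) : ℤ) := by cases X <;> simp [rl]
  have hr : rr (j + 1) = ((j + 2 : ℕ) : ℤ) := by simp [rr]
  have hg1 : gen X (j + 1) ((j + 1 : ℕ) : ℤ) = ((j + 2 : ℕ) : ℤ) := by
    rw [← hl, gen_rl, hr]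
  have hg2 : gen X (j + 1) ((j + 2 : ℕ) : ℤ) = ((j + 1 : ℕ) : ℤ) := by
    rw [← hr, gen_rr, hl]
  have hg3 : ∀ k : ℕ, k ≠ j + 1 → k ≠ j + 2 → gen X (j + 1) (k : ℤ) = k := fun k k1 k2 => by
    rw [gen_succ_apply]
    split_ifs <;> omega
  induction n, hn using Nat.le_induction generalizing V with
  | base =>
    have hrow : ∀ v, rowFactor X c j v = rowFactor X d j v := rowFactor_congr fun k hk =>
      (hd k (by omega) (by omega)).symm
    have hcd : ∀ (J' : Signs) V, (∀ k : ℕ, k ≠ j + 1 → k ≠ j + 2 → ((k : ℤ) ∈ J ↔ (k : ℤ) ∈ J')) →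
        symSum X c j J V = symSum X d j J' V := fun J' V h => symSum_congr
      (fun k _ _ => h k (by omega) (by omega)) fun k _ => (hd k (by omega) (by omega)).symm
    by_cases m2 : ((j + 2 : ℕ) : ℤ) ∈ J
    · by_cases m1 : ((j + 1 : ℕ) : ℤ) ∈ J
      -- The two sides differ by a sum with adjacent rows `(1 + β v) ρ(v)` and `ρ(w)`.
      · rw [hop_of_notMem _ _ (by rw [hl, hr]; exact fun h => h.2 m1), symSum_succ_of_mem m2,
          symSum_succ_of_mem m2, ← sub_eq_zero, ← Finset.sum_sub_distrib]
        have := sum_adjacent_rows V (rowFactor X c j) (symSum X c j J)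
        rw [← mul_zero (s * (1 + β * c (j + 1))), ← this, Finset.mul_sum]
        refine Finset.sum_congr rfl fun v _ => ?_
        rw [symSum_succ_of_mem m1, symSum_succ_of_mem m1, rowFactor_succ, rowFactor_succ, h1]
        simp only [← hrow, ← hcd J _ fun _ _ _ => Iff.rfl, hs, oplus]
        ring
      · rw [hop_of_mem _ _ (by rw [hl, hr]; exact ⟨m2, m1⟩), symSum_succ_of_mem m2,
          symSum_succ_of_mem m2, symSum_succ_of_notMem (n := j + 1) (by rwa [mem_act, hg2]),
          symSum_succ_of_mem (by rwa [mem_act, hg1]), Finset.mul_sum, Finset.mul_sum,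
          ← Finset.sum_add_distrib]
        refine Finset.sum_congr rfl fun v _ => ?_
        rw [symSum_succ_of_notMem m1, symSum_succ_of_notMem m1, rowFactor_succ, rowFactor_succ, h1,
          ← hrow, ← hcd J _ fun _ _ _ => Iff.rfl,
          ← hcd (act X (j + 1) J) _ fun k k1 k2 => by rw [mem_act, hg3 k k1 k2], hs]
        simp only [oplus]
        ring
    · rw [hop_of_notMem _ _ (by rw [hr]; exact fun h => m2 h.1)]
      refine symSum_succ_of_notMem m2 |>.trans ?_
      rw [symSum_succ_of_notMem (n := j + 1) m2]
      exact symSum_congr (fun _ _ _ => Iff.rfl) fun k hk => (hd k (by omega) (by omega)).symm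
  | succ n hn ih =>
    have hrow : ∀ v, rowFactor X c n v = rowFactor X d n v := fun v => by
      rw [rowFactor, rowFactor, prod_oplus_swap h1 h2 hd v hn]
    have ha : ((n + 1 : ℕ) : ℤ) ∈ act X (j + 1) J ↔ ((n + 1 : ℕ) : ℤ) ∈ J := by
      rw [mem_act, hg3 _ (by omega) (by omega)]
    by_cases hc : rr (j + 1) ∈ J ∧ rl X (j + 1) ∉ J
    · simp only [hop_of_mem _ _ hc] at ih ⊢
      by_cases hm : ((n + 1 : ℕ) : ℤ) ∈ J
      · rw [symSum_succ_of_mem hm, symSum_succ_of_mem hm, symSum_succ_of_mem (ha.2 hm),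
          Finset.mul_sum, Finset.mul_sum, ← Finset.sum_add_distrib]
        refine Finset.sum_congr rfl fun v _ => ?_
        rw [ih, hrow]
        ring
      · rw [symSum_succ_of_notMem hm, symSum_succ_of_notMem hm,
          symSum_succ_of_notMem (mt ha.1 hm), ih]
    · simp only [hop_of_notMem _ _ hc] at ih ⊢
      by_cases hm : ((n + 1 : ℕ) : ℤ) ∈ J
      · rw [symSum_succ_of_mem hm, symSum_succ_of_mem hm]
        exact Finset.sum_congr rfl fun v _ => by rw [ih, hrow]
      · rw [symSum_succ_of_notMem hm, symSum_succ_of_notMem hm, ih]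

/-! ### Closed forms for one row -/

/-- The condition on the variables under which no denominator vanishes. -/
def Generic (V : Finset K) : Prop := ∀ v ∈ V, 1 + β * v ≠ 0 ∧ oplus v v ≠ 0

theorem Generic.mono {V V' : Finset K} (h : Generic V) (hs : V' ⊆ V) : Generic V' :=
  fun v hv => h v (hs hv)

theorem one_add_beta_mul_oplus (s t : K) : 1 + β * oplus s t = (1 + β * s) * (1 + β * t) := by
  rw [oplus]
  ring

theorem cof_eq (v w : K) : cof v w = (1 + β * w) * ((1 + β * v) * (1 + β * w) - 1) /
    ((1 + β * v) - (1 + β * w)) := by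
  have e1 : (1 + β * v) * (1 + β * w) - 1 = β * oplus v w := by rw [oplus]; ring
  have e2 : (1 + β * v) - (1 + β * w) = β * (v - w) := by ring
  rw [cof, ominus, e1, e2, div_div_eq_mul_div, mul_left_comm, mul_div_mul_left _ _ beta_ne_zero,
    mul_comm]

theorem sum_pow_mul_prodCof {V : Finset K} (hV : Generic V) (k : ℕ) (hk : k ≤ 2) :
    ∑ v ∈ V, (1 + β * v) ^ k * prodCof V v =
      (∏ v ∈ V, (1 + β * v)) * ((if k = 2 then ∏ v ∈ V, (1 + β * v) else 0) -
        (-1) ^ V.card / 2 - (-1) ^ k / 2) + 0 ^ k := by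
  have hinj : Function.Injective fun v : K => 1 + β * v := fun v w h =>
    mul_left_cancel₀ beta_ne_zero (add_left_cancel h)
  have := sum_pow_mul_prod_div (two_ne_zero (α := K)) (V.map ⟨_, hinj⟩) (fun z hz => by
    obtain ⟨v, hv, rfl⟩ := Finset.mem_map.1 hz
    exact (hV v hv).1) (fun z hz h => by
    obtain ⟨v, hv, rfl⟩ := Finset.mem_map.1 hz
    refine (hV v hv).2 (mul_left_cancel₀ beta_ne_zero ?_)
    simp only [Function.Embedding.coeFn_mk] at h
    rw [mul_zero, ← sub_eq_zero.2 h, oplus]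
    ring) k hk
  rw [Finset.sum_map, Finset.prod_map, Finset.card_map] at this
  refine Eq.trans (Finset.sum_congr rfl fun v _ => ?_) this
  rw [← Finset.map_erase, Finset.prod_map]
  simp only [prodCof, cof_eq, Function.Embedding.coeFn_mk]

/-- The sum for a single row of factor `wt`. -/
def wtSum (X : CType) (V : Finset K) : K := ∑ v ∈ V, wt X v * prodCof V v

/-- `wtSum V` is the sum of the `wt v` with respect to `⊕`. -/
theorem one_add_beta_mul_wtSum {X : CType} (hX : X ≠ CType.D) {V : Finset K} (hV : Generic V) :
    1 + β * wtSum X V = ∏ v ∈ V, (1 + β * wt X v) := by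
  have h0 := sum_pow_mul_prodCof hV 0 (by norm_num)
  cases X with
  | B =>
    have h1 := sum_pow_mul_prodCof hV 1 (by norm_num)
    have : β * wtSum CType.B V =
        (∑ v ∈ V, (1 + β * v) ^ 1 * prodCof V v) - ∑ v ∈ V, (1 + β * v) ^ 0 * prodCof V v := by
      rw [wtSum, Finset.mul_sum, ← Finset.sum_sub_distrib]
      exact Finset.sum_congr rfl fun v _ => by rw [wt]; ring
    rw [this, h0, h1, if_neg (by norm_num), if_neg (by norm_num)]
    simp only [wt]
    ring
  | C =>
    have h1 := sum_pow_mul_prodCof hV 2 (by norm_num)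
    have : β * wtSum CType.C V =
        (∑ v ∈ V, (1 + β * v) ^ 2 * prodCof V v) - ∑ v ∈ V, (1 + β * v) ^ 0 * prodCof V v := by
      rw [wtSum, Finset.mul_sum, ← Finset.sum_sub_distrib]
      exact Finset.sum_congr rfl fun v _ => by rw [wt, oplus]; ring
    rw [this, h0, h1, if_pos rfl, if_neg (by norm_num)]
    simp only [wt, one_add_beta_mul_oplus, Finset.prod_mul_distrib]
    ring
  | D => exact absurd rfl hX

theorem wtSum_D {V : Finset K} (hV : Generic V) (h : Odd V.card) : wtSum CType.D V = 1 := by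
  have h0 := sum_pow_mul_prodCof hV 0 (by norm_num)
  rw [if_neg (by norm_num), h.neg_one_pow] at h0
  simp only [wtSum, wt]
  simp only [pow_zero] at h0
  rw [h0]
  ring

theorem wtSum_insert {X : CType} (hX : X ≠ CType.D) {V : Finset K} {t : K} (ht : t ∉ V)
    (hV : Generic (insert t V)) :
    wtSum X (insert t V) = (1 + β * wt X t) * wtSum X V + wt X t := by
  have h1 := one_add_beta_mul_wtSum hX hV
  rw [Finset.prod_insert ht,
    ← one_add_beta_mul_wtSum hX (hV.mono (Finset.subset_insert t V))] at h1
  refine mul_left_cancel₀ beta_ne_zero ?_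
  linear_combination h1

/-! ### Setting the first parameter to the inverse of a variable -/

theorem bar_eq (t : K) : bar t = -t / (1 + β * t) := by rw [bar, ominus, zero_sub]

theorem oplus_bar {t : K} (ht : 1 + β * t ≠ 0) (v : K) : oplus v (bar t) = ominus v t := by
  rw [oplus, bar_eq, ominus, eq_div_iff ht]
  linear_combination (1 + β * v) * div_mul_cancel₀ (-t) ht

theorem oplus_bar_self {t : K} (ht : 1 + β * t ≠ 0) : oplus t (bar t) = 0 := by
  rw [oplus_bar ht, ominus, sub_self, zero_div]

theorem oplus_oplus_bar {t : K} (ht : 1 + β * t ≠ 0) (c : K) :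
    oplus (oplus c t) (bar t) = c := by
  rw [oplus_bar ht, ominus, oplus, div_eq_iff ht]
  ring

/-- The number of positive members `≤ n`. -/
def countPos (n : ℕ) (J : Signs) : ℕ :=
  open Classical in ((Finset.range n).filter fun k => ((k + 1 : ℕ) : ℤ) ∈ J).card

theorem countPos_succ_of_mem {n : ℕ} {J : Signs} (h : ((n + 1 : ℕ) : ℤ) ∈ J) :
    countPos (n + 1) J = countPos n J + 1 := by
  classical
  rw [countPos, Finset.range_add_one, Finset.filter_insert, if_pos h,
    Finset.card_insert_of_notMem (by simp)]
  rfl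

theorem countPos_succ_of_notMem {n : ℕ} {J : Signs} (h : ((n + 1 : ℕ) : ℤ) ∉ J) :
    countPos (n + 1) J = countPos n J := by
  classical
  rw [countPos, Finset.range_add_one, Finset.filter_insert, if_neg h]
  rfl

theorem bop_apply (X : CType) (t : K) (J : Signs) :
    ∃ p q : K, ∀ f, bop X t f J = p * f J + q * f (flip J) := by
  cases X with
  | D => exact ⟨0, 1, fun f => by simp [bop]⟩
  | B =>
    by_cases h : rr 0 ∈ J ∧ rl CType.B 0 ∉ J
    · exact ⟨_, _, fun f => hop_of_mem _ _ h⟩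
    · exact ⟨1, 0, fun f => (hop_of_notMem _ _ h).trans (by ring)⟩
  | C =>
    by_cases h : rr 0 ∈ J ∧ rl CType.C 0 ∉ J
    · exact ⟨_, _, fun f => hop_of_mem _ _ h⟩
    · exact ⟨1, 0, fun f => (hop_of_notMem _ _ h).trans (by ring)⟩

theorem prodCof_insert {V : Finset K} {t v : K} (ht : t ∉ V) (hv : v ∈ V) :
    prodCof (insert t V) v = cof v t * prodCof V v := by
  have hne : t ≠ v := fun h => ht (h ▸ hv)
  rw [prodCof, Finset.erase_insert_of_ne hne, Finset.prod_insert
    fun h => ht (Finset.mem_of_mem_erase h), prodCof]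

theorem one_mem_iff_BC {X : CType} (hX : X ≠ CType.D) (J : Signs) :
    (rr 0 ∈ J ∧ rl X 0 ∉ J) ↔ ((0 + 1 : ℕ) : ℤ) ∈ J := by
  have h := J.neg_mem_iff one_ne_zero
  have e : rl X 0 = -1 := by cases X <;> first | rfl | exact absurd rfl hX
  rw [e, h, not_not]
  exact and_self_iff

theorem symSum_one_of_mem {X : CType} {c : ℕ → K} {J : Signs} {V : Finset K}
    (h : ((0 + 1 : ℕ) : ℤ) ∈ J) : symSum X c 1 J V = wtSum X V := by
  rw [symSum_succ_of_mem h, wtSum]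
  exact Finset.sum_congr rfl fun v _ => by simp [rowFactor, symSum]

theorem symSum_one_of_notMem {X : CType} {c : ℕ → K} {J : Signs} {V : Finset K}
    (h : ((0 + 1 : ℕ) : ℤ) ∉ J) : symSum X c 1 J V = 1 :=
  symSum_succ_of_notMem h

/-- With `c₁ = ⊖ t`, the variable `t` can be removed from the symmetrized sums by applying the
middle factor of `F_n(t)`. -/
theorem symSum_insert_bar (X : CType) {c d : ℕ → K} {t : K} (hd0 : d 0 = bar t) (hc0 : c 0 = t)
    (hcd : ∀ k, d (k + 1) = c (k + 1)) {n : ℕ} (hn : 1 ≤ n) (J : Signs) (V : Finset K)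
    (ht : t ∉ V) (hV : Generic (insert t V))
    (hJ : X = CType.D → Even (V.card + 1 + countPos n J)) :
    symSum X d n J (insert t V) = bop X t (fun J => symSum X c n J V) J := by
  have hV' := hV.mono (Finset.subset_insert t V)
  have ht1 := (hV t (Finset.mem_insert_self t V)).1
  induction n, hn using Nat.le_induction generalizing V with
  | base =>
    have hf : ((0 + 1 : ℕ) : ℤ) ∈ flip J ↔ ((0 + 1 : ℕ) : ℤ) ∉ J := one_mem_flip
    by_cases hX : X = CType.D
    · subst hX
      change _ = symSum CType.D c 1 (flip J) V
      by_cases h : ((0 + 1 : ℕ) : ℤ) ∈ J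
      · rw [symSum_one_of_mem h, symSum_one_of_notMem fun h' => hf.1 h' h, wtSum_D hV]
        have := hJ rfl
        rw [countPos_succ_of_mem h, countPos, Finset.range_zero, Finset.filter_empty,
          Finset.card_empty] at this
        rw [Finset.card_insert_of_notMem ht]
        grind
      · rw [symSum_one_of_notMem h, symSum_one_of_mem (hf.2 h), wtSum_D hV']
        have := hJ rfl
        rw [countPos_succ_of_notMem h, countPos, Finset.range_zero, Finset.filter_empty,
          Finset.card_empty] at this
        grind
    · rw [bop_BC hX]
      by_cases h : ((0 + 1 : ℕ) : ℤ) ∈ J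
      · have ha : ((0 + 1 : ℕ) : ℤ) ∉ act X 0 J := fun h' => by
          rw [← one_mem_iff_BC hX, mem_act, mem_act, gen_rl, gen_rr] at h'
          exact h'.2 ((one_mem_iff_BC hX J).2 h).1
        rw [hop_of_mem _ _ ((one_mem_iff_BC hX J).2 h), symSum_one_of_mem h, symSum_one_of_mem h,
          symSum_one_of_notMem ha, wtSum_insert hX ht hV, mul_one]
      · rw [hop_of_notMem _ _ (mt (one_mem_iff_BC hX J).1 h), symSum_one_of_notMem h,
          symSum_one_of_notMem h]
  | succ n hn ih =>
    obtain ⟨k, rfl⟩ : ∃ k, n = k + 1 := ⟨n - 1, by omega⟩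
    obtain ⟨p, q, hpq⟩ := bop_apply X t J
    simp only [hpq] at ih ⊢
    have hf : ((k + 1 + 1 : ℕ) : ℤ) ∈ flip J ↔ ((k + 1 + 1 : ℕ) : ℤ) ∈ J :=
      mem_flip_of_two_le (by push_cast; omega)
    by_cases hm : ((k + 1 + 1 : ℕ) : ℤ) ∈ J
    · have hrow0 : rowFactor X d (k + 1) t = 0 := by
        rw [rowFactor, Finset.prod_range_succ', hd0, oplus_bar_self ht1, mul_zero, mul_zero]
      have hrow : ∀ v ∈ V, rowFactor X d (k + 1) v * cof v t = rowFactor X c (k + 1) v := by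
        intro v hv
        have hne : v - t ≠ 0 := sub_ne_zero.2 fun h => ht (h ▸ hv)
        have hom : ominus v t ≠ 0 := div_ne_zero hne ht1
        rw [rowFactor, rowFactor, Finset.prod_range_succ', Finset.prod_range_succ', hd0, hc0,
          oplus_bar ht1, cof]
        simp only [hcd]
        field_simp
      rw [symSum_succ_of_mem hm, symSum_succ_of_mem hm, symSum_succ_of_mem (hf.2 hm),
        Finset.sum_insert ht, hrow0, zero_mul, zero_mul, zero_add, Finset.mul_sum, Finset.mul_sum,
        ← Finset.sum_add_distrib]
      refine Finset.sum_congr rfl fun v hv => ?_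
      have hne : t ≠ v := fun h => ht (h ▸ hv)
      have hsub : insert t (V.erase v) ⊆ insert t V :=
        Finset.insert_subset_insert t (Finset.erase_subset v V)
      rw [Finset.erase_insert_of_ne hne, ih (V.erase v) (fun h => ht (Finset.mem_of_mem_erase h))
        (hV.mono hsub) (fun hX => ?_) (hV'.mono (Finset.erase_subset v V)),
        prodCof_insert ht hv, ← hrow v hv]
      · ring
      · have h1 := hJ hX
        rw [countPos_succ_of_mem hm] at h1
        have h2 := Finset.card_erase_add_one hv
        rw [← h2] at h1
        grind
    · rw [symSum_succ_of_notMem hm, symSum_succ_of_notMem hm, symSum_succ_of_notMem (mt hf.1 hm)]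
      refine ih V ht hV (fun hX => ?_) hV'
      rw [← countPos_succ_of_notMem hm]
      exact hJ hX

/-- In type `D`, a part `0` can be omitted if the number of parts then has the parity opposite to
that of the number of variables. -/
theorem symSum_flip {c : ℕ → K} {n : ℕ} (hn : 1 ≤ n) (J : Signs) (V : Finset K) (hV : Generic V)
    (hJ : Even (V.card + countPos n J)) (h1 : 1 ∈ J) :
    symSum CType.D c n J V = symSum CType.D c n (flip J) V := by
  induction n, hn using Nat.le_induction generalizing V with
  | base =>
    have hf : ((0 + 1 : ℕ) : ℤ) ∉ flip J := fun h => one_mem_flip.1 h h1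
    rw [symSum_one_of_mem (J := J) h1, symSum_one_of_notMem hf, wtSum_D hV]
    rw [countPos_succ_of_mem (J := J) h1, countPos, Finset.range_zero, Finset.filter_empty,
      Finset.card_empty] at hJ
    grind
  | succ n hn ih =>
    have hf : ((n + 1 : ℕ) : ℤ) ∈ flip J ↔ ((n + 1 : ℕ) : ℤ) ∈ J :=
      mem_flip_of_two_le (by push_cast; omega)
    by_cases hm : ((n + 1 : ℕ) : ℤ) ∈ J
    · rw [symSum_succ_of_mem hm, symSum_succ_of_mem (hf.2 hm)]
      refine Finset.sum_congr rfl fun v hv => ?_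
      rw [ih _ (hV.mono (Finset.erase_subset v V))]
      have h2 := Finset.card_erase_add_one hv
      rw [countPos_succ_of_mem hm, ← h2] at hJ
      grind
    · rw [symSum_succ_of_notMem hm, symSum_succ_of_notMem (mt hf.1 hm)]
      exact ih V hV (by rwa [countPos_succ_of_notMem hm] at hJ)

/-! ### Both sides satisfy the same recursion -/

/-- The sequence `c` with the term `e` inserted at position `j`. -/
def insertAt (j : ℕ) (e : K) (c : ℕ → K) (k : ℕ) : K :=
  if k < j then c k else if k = j then e else c (k - 1)

/-- Moving the inserted parameter `⊖ t` to the front. -/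
theorem symSum_insertAt (X : CType) (c : ℕ → K) {t : K} (ht : 1 + β * t ≠ 0) (m : ℕ)
    (V : Finset K) {j : ℕ} (hj : j ≤ m) :
    (fun J => symSum X (insertAt j (bar t) c) (m + 1) J V) =
      descSum β X 1 j c t fun J => symSum X (insertAt 0 (bar t) c) (m + 1) J V := by
  induction j with
  | zero => rfl
  | succ j ih =>
    rw [descSum_succ, ← ih (by omega), Nat.add_comm 1 j]
    funext J
    refine symSum_swap (c := insertAt (j + 1) (bar t) c) (d := insertAt j (bar t) c)
      (s := oplus (c j) t) ?_ ?_ ?_ ?_ (by omega) J V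
    · rw [insertAt, insertAt, if_pos (by omega), if_neg (by omega), if_pos rfl, oplus_oplus_bar ht]
    · simp [insertAt]
    · simp [insertAt]
    · intro k k1 k2
      simp only [insertAt]
      split_ifs <;> first | rfl | omega

/-- The sign patterns of signed permutations of `1, …, n`; in type `D` the number of minus signs
has the same parity as `N`. -/
def Good (X : CType) (n N : ℕ) : Set Signs :=
  {J | (∀ k : ℕ, n < k → (k : ℤ) ∉ J) ∧ (X = CType.D → Even (N + countPos n J))}

theorem countPos_act (X : CType) {i n : ℕ} (hi : 1 ≤ i) (hn : i < n) (J : Signs) :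
    countPos n (act X i J) = countPos n J := by
  classical
  obtain ⟨j, rfl⟩ : ∃ j, i = j + 1 := ⟨i - 1, by omega⟩
  have hg : ∀ k : ℕ, gen X (j + 1) ((k + 1 : ℕ) : ℤ) = ((Equiv.swap j (j + 1) k + 1 : ℕ) : ℤ) := by
    intro k
    rw [gen_succ_apply, Equiv.swap_apply_def]
    split_ifs <;> push_cast <;> omega
  refine Finset.card_bijective (Equiv.swap j (j + 1)) (Equiv.bijective _) fun k => ?_
  rw [Finset.mem_filter, Finset.mem_filter, mem_act, hg]
  refine and_congr_left fun _ => ?_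
  rw [Finset.mem_range, Finset.mem_range, Equiv.swap_apply_def]
  split_ifs <;> omega

theorem act_mem_Good {X : CType} {n N i : ℕ} (hi : 1 ≤ i) (hn : i < n) {J : Signs}
    (hJ : J ∈ Good X n N) : act X i J ∈ Good X n N := by
  refine ⟨fun k hk => ?_, fun hX => by rw [countPos_act X hi hn]; exact hJ.2 hX⟩
  obtain ⟨j, rfl⟩ : ∃ j, i = j + 1 := ⟨i - 1, by omega⟩
  have : gen X (j + 1) (k : ℤ) = k := by
    rw [gen_succ_apply]
    split_ifs <;> omega
  rw [mem_act, this]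
  exact hJ.1 k hk

theorem even_add_countPos_flip (N : ℕ) {n : ℕ} (hn : 1 ≤ n) (J : Signs) :
    Even (N + countPos n (flip J)) ↔ Even (N + 1 + countPos n J) := by
  induction n, hn using Nat.le_induction with
  | base =>
    have hf : ((0 + 1 : ℕ) : ℤ) ∈ flip J ↔ ((0 + 1 : ℕ) : ℤ) ∉ J := one_mem_flip
    have h0 : ∀ J, countPos 0 J = 0 := fun J => by simp [countPos]
    by_cases h : ((0 + 1 : ℕ) : ℤ) ∈ J
    · rw [countPos_succ_of_mem h, countPos_succ_of_notMem fun h' => hf.1 h' h, h0, h0]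
      grind
    · rw [countPos_succ_of_notMem h, countPos_succ_of_mem (hf.2 h), h0, h0]
  | succ n hn ih =>
    have hf : ((n + 1 : ℕ) : ℤ) ∈ flip J ↔ ((n + 1 : ℕ) : ℤ) ∈ J :=
      mem_flip_of_two_le (by push_cast; omega)
    by_cases h : ((n + 1 : ℕ) : ℤ) ∈ J
    · rw [countPos_succ_of_mem h, countPos_succ_of_mem (hf.2 h)]
      grind
    · rw [countPos_succ_of_notMem h, countPos_succ_of_notMem (mt hf.1 h), ih]

theorem flip_mem_Good {X : CType} {n N : ℕ} (hn : 1 ≤ n) {J : Signs}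
    (hJ : J ∈ Good X n (N + 1)) : flip J ∈ Good X n N :=
  ⟨fun k hk => by rw [mem_flip_of_two_le (by omega)]; exact hJ.1 k hk,
    fun hX => (even_add_countPos_flip N hn J).2 (hJ.2 hX)⟩

theorem bop_congr {X : CType} {n N : ℕ} (hn : 1 ≤ n) {f g : Signs → K}
    (h : Set.EqOn f g (Good X n N)) (t : K) :
    Set.EqOn (bop X t f) (bop X t g) (Good X n (N + 1)) := by
  intro J hJ
  have hf := h (flip_mem_Good hn hJ)
  by_cases hX : X = CType.D
  · subst hX
    exact hf
  · have hJ' : J ∈ Good X n N := ⟨hJ.1, fun h => absurd h hX⟩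
    obtain ⟨p, q, hpq⟩ := bop_apply X t J
    rw [hpq, hpq, hf, h hJ']

theorem descSum_congr {X : CType} {n N i k : ℕ} (hi : 1 ≤ i) (hk : i + k ≤ n) {f g : Signs → K}
    (h : Set.EqOn f g (Good X n N)) (c : ℕ → K) (t : K) :
    Set.EqOn (descSum β X i k c t f) (descSum β X i k c t g) (Good X n N) := by
  induction k generalizing i c f g with
  | zero => exact h
  | succ k ih =>
    refine ih (by omega) (by omega) (fun J hJ => ?_) _
    have h' := h (act_mem_Good hi (by omega) hJ)
    rw [hop, hop, h hJ, h']

/-- The sign pattern of the identity. -/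
def vac : Signs where
  carrier := {z | z < 0}
  zero_notMem := by simp
  neg_mem_iff' z hz := by
    rw [Set.mem_ofPred_eq, Set.mem_ofPred_eq]
    omega

theorem mem_vac {z : ℤ} : z ∈ vac ↔ z < 0 := Set.mem_ofPred_eq.to_iff

theorem eq_vac_iff {J : Signs} : J = vac ↔ ∀ k : ℕ, 1 ≤ k → (k : ℤ) ∉ J := by
  refine ⟨?_, fun h => Signs.ext_pos fun k hk => iff_of_false (h k hk) ?_⟩
  · rintro rfl k _
    rw [mem_vac]
    omega
  · rw [mem_vac]
    omega

open Classical in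
/-- The indicator function of a sign pattern. -/
def delta {R : Type*} [CommRing R] (J₀ J : Signs) : R := if J = J₀ then 1 else 0

theorem hop_vac {R : Type*} [CommRing R] (β₀ : R) (X : CType) {i : ℕ} (hi : 1 ≤ i) (t : R) :
    hop β₀ X i t (delta vac) = delta vac := by
  funext J
  by_cases h : rr i ∈ J ∧ rl X i ∉ J
  · obtain ⟨k, rfl⟩ : ∃ k, i = k + 1 := ⟨i - 1, by omega⟩
    have e1 : rl X (k + 1) = k + 1 := by cases X <;> rfl
    have h1 : J ≠ vac := by
      rintro rfl
      have := mem_vac.1 h.1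
      simp only [rr] at this
      omega
    have h2 : act X (k + 1) J ≠ vac := by
      intro e
      have : rl X (k + 1) ∈ act X (k + 1) J := by rw [mem_act, gen_rl]; exact h.1
      rw [e, mem_vac, e1] at this
      omega
    rw [hop_of_mem _ _ h, delta, delta, if_neg h1, if_neg h2]
    ring
  · rw [hop_of_notMem _ _ h]

theorem asc_vac {R : Type*} [CommRing R] (β₀ : R) (X : CType) {i : ℕ} (hi : 1 ≤ i) (k : ℕ)
    (t : R) : asc β₀ X i k t (delta vac) = delta vac := by
  induction k generalizing i with
  | zero => rfl
  | succ k ih => rw [asc, ih (by omega), hop_vac β₀ X hi]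

theorem desc_vac {R : Type*} [CommRing R] (β₀ : R) (X : CType) {i : ℕ} (hi : 1 ≤ i) (k : ℕ)
    (t : R) : desc β₀ X i k t (delta vac) = delta vac := by
  induction k generalizing i with
  | zero => rfl
  | succ k ih => rw [desc, hop_vac β₀ X hi, ih (by omega)]

theorem ascs_vac {R : Type*} [CommRing R] (β₀ : R) (X : CType) {i : ℕ} (hi : 1 ≤ i) (k : ℕ)
    (c : ℕ → R) : ascs β₀ X i k c (delta vac) = delta vac := by
  induction k generalizing i c with
  | zero => rfl
  | succ k ih => rw [ascs, asc_vac β₀ X hi, ih (by omega)]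

theorem symSum_empty (X : CType) (c : ℕ → K) (n : ℕ) (J : Signs)
    (hJ : ∀ k : ℕ, n < k → (k : ℤ) ∉ J) : symSum X c n J ∅ = delta vac J := by
  induction n with
  | zero => rw [delta, if_pos (eq_vac_iff.2 fun k hk => hJ k hk)]; rfl
  | succ n ih =>
    by_cases hm : ((n + 1 : ℕ) : ℤ) ∈ J
    · rw [symSum_succ_of_mem hm, Finset.sum_empty, delta,
        if_neg fun h => eq_vac_iff.1 h (n + 1) (by omega) hm]
    · rw [symSum_succ_of_notMem hm]
      refine ih fun k hk => ?_
      rcases Nat.lt_or_eq_of_le hk with h | rfl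
      · exact hJ k h
      · exact hm

/-- One step of the recursion: `t` is removed from the variables and put in front of the
parameters. -/
theorem symSum_insert (X : CType) {m N : ℕ} {c c' : ℕ → K} {t : K} (h0 : c' 0 = t)
    (hc : ∀ k, c' (k + 1) = c k) {V : Finset K} (hN : V.card = N) (ht : t ∉ V)
    (hV : Generic (insert t V)) :
    Set.EqOn (fun J => symSum X c (m + 1) J (insert t V))
      (descSum β X 1 m c t (bop X t fun J => symSum X c' (m + 1) J V)) (Good X (m + 1) (N + 1)) := by
  have ht1 := (hV t (Finset.mem_insert_self t V)).1
  have e : (fun J => symSum X c (m + 1) J (insert t V)) =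
      fun J => symSum X (insertAt m (bar t) c) (m + 1) J (insert t V) := funext fun J =>
    symSum_congr (fun _ _ _ => Iff.rfl) fun j hj => by rw [insertAt, if_pos (by omega)]
  rw [e, symSum_insertAt X c ht1 m _ le_rfl]
  refine descSum_congr le_rfl (by omega) (fun J hJ => ?_) c t
  refine symSum_insert_bar X ?_ h0 (fun k => ?_) (by omega) J V ht hV fun hX => ?_
  · simp [insertAt]
  · rw [hc]
    simp [insertAt]
  · rw [hN]
    exact hJ.2 hX

/-- The sequence `t, c₁, c₂, …`. -/
def consSeq (t : K) (c : ℕ → K) : ℕ → K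
  | 0 => t
  | k + 1 => c k

theorem ascs_foldr_eq_symSum (X : CType) (m : ℕ) (L : List K) (hL : L.Nodup)
    (hV : Generic L.toFinset) (c : ℕ → K) :
    Set.EqOn (ascs β X 1 m c
        (L.foldr (fun t f => desc β X 1 m t (bop X t (asc β X 1 m t f))) (delta vac)))
      (fun J => symSum X c (m + 1) J L.toFinset) (Good X (m + 1) L.length) := by
  induction L generalizing c with
  | nil =>
    intro J hJ
    rw [List.foldr_nil, ascs_vac β X le_rfl]
    exact (symSum_empty X c (m + 1) J hJ.1).symm
  | cons t L ih =>
    rw [List.nodup_cons] at hL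
    rw [List.toFinset_cons] at hV ⊢
    have ih' := ih hL.2 (hV.mono (Finset.subset_insert _ _)) (consSeq t c)
    rw [List.foldr_cons, ascs_desc_asc (commutesFrom_bop X t) m c
      (consSeq t c) t rfl (fun _ => rfl), List.length_cons]
    refine Set.EqOn.trans ?_ (symSum_insert X (c' := consSeq t c) rfl (fun _ => rfl)
      (List.toFinset_card_of_nodup hL.2) (by rw [List.mem_toFinset]; exact hL.1) hV).symm
    exact descSum_congr le_rfl (by omega) (bop_congr (by omega) ih' t) c t

theorem foldr_Fop_D (m : ℕ) (hm : 1 ≤ m) (L : List K) (f : Signs → K) :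
    L.foldr (fun t f => desc β CType.D 1 m t (bop CType.D t (asc β CType.D 1 m t f))) f =
      L.foldr (fun t f => Fop β CType.D (m + 1) t f) fun J => f (flip^[L.length] J) := by
  induction L generalizing f with
  | nil => rfl
  | cons t L ih =>
    have hcomm : ∀ (L : List K) (g : Signs → K),
        (fun J => L.foldr (fun t f => Fop β CType.D (m + 1) t f) g (flip J)) =
          L.foldr (fun t f => Fop β CType.D (m + 1) t f) fun J => g (flip J) := by
      intro L
      induction L with
      | nil => intro g; rfl
      | cons t L ih => intro g; rw [List.foldr_cons, List.foldr_cons, ← ih, Fop_D_flip]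
    have h1 := desc_bop_asc CType.D m (fun _ => hm) t
    simp only at h1
    rw [List.foldr_cons, ih, List.foldr_cons, h1, hcomm]
    congr 2

/-- The generating function of the `𝒢_{n,w}`, at Grassmannian elements, is the vector of the
symmetrized sums. -/
theorem ascs_foldr_Fop (X : CType) (n : ℕ) (hn : 1 ≤ n) (hD : X = CType.D → 2 ≤ n) (L : List K)
    (hL : L.Nodup) (hV : Generic L.toFinset) (hLD : X = CType.D → Even L.length) (c : ℕ → K)
    (J : Signs) (hJ : J ∈ Good X n L.length) :
    ascs β X 1 (n - 1) c (L.foldr (fun t f => Fop β X n t f) (delta vac)) J =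
      symSum X c n J L.toFinset := by
  obtain ⟨m, rfl⟩ : ∃ m, n = m + 1 := ⟨n - 1, by omega⟩
  refine Eq.trans ?_ (ascs_foldr_eq_symSum X m L hL hV c hJ)
  rw [Nat.add_sub_cancel]
  have key : L.foldr (fun t f => Fop β X (m + 1) t f) (delta vac) =
      L.foldr (fun t f => desc β X 1 m t (bop X t (asc β X 1 m t f))) (delta vac) := by
    cases X with
    | B => rfl
    | C => simp only [desc_bop_asc CType.C m (fun h => by cases h)]
    | D =>
      rw [foldr_Fop_D m (by have := hD rfl; omega)]
      obtain ⟨k, hk⟩ := hLD rfl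
      have : flip^[L.length] = id := by
        rw [hk, ← two_mul, Function.iterate_mul]
        have h2 : flip^[2] = id := funext fun J => flip_flip J
        rw [h2, Function.iterate_id]
      rw [this]
      rfl
  rw [key]

/-! ### The regular representation and sign patterns -/

section Projection

variable {X : CType}

theorem symm_zero (v : W X) : v.1.symm 0 = 0 := by
  have := symm_neg X v 0
  rw [neg_zero] at this
  omega

theorem symm_ne_zero (v : W X) {z : ℤ} (hz : z ≠ 0) : v.1.symm z ≠ 0 := by
  rw [← symm_zero v]
  exact symm_ne X v hz

theorem coe_neg (v : W X) (z : ℤ) : v.1 (-z) = -v.1 z := symm_neg X v⁻¹ z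

theorem coe_ne_zero (v : W X) {z : ℤ} (hz : z ≠ 0) : v.1 z ≠ 0 := symm_ne_zero v⁻¹ hz

/-- The sign pattern of a signed permutation. -/
def negSet (v : W X) : Signs where
  carrier := {z | v.1.symm z < 0}
  zero_notMem := by
    rw [Set.mem_ofPred_eq, symm_zero]
    exact lt_irrefl 0
  neg_mem_iff' z hz := by
    rw [Set.mem_ofPred_eq, Set.mem_ofPred_eq, symm_neg]
    have := symm_ne_zero v hz
    omega

theorem mem_negSet {v : W X} {z : ℤ} : z ∈ negSet v ↔ v.1.symm z < 0 := Set.mem_ofPred_eq.to_iff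

theorem negSet_one : negSet (1 : W X) = vac :=
  Signs.ext_mem fun z => by rw [mem_negSet, mem_vac]; rfl

theorem negSet_s_mul (i : ℕ) (v : W X) : negSet (s X i * v) = act X i (negSet v) :=
  Signs.ext_mem fun z => by rw [mem_negSet, mem_act, mem_negSet, s_mul_symm_apply]

/-- The one-line notation `[v(1), v(2), …]` is increasing. -/
def Increasing (v : W X) : Prop := ∀ j k : ℤ, 0 < j → j < k → v.1 j < v.1 k

theorem increasing_one : Increasing (1 : W X) := fun _ _ _ h => h

/-- At a descent of an increasing `v` the sign pattern is determined. -/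
theorem Increasing.of_descent {v : W X} (hv : Increasing v) {i : ℕ}
    (h : v.1.symm (rr i) < v.1.symm (rl X i)) :
    rr i ∈ negSet v ∧ rl X i ∉ negSet v := by
  obtain ⟨hr, hlt⟩ := isRoot_simple X i
  rw [mem_negSet, mem_negSet]
  constructor
  · by_contra h'
    have h0 := symm_ne_zero v hr.ne.2
    have := hv _ _ (by omega) h
    rw [Equiv.apply_symm_apply, Equiv.apply_symm_apply] at this
    omega
  · intro h'
    have := hv (v.1.symm (-rl X i)) (v.1.symm (-rr i)) (by rw [symm_neg]; omega)
      (by rw [symm_neg, symm_neg]; omega)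
    rw [Equiv.apply_symm_apply, Equiv.apply_symm_apply] at this
    omega

theorem isRoot_of_pos (v : W X) {j k : ℤ} (hj : 0 < j) (hk : 0 < k) : IsRoot X (v.1 j) (v.1 k) := by
  have h1 := coe_ne_zero v hj.ne'
  have h2 := coe_ne_zero v hk.ne'
  have h3 : v.1 j ≠ -v.1 k := by
    rw [← coe_neg]
    intro h
    have := v.1.injective h
    omega
  cases X
  · exact ⟨h1, h2⟩
  · exact ⟨h1, h2⟩
  · exact ⟨h1, h2, h3⟩

theorem Increasing.s_mul {v : W X} (hv : Increasing v) {i : ℕ}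
    (h : rl X i ∈ negSet v ∧ rr i ∉ negSet v) : Increasing (s X i * v) := by
  intro j k hj hjk
  rw [mem_negSet, mem_negSet] at h
  rw [s_coe_apply, s_coe_apply]
  rcases gen_pos X i _ _ (isRoot_of_pos v hj (hj.trans hjk)) (hv j k hj hjk) with
    ⟨e, _⟩ | ⟨e, _⟩ | ⟨_, hlt⟩
  · rw [← e, Equiv.symm_apply_apply] at h
    omega
  · have h2 : rr i = -v.1 j := by omega
    rw [h2, ← coe_neg, Equiv.symm_apply_apply] at h
    omega
  · exact hlt

theorem not_increasing_s_mul {v : W X} {i : ℕ} (ha : ¬ v.1.symm (rr i) < v.1.symm (rl X i))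
    (h : rl X i ∈ negSet v ↔ rr i ∈ negSet v) : ¬ Increasing (s X i * v) := by
  intro hv
  obtain ⟨hr, hlt⟩ := isRoot_simple X i
  rw [mem_negSet, mem_negSet] at h
  have h0 := symm_ne_zero v hr.ne.2
  have h1 := symm_ne_zero v hr.ne.1
  have h2 := symm_ne X v hlt.ne
  by_cases hp : v.1.symm (rl X i) < 0
  · have := hv (v.1.symm (-rr i)) (v.1.symm (-rl X i)) (by rw [symm_neg]; omega)
      (by rw [symm_neg, symm_neg]; omega)
    rw [s_coe_apply, s_coe_apply, Equiv.apply_symm_apply, Equiv.apply_symm_apply, gen_neg, gen_neg,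
      gen_rl, gen_rr] at this
    omega
  · have := hv (v.1.symm (rl X i)) (v.1.symm (rr i)) (by omega) (by omega)
    rw [s_coe_apply, s_coe_apply, Equiv.apply_symm_apply, Equiv.apply_symm_apply,
      gen_rl, gen_rr] at this
    omega

theorem not_increasing_s_mul' {v : W X} {i : ℕ} (ha : ¬ v.1.symm (rr i) < v.1.symm (rl X i))
    (h : ¬ Increasing v) : ¬ Increasing (s X i * v) := by
  intro hv
  refine h fun j k hj hjk => ?_
  by_contra hlt
  have hne : v.1 k ≠ v.1 j := fun e => hjk.ne' (v.1.injective e)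
  rcases gen_pos X i _ _ (isRoot_of_pos v (hj.trans hjk) hj) (by omega) with
    ⟨e, e'⟩ | ⟨e, e'⟩ | ⟨_, hlt'⟩
  · rw [← e, ← e', Equiv.symm_apply_apply, Equiv.symm_apply_apply] at ha
    omega
  · have h1 : rr i = -v.1 k := by omega
    have h2 : rl X i = -v.1 j := by omega
    rw [h1, h2, ← coe_neg, ← coe_neg, Equiv.symm_apply_apply, Equiv.symm_apply_apply] at ha
    omega
  · have := hv j k hj hjk
    rw [s_coe_apply, s_coe_apply] at this
    omega

/-- An increasing signed permutation is determined by its sign pattern. -/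
theorem Increasing.eq {v w : W X} (hv : Increasing v) (hw : Increasing w)
    (h : negSet v = negSet w) : v = w := by
  have hmono : ∀ {v : W X}, Increasing v → StrictMono fun n : ℕ => v.1 ((n : ℤ) + 1) :=
    fun hv m n hmn => hv _ _ (by omega) (by omega)
  have hrange : ∀ v : W X, Set.range (fun n : ℕ => v.1 ((n : ℤ) + 1)) =
      {z | z ≠ 0 ∧ z ∉ negSet v} := by
    intro v
    ext z
    rw [Set.mem_range, Set.mem_ofPred_eq, mem_negSet]
    constructor
    · rintro ⟨n, rfl⟩
      refine ⟨coe_ne_zero v (by omega), ?_⟩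
      rw [Equiv.symm_apply_apply]
      omega
    · rintro ⟨h0, h1⟩
      have := symm_ne_zero v h0
      refine ⟨(v.1.symm z - 1).toNat, ?_⟩
      have e : (((v.1.symm z - 1).toNat : ℕ) : ℤ) + 1 = v.1.symm z := by omega
      rw [e, Equiv.apply_symm_apply]
  have hfun := ((hmono hv).range_inj (hmono hw)).1 (by rw [hrange, hrange, h])
  have hpos : ∀ z : ℤ, 0 < z → v.1 z = w.1 z := fun z hz => by
    have := congrFun hfun (z - 1).toNat
    have e : (((z - 1).toNat : ℕ) : ℤ) + 1 = z := by omega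
    simpa only [e] using this
  refine Subtype.ext (Equiv.ext fun z => ?_)
  rcases lt_trichotomy z 0 with hz | rfl | hz
  · have := hpos (-z) (by omega)
    rw [coe_neg, coe_neg] at this
    omega
  · have h1 : v.1 0 = 0 := symm_zero v⁻¹
    have h2 : w.1 0 = 0 := symm_zero w⁻¹
    rw [h1, h2]
  · exact hpos z hz

open Classical in
/-- The projection of the regular representation to functions of sign patterns: the basis element
of `v` goes to the indicator function of its sign pattern if `v` is increasing, and to `0`
otherwise.  It amounts to dividing by the left ideal generated by `u₁, u₂, …`. -/
def proj (X : CType) : (W X →₀ K) →ₗ[K] (Signs → K) :=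
  Finsupp.linearCombination K fun v : W X => if Increasing v then delta (negSet v) else 0

theorem proj_single_of_increasing {v : W X} (hv : Increasing v) (c : K) :
    proj X (Finsupp.single v c) = c • delta (negSet v) := by
  rw [proj, Finsupp.linearCombination_single, if_pos hv]

theorem proj_single_of_not {v : W X} (hv : ¬ Increasing v) (c : K) :
    proj X (Finsupp.single v c) = 0 := by
  rw [proj, Finsupp.linearCombination_single, if_neg hv, smul_zero]

theorem proj_apply_negSet {w : W X} (hw : Increasing w) (y : W X →₀ K) :
    proj X y (negSet w) = y w := by
  induction y using Finsupp.induction_linear with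
  | zero => simp
  | add y z hy hz => rw [map_add, Pi.add_apply, hy, hz, Finsupp.add_apply]
  | single v c =>
    by_cases hv : Increasing v
    · rw [proj_single_of_increasing hv, Pi.smul_apply, smul_eq_mul, delta]
      by_cases e : v = w
      · subst e
        rw [if_pos rfl, mul_one, Finsupp.single_eq_same]
      · rw [if_neg fun h => e (hv.eq hw h.symm), mul_zero, Finsupp.single_eq_of_ne (Ne.symm e)]
    · rw [proj_single_of_not hv, Pi.zero_apply, Finsupp.single_eq_of_ne]
      rintro rfl
      exact hv hw

theorem hop_add (β₀ : K) (i : ℕ) (t : K) (f g : Signs → K) :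
    hop β₀ X i t (f + g) = hop β₀ X i t f + hop β₀ X i t g := by
  funext J
  simp only [hop, Pi.add_apply]
  split_ifs <;> ring

/-- The operator `1 + t u_i` becomes `hop`. -/
theorem proj_regOp (i : ℕ) (t : K) (y : W X →₀ K) :
    proj X (y + t • regOp X i y) = hop β X i t (proj X y) := by
  induction y using Finsupp.induction_linear with
  | zero =>
    rw [map_zero, smul_zero, add_zero, map_zero]
    funext J
    simp [hop]
  | add y z hy hz =>
    rw [map_add (proj X) y z, hop_add, ← hy, ← hz, map_add (regOp X i), smul_add, ← map_add]
    congr 1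
    abel
  | single v c =>
    have hself : ∀ J : Signs, (rr i ∈ act X i J ∧ rl X i ∉ act X i J) ↔
        (rl X i ∈ J ∧ rr i ∉ J) := fun J => by rw [mem_act, mem_act, gen_rr, gen_rl]
    have hact : ∀ J J' : Signs, act X i J = J' ↔ J = act X i J' := fun J J' =>
      ⟨fun h => by rw [← h, act_act], fun h => by rw [h, act_act]⟩
    by_cases hd : v.1.symm (rr i) < v.1.symm (rl X i)
    · rw [regOp_desc X i v c hd, map_add, map_smul]
      by_cases hv : Increasing v
      · have hJ := hv.of_descent hd
        rw [proj_single_of_increasing hv, proj_single_of_increasing hv]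
        funext I
        simp only [Pi.add_apply, Pi.smul_apply, smul_eq_mul, delta, hop]
        by_cases hI : rr i ∈ I ∧ rl X i ∉ I
        · have : act X i I ≠ negSet v := fun e => by
            rw [← e, hself] at hJ
            exact hI.2 hJ.1
          rw [if_pos hI, if_neg this]
          ring
        · have : I ≠ negSet v := fun e => hI (e ▸ hJ)
          rw [if_neg hI, if_neg this]
          ring
      · rw [proj_single_of_not hv, proj_single_of_not hv]
        funext I
        simp [hop]
    · rw [regOp_asc X i v c hd, map_add, map_smul]
      by_cases hv : Increasing v
      · by_cases hJ : rl X i ∈ negSet v ∧ rr i ∉ negSet v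
        · rw [proj_single_of_increasing hv, proj_single_of_increasing (hv.s_mul hJ), negSet_s_mul]
          funext I
          simp only [Pi.add_apply, Pi.smul_apply, smul_eq_mul, delta, hop]
          by_cases hI : rr i ∈ I ∧ rl X i ∉ I
          · have : I ≠ negSet v := fun e => hJ.2 (e ▸ hI.1)
            rw [if_pos hI, if_neg this]
            by_cases e : act X i I = negSet v
            · rw [if_pos e, if_pos ((hact _ _).1 e)]
              ring
            · rw [if_neg e, if_neg (mt (hact _ _).2 e)]
              ring
          · have : I ≠ act X i (negSet v) := fun e => by
              rw [e, hself] at hI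
              exact hI hJ
            rw [if_neg hI, if_neg this]
            ring
        · have hb : rl X i ∈ negSet v ↔ rr i ∈ negSet v := by
            refine ⟨fun h => not_not.1 fun h' => hJ ⟨h, h'⟩, fun h => ?_⟩
            rw [mem_negSet] at h ⊢
            omega
          rw [proj_single_of_increasing hv, proj_single_of_not (not_increasing_s_mul hd hb)]
          funext I
          simp only [Pi.add_apply, Pi.smul_apply, smul_eq_mul, delta, hop, Pi.zero_apply, mul_zero,
            add_zero]
          by_cases hI : rr i ∈ I ∧ rl X i ∉ I
          · have h1 : I ≠ negSet v := fun e => hI.2 (e ▸ hb.2 (e ▸ hI.1))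
            have h2 : act X i I ≠ negSet v := fun e => by
              rw [hact] at e
              rw [e, hself] at hI
              exact hJ hI
            rw [if_pos hI, if_neg h1, if_neg h2]
            ring
          · rw [if_neg hI]
      · rw [proj_single_of_not hv, proj_single_of_not (not_increasing_s_mul' hd hv)]
        funext I
        simp [hop]

end Projection

/-! ### Elements of the idCoxeter algebra as operators -/

/-- The element `z` acts on functions of sign patterns as the operator `T`. -/
def ActsAs (X : CType) (z : IdAlg X) (T : (Signs → K) → Signs → K) : Prop :=
  ∀ y, proj X (reg X z y) = T (proj X y)

section ActsAs

variable {X : CType}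

theorem actsAs_one : ActsAs X 1 id := fun y => by rw [map_one]; rfl

theorem ActsAs.mul {z z' : IdAlg X} {T T' : (Signs → K) → Signs → K} (h : ActsAs X z T)
    (h' : ActsAs X z' T') : ActsAs X (z * z') fun f => T (T' f) := fun y => by
  rw [map_mul, Module.End.mul_apply, h, h']

theorem actsAs_h (i : ℕ) (t : K) : ActsAs X (h X i t) (hop β X i t) := fun y => by
  rw [← proj_regOp, h, map_add, map_one, map_smul, reg_u]
  rfl

/-- `h_i(t) h_{i+1}(t) ⋯ h_{i+k-1}(t)` in the idCoxeter algebra. -/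
def ascElt (X : CType) (i k : ℕ) (t : K) : IdAlg X := ((List.range' i k).map fun j => h X j t).prod

/-- `h_{i+k-1}(t) ⋯ h_{i+1}(t) h_i(t)` in the idCoxeter algebra. -/
def descElt (X : CType) (i k : ℕ) (t : K) : IdAlg X :=
  ((List.range' i k).reverse.map fun j => h X j t).prod

theorem ascElt_succ (i k : ℕ) (t : K) : ascElt X i (k + 1) t = h X i t * ascElt X (i + 1) k t := by
  rw [ascElt, List.range'_succ, List.map_cons, List.prod_cons, ascElt]

theorem descElt_succ (i k : ℕ) (t : K) :
    descElt X i (k + 1) t = descElt X (i + 1) k t * h X i t := by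
  rw [descElt, List.range'_succ, List.reverse_cons, List.map_append, List.prod_append, descElt]
  simp

theorem actsAs_ascElt (i k : ℕ) (t : K) : ActsAs X (ascElt X i k t) (asc β X i k t) := by
  induction k generalizing i with
  | zero => exact actsAs_one
  | succ k ih =>
    rw [ascElt_succ]
    exact (actsAs_h i t).mul (ih (i + 1))

theorem actsAs_descElt (i k : ℕ) (t : K) : ActsAs X (descElt X i k t) (desc β X i k t) := by
  induction k generalizing i with
  | zero => exact actsAs_one
  | succ k ih =>
    rw [descElt_succ]
    exact (ih (i + 1)).mul (actsAs_h i t)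

theorem actsAs_F (n : ℕ) (t : K) : ActsAs X (F X n t) (Fop β X n t) := by
  cases X with
  | B => exact ((actsAs_descElt 1 (n - 1) t).mul (actsAs_h 0 t)).mul (actsAs_ascElt 1 (n - 1) t)
  | C =>
    have := ((actsAs_descElt 1 (n - 1) t).mul ((actsAs_h 0 t).mul (actsAs_h 0 t))).mul
      (actsAs_ascElt (X := CType.C) 1 (n - 1) t)
    rw [← sq] at this
    exact this
  | D =>
    exact ((actsAs_descElt 2 (n - 2) t).mul ((actsAs_h 1 t).mul (actsAs_h 0 t))).mul
      (actsAs_ascElt 2 (n - 2) t)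

theorem actsAs_list_prod {ι : Type*} (L : List ι) (z : ι → IdAlg X)
    (T : ι → (Signs → K) → Signs → K) (h : ∀ i, ActsAs X (z i) (T i)) :
    ActsAs X (L.map z).prod fun f => L.foldr (fun i f => T i f) f := by
  induction L with
  | nil => exact actsAs_one
  | cons i L ih =>
    rw [List.map_cons, List.prod_cons]
    exact (h i).mul ih

theorem u_mul_u (i : ℕ) : u X i * u X i = β • u X i := by
  rw [u, ← map_mul, ← map_smul]
  exact RingQuot.mkAlgHom_rel K (IdRel.quad i)

theorem h_mul_h (i : ℕ) (s t : K) : h X i s * h X i t = h X i (oplus s t) := by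
  rw [h, h, h, mul_add, add_mul, add_mul, mul_one, one_mul, mul_one, smul_mul_smul_comm, u_mul_u,
    smul_smul, oplus, add_smul, add_smul]
  have : s * t * β = β * s * t := by ring
  rw [this]
  abel

theorem h_mul_h_of_oplus_eq_zero (i : ℕ) {s t : K} (hst : oplus s t = 0) :
    h X i s * h X i t = 1 := by
  rw [h_mul_h, hst, h, zero_smul, add_zero]

theorem descElt_mul_ascElt (i k : ℕ) {s t : K} (hst : oplus s t = 0) :
    descElt X i k s * ascElt X i k t = 1 := by
  induction k generalizing i with
  | zero => exact mul_one 1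
  | succ k ih =>
    rw [descElt_succ, ascElt_succ, mul_assoc, ← mul_assoc (h X i s),
      h_mul_h_of_oplus_eq_zero i hst, one_mul, ih]

theorem ascElt_mul_descElt (i k : ℕ) {s t : K} (hst : oplus s t = 0) :
    ascElt X i k s * descElt X i k t = 1 := by
  induction k generalizing i with
  | zero => exact mul_one 1
  | succ k ih =>
    rw [descElt_succ, ascElt_succ, mul_assoc, ← mul_assoc (ascElt X (i + 1) k s), ih, one_mul,
      h_mul_h_of_oplus_eq_zero i hst]

theorem GA_eq (n : ℕ) (c : ℕ → K) : GA X n c =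
    ((List.range (n - 1)).map fun k => descElt X (1 + k) (n - 1 - k) (c k)).prod := by
  rw [GA]
  congr 1
  refine List.map_congr_left fun k _ => ?_
  rw [A, descElt, Nat.add_comm 1 k, Nat.sub_sub, Nat.add_comm 1 k]

/-- `G_A(c̄)⁻¹` acts as `Ã_{n-1}(c_{n-1}) ⋯ Ã₁(c₁)`. -/
theorem exists_inverse_actsAs (i k : ℕ) (c : ℕ → K) (hc : ∀ j, 1 + β * c j ≠ 0) :
    ∃ z : IdAlg X,
      z * ((List.range k).map fun j => descElt X (i + j) (k - j) (bar (c j))).prod = 1 ∧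
      ((List.range k).map fun j => descElt X (i + j) (k - j) (bar (c j))).prod * z = 1 ∧
      ActsAs X z (ascs β X i k c) := by
  induction k generalizing i c with
  | zero => exact ⟨1, mul_one 1, mul_one 1, actsAs_one⟩
  | succ k ih =>
    obtain ⟨z, h1, h2, h3⟩ := ih (i + 1) (fun j => c (j + 1)) fun j => hc (j + 1)
    have e : ((List.range (k + 1)).map fun j => descElt X (i + j) (k + 1 - j) (bar (c j))).prod =
        descElt X i (k + 1) (bar (c 0)) *
          ((List.range k).map fun j => descElt X (i + 1 + j) (k - j) (bar (c (j + 1)))).prod := by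
      rw [List.range_succ_eq_map, List.map_cons, List.prod_cons, List.map_map]
      congr 3
      funext j
      rw [Function.comp_apply, Nat.succ_eq_add_one, Nat.add_sub_add_right, Nat.add_assoc i 1 j,
        Nat.add_comm 1 j]
    have ho : oplus (c 0) (bar (c 0)) = 0 := oplus_bar_self (hc 0)
    have ho' : oplus (bar (c 0)) (c 0) = 0 := by
      rw [← ho, oplus, oplus]
      ring
    refine ⟨z * ascElt X i (k + 1) (c 0), ?_, ?_, h3.mul (actsAs_ascElt i (k + 1) (c 0))⟩
    · rw [e, mul_assoc, ← mul_assoc (ascElt X i (k + 1) (c 0)), ascElt_mul_descElt i _ ho, one_mul,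
        h1]
    · rw [e, mul_assoc, ← mul_assoc _ z, h2, one_mul, descElt_mul_ascElt i _ ho']

theorem one_add_beta_mul_algebraMap_X_ne_zero (v : Var) :
    1 + β * algebraMap P K (MvPolynomial.X v) ≠ 0 := by
  rw [β, ← map_mul, ← map_one (algebraMap P K), ← map_add, Ne,
    map_eq_zero_iff _ (IsFractionRing.injective P K)]
  intro h
  have := congrArg (MvPolynomial.eval fun _ => (0 : ℤ)) h
  simp at this

theorem proj_reg_G (n : ℕ) : proj X (reg X (G X n) (Finsupp.single 1 1)) =
    ascs β X 1 (n - 1) b (((List.range n).map x).foldr (fun t f => Fop β X n t f) (delta vac)) := by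
  have h0 : proj X (Finsupp.single (1 : W X) 1) = delta vac := by
    rw [proj_single_of_increasing increasing_one, negSet_one, one_smul]
  have hGA : proj X (reg X (GA X n a) (Finsupp.single 1 1)) = delta vac := by
    rw [GA_eq, actsAs_list_prod _ _ (fun k => desc β X (1 + k) (n - 1 - k) (a k))
      fun k => actsAs_descElt _ _ _, h0]
    generalize List.range (n - 1) = L
    induction L with
    | nil => rfl
    | cons k L ih =>
      dsimp only at ih ⊢
      rw [List.foldr_cons, ih, desc_vac β X (by omega)]
  obtain ⟨z, h1, h2, h3⟩ := exists_inverse_actsAs (X := X) 1 (n - 1) b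
    fun j => one_add_beta_mul_algebraMap_X_ne_zero _
  have hinv : Ring.inverse (GA X n fun k => bar (b k)) = z := by
    rw [GA_eq]
    exact Ring.inverse_unit ⟨_, z, h2, h1⟩
  have hF : ActsAs X (Fx X n) fun f => (List.range n).foldr (fun k f => Fop β X n (x k) f) f :=
    actsAs_list_prod _ _ _ fun k => actsAs_F n (x k)
  rw [G, hinv, map_mul, Module.End.mul_apply, map_mul, Module.End.mul_apply, h3, hF, hGA,
    List.foldr_map]

/-- The coefficient of `u_w` for Grassmannian `w`. -/
theorem GPoly_eq {w : W X} (hw : Increasing w) (n : ℕ) : GPoly X n w =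
    ascs β X 1 (n - 1) b
      (((List.range n).map x).foldr (fun t f => Fop β X n t f) (delta vac)) (negSet w) := by
  rw [← proj_reg_G, proj_apply_negSet hw]
  rfl

end ActsAs

/-! ### From the recursive sums to the symmetrizations -/

/-- The symmetrized product with one factor for each row, the variables being chosen row by row
from the finite set. -/
def listSum : List (K → K) → Finset K → K
  | [], _ => 1
  | g :: fs, V => ∑ v ∈ V, g v * prodCof V v * listSum fs (V.erase v)

theorem symSum_eq_listSum (X : CType) (c : ℕ → K) (n : ℕ) (J : Signs) (l : List ℕ)
    (hl : l.Pairwise (· > ·)) (hJ : ∀ k : ℕ, k ∈ l ↔ 1 ≤ k ∧ k ≤ n ∧ (k : ℤ) ∈ J) (V : Finset K) :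
    symSum X c n J V = listSum (l.map fun k => rowFactor X c (k - 1)) V := by
  induction n generalizing l V with
  | zero =>
    have : l = [] := List.eq_nil_iff_forall_not_mem.2 fun k hk => by
      have := (hJ k).1 hk
      omega
    subst this
    rfl
  | succ n ih =>
    by_cases hm : ((n + 1 : ℕ) : ℤ) ∈ J
    · cases l with
      | nil => exact absurd ((hJ (n + 1)).2 ⟨by omega, le_rfl, hm⟩) List.not_mem_nil
      | cons a l =>
        rw [List.pairwise_cons] at hl
        have ha : a = n + 1 := by
          have h1 := (hJ a).1 List.mem_cons_self
          rcases List.mem_cons.1 ((hJ (n + 1)).2 ⟨by omega, le_rfl, hm⟩) with h | h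
          · exact h.symm
          · have := hl.1 _ h
            omega
        subst ha
        rw [symSum_succ_of_mem hm, List.map_cons, listSum]
        refine Finset.sum_congr rfl fun v _ => ?_
        rw [ih l hl.2, Nat.add_sub_cancel]
        intro k
        constructor
        · intro hk
          have h1 := hl.1 k hk
          have h2 := (hJ k).1 (List.mem_cons_of_mem _ hk)
          exact ⟨h2.1, by omega, h2.2.2⟩
        · rintro ⟨h1, h2, h3⟩
          rcases List.mem_cons.1 ((hJ k).2 ⟨h1, by omega, h3⟩) with h | h
          · omega
          · exact h
    · rw [symSum_succ_of_notMem hm]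
      refine ih l hl (fun k => ?_) V
      rw [hJ k]
      constructor
      · rintro ⟨h1, h2, h3⟩
        refine ⟨h1, ?_, h3⟩
        rcases Nat.lt_or_eq_of_le h2 with h | rfl
        · omega
        · exact absurd h3 hm
      · rintro ⟨h1, h2, h3⟩
        exact ⟨h1, by omega, h3⟩

theorem symmetrize_eq_listSum_aux (pow : K → ℕ → K) (n : ℕ) (lam : List ℕ) (hn : lam.length ≤ n)
    (y : Fin n → K) (hy : Function.Injective y) :
    (((n - lam.length).factorial : ℕ) : K)⁻¹ *
      ∑ σ : Equiv.Perm (Fin n), ∏ i ∈ Finset.univ.filter fun i : Fin n => (i : ℕ) < lam.length,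
        (pow (y (σ i)) (lam.getD i 0) * ∏ j ∈ Finset.Ioi i, cof (y (σ i)) (y (σ j))) =
      listSum (lam.map fun k v => pow v k) (Finset.univ.image y) := by
  induction n generalizing lam with
  | zero =>
    obtain rfl : lam = [] := List.length_eq_zero_iff.1 (by omega)
    simp [listSum]
  | succ n ih =>
    cases lam with
    | nil =>
      have : (((n + 1).factorial : ℕ) : K) ≠ 0 := Nat.cast_ne_zero.2 (Nat.factorial_ne_zero _)
      simp only [List.length_nil, Nat.not_lt_zero, Finset.filter_false, Finset.prod_empty,
        Finset.sum_const, Finset.card_univ, Fintype.card_perm, Fintype.card_fin, nsmul_eq_mul,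
        mul_one, Nat.sub_zero, List.map_nil, listSum]
      exact inv_mul_cancel₀ this
    | cons k lam =>
      rw [List.length_cons] at hn
      rw [List.map_cons, listSum, Finset.sum_image fun p _ q _ h => hy h,
        ← (Equiv.Perm.decomposeFin (n := n)).symm.sum_comp, Fintype.sum_prod_type, Finset.mul_sum]
      refine Finset.sum_congr rfl fun p _ => ?_
      set y' : Fin n → K := fun j => y (Equiv.swap 0 p j.succ) with hy'
      have hy'inj : Function.Injective y' := fun i j h =>
        Fin.succ_injective n ((Equiv.swap 0 p).injective (hy h))
      have himage : (Finset.univ.image y).erase (y p) = Finset.univ.image y' := by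
        ext v
        simp only [Finset.mem_erase, Finset.mem_image, Finset.mem_univ, true_and]
        constructor
        · rintro ⟨hv, q, rfl⟩
          have hq : Equiv.swap 0 p q ≠ 0 := fun h => by
            have : q = p :=
              (Equiv.swap 0 p).injective (by rw [h, Equiv.swap_apply_right])
            exact hv (by rw [this])
          obtain ⟨j, hj⟩ := Fin.exists_succ_eq.2 hq
          exact ⟨j, by rw [hy']; dsimp only; rw [hj, Equiv.swap_apply_self]⟩
        · rintro ⟨j, rfl⟩
          refine ⟨fun h => ?_, _, rfl⟩
          have h1 := hy h
          rw [← Equiv.swap_apply_left 0 p] at h1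
          exact Fin.succ_ne_zero j ((Equiv.swap 0 p).injective h1)
      rw [himage, ← ih lam (by omega) y' hy'inj, List.length_cons, Nat.add_sub_add_right,
        mul_left_comm]
      congr 1
      rw [Finset.mul_sum]
      refine Finset.sum_congr rfl fun e _ => ?_
      rw [Finset.prod_filter, Fin.prod_univ_succ, if_pos (by simp), Finset.prod_filter]
      simp only [Equiv.Perm.decomposeFin_symm_apply_zero,
        Equiv.Perm.decomposeFin_symm_apply_succ, Fin.prod_Ioi_zero, Fin.prod_Ioi_succ,
        Fin.val_zero, Fin.val_succ, List.getD_cons_zero, List.getD_cons_succ,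
        Nat.add_lt_add_iff_right]
      congr 2
      rw [prodCof, himage, Finset.prod_image fun i _ j _ h => hy'inj h]
      exact Equiv.prod_comp e fun j => cof (y p) (y' j)

/-- The set of the first `N` variables. -/
def varSet (N : ℕ) : Finset K := ((List.range N).map x).toFinset

theorem x_injective : Function.Injective x := fun i j h => by
  have h1 := IsFractionRing.injective P K h
  have h2 := MvPolynomial.X_injective h1
  exact Var.x.inj h2

theorem varSet_eq_image (N : ℕ) : varSet N = Finset.univ.image fun i : Fin N => x i := by
  ext v
  simp only [varSet, List.mem_toFinset, List.mem_map, List.mem_range, Finset.mem_image,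
    Finset.mem_univ, true_and]
  exact ⟨fun ⟨i, hi, h⟩ => ⟨⟨i, hi⟩, h⟩, fun ⟨i, h⟩ => ⟨i, i.2, h⟩⟩

theorem symmetrize_eq_listSum (pow : K → ℕ → K) (n : ℕ) (lam : List ℕ) (hn : lam.length ≤ n) :
    symmetrize pow n lam = listSum (lam.map fun k v => pow v k) (varSet n) := by
  rw [varSet_eq_image, ← symmetrize_eq_listSum_aux pow n lam hn (fun i : Fin n => x i)
    fun i j h => Fin.ext (x_injective h)]
  rfl

theorem generic_varSet (N : ℕ) : Generic (varSet N) := by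
  intro v hv
  simp only [varSet, List.mem_toFinset, List.mem_map] at hv
  obtain ⟨i, _, rfl⟩ := hv
  refine ⟨one_add_beta_mul_algebraMap_X_ne_zero _, ?_⟩
  rw [oplus, x, β, ← map_mul, ← map_mul, ← map_add, ← map_add, Ne,
    map_eq_zero_iff _ (IsFractionRing.injective P K)]
  intro h
  have := congrArg (MvPolynomial.eval fun _ => (1 : ℤ)) h
  simp at this

/-! ### Grassmannian elements -/

section Grassmannian

variable {X : CType}

theorem wordProd_reverse (ω : List ℕ) : wordProd X ω.reverse = (wordProd X ω)⁻¹ := by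
  rw [wordProd, wordProd, List.prod_inv_reverse, List.map_map, List.map_reverse]
  congr 3
  funext i
  exact (s_inv X i).symm

theorem len_inv (w : W X) : len X w⁻¹ = len X w := by
  have key : ∀ w : W X, len X w⁻¹ ≤ len X w := fun w => by
    obtain ⟨ω, hl, rfl⟩ := exists_word_len X w
    rw [← hl, ← wordProd_reverse, ← List.length_reverse]
    exact len_le X _
  refine le_antisymm (key w) ?_
  have := key w⁻¹
  rwa [inv_inv] at this

/-- Minimal length in the coset `w S_∞` means that the one-line notation is increasing. -/
theorem IsGrassmannian.increasing {w : W X} (hw : IsGrassmannian X w) : Increasing w := by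
  have hstep : ∀ i : ℕ, w.1 ((i : ℤ) + 1) < w.1 ((i : ℤ) + 1 + 1) := by
    intro i
    have h1 := hw (s X (i + 1)) (Subgroup.subset_closure ⟨i + 1, by simp, rfl⟩)
    rw [← len_inv w, ← len_inv (w * s X (i + 1)), mul_inv_rev, s_inv] at h1
    have h2 := mt (descent_iff X (i + 1) w⁻¹).2 (not_lt.2 h1)
    have e1 : rl X (i + 1) = (i : ℤ) + 1 := by cases X <;> rfl
    have e2 : rr (i + 1) = (i : ℤ) + 1 + 1 := by simp only [rr]; ring
    rw [e1, e2] at h2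
    have h3 : ¬ w.1 ((i : ℤ) + 1 + 1) < w.1 ((i : ℤ) + 1) := h2
    have h4 : w.1 ((i : ℤ) + 1 + 1) ≠ w.1 ((i : ℤ) + 1) := fun e => by
      have := w.1.injective e
      omega
    omega
  have hmono : StrictMono fun i : ℕ => w.1 ((i : ℤ) + 1) := strictMono_nat_of_lt_succ fun i => by
    simpa using hstep i
  intro j k hj hjk
  have := hmono (show (j - 1).toNat < (k - 1).toNat by omega)
  have ej : (((j - 1).toNat : ℕ) : ℤ) + 1 = j := by omega
  have ek : (((k - 1).toNat : ℕ) : ℤ) + 1 = k := by omega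
  simpa only [ej, ek] using this

theorem gen_of_lt {i n : ℕ} (hi : i < n) (hn : X = CType.D → 2 ≤ n) {z : ℤ} (hz : (n : ℤ) < z) :
    gen X i z = z := by
  cases i with
  | zero =>
    cases X with
    | D =>
      have := hn rfl
      rw [gen_D_zero_apply]
      split_ifs <;> omega
    | B => rw [gen_B_zero_apply]; split_ifs <;> omega
    | C => rw [gen_C_zero_apply]; split_ifs <;> omega
  | succ k => rw [gen_succ_apply]; split_ifs <;> omega

theorem symm_apply_of_mem_Wfin {n : ℕ} (hn : X = CType.D → 2 ≤ n) {w : W X} (hw : w ∈ Wfin X n)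
    {z : ℤ} (hz : (n : ℤ) < z) : w.1.symm z = z := by
  rw [Equiv.symm_apply_eq, eq_comm]
  induction hw using Subgroup.closure_induction with
  | mem g hg =>
    obtain ⟨i, hi, rfl⟩ := hg
    exact gen_of_lt hi hn hz
  | one => rfl
  | mul v w _ _ hv hw =>
    change v.1 (w.1 z) = z
    rw [hw, hv]
  | inv w _ hw =>
    change w.1.symm z = z
    rw [Equiv.symm_apply_eq, hw]

theorem exists_mem_Wfin (w : W X) : ∃ n, 2 ≤ n ∧ w ∈ Wfin X n := by
  obtain ⟨ω, rfl⟩ := exists_word X w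
  refine ⟨ω.sum + 2, by omega, ?_⟩
  rw [wordProd]
  refine Subgroup.list_prod_mem _ fun v hv => ?_
  obtain ⟨i, hi, rfl⟩ := List.mem_map.1 hv
  refine Subgroup.subset_closure ⟨i, ?_, rfl⟩
  have := List.le_sum_of_mem hi
  rw [Set.mem_ofPred_eq]
  omega

/-- Elements of `W(D)` have an even number of barred entries. -/
theorem even_countPos {n : ℕ} (hn : 2 ≤ n) {w : W CType.D} (hw : w ∈ Wfin CType.D n) :
    Even (countPos n (negSet w)) := by
  have hgen : ∀ i < n, ∀ J, Even (countPos n (act CType.D i J)) ↔ Even (countPos n J) := by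
    intro i hi J
    cases i with
    | succ k => rw [countPos_act CType.D (by omega) hi]
    | zero =>
      have e : act CType.D 0 J = flip (act CType.D 1 (flip J)) := by
        refine Signs.ext_mem fun z => ?_
        simp only [flip, mem_act]
        rfl
      have h1 := even_add_countPos_flip 0 (n := n) (by omega) (act CType.D 1 (flip J))
      have h2 := even_add_countPos_flip 1 (n := n) (by omega) J
      rw [countPos_act CType.D le_rfl (by omega)] at h1
      rw [e]
      grind
  induction hw using Subgroup.closure_induction_left with
  | one =>
    have : countPos n (negSet (1 : W CType.D)) = 0 := by
      classical
      refine Finset.card_eq_zero.2 (Finset.filter_eq_empty_iff.2 fun k _ => ?_)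
      rw [negSet_one, mem_vac]
      omega
    rw [this]
    exact Even.zero
  | mul_left g hg y hy ih =>
    obtain ⟨i, hi, rfl⟩ := hg
    rw [negSet_s_mul, hgen i hi]
    exact ih
  | inv_mul_cancel g hg y hy ih =>
    obtain ⟨i, hi, rfl⟩ := hg
    rw [s_inv, negSet_s_mul, hgen i hi]
    exact ih

theorem negSet_mem_Good {n N : ℕ} (hn : X = CType.D → 2 ≤ n) (hN : X = CType.D → Even N) {w : W X}
    (hw : w ∈ Wfin X n) : negSet w ∈ Good X n N := by
  refine ⟨fun k hk => ?_, fun hX => ?_⟩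
  · rw [mem_negSet, symm_apply_of_mem_Wfin hn hw (by omega)]
    omega
  · subst hX
    exact (hN rfl).add (even_countPos (hn rfl) hw)

theorem exists_numBars {w : W X} (hw : Increasing w) :
    ∀ j : ℕ, 1 ≤ j → (w.1 (j : ℤ) < 0 ↔ j ≤ numBars w.1) := by
  obtain ⟨n, hn, hn'⟩ := exists_mem_Wfin w
  have hex : ∃ m : ℕ, 0 < w.1 ((m : ℤ) + 1) := by
    refine ⟨n, ?_⟩
    have := symm_apply_of_mem_Wfin (fun _ => hn) hn' (z := (n : ℤ) + 1) (by omega)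
    rw [Equiv.symm_apply_eq] at this
    omega
  classical
  have key : ∀ j : ℕ, 1 ≤ j → (w.1 (j : ℤ) < 0 ↔ j ≤ Nat.find hex) := by
    intro j hj
    have h0 := coe_ne_zero w (z := (j : ℤ)) (by omega)
    constructor
    · intro h
      by_contra hlt
      have h1 := Nat.find_spec hex
      rcases Nat.lt_or_eq_of_le (show Nat.find hex + 1 ≤ j by omega) with h2 | h2
      · have := hw _ _ (by omega) (show ((Nat.find hex : ℕ) : ℤ) + 1 < j by omega)
        omega
      · rw [← h2] at h
        push_cast at h
        omega
    · intro h
      have h1 := Nat.find_min hex (m := j - 1) (by omega)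
      have e : (((j - 1 : ℕ) : ℤ)) + 1 = j := by omega
      rw [e] at h1
      omega
  have hset : {j : ℕ | 1 ≤ j ∧ w.1 (j : ℤ) < 0} = (Finset.Icc 1 (Nat.find hex) : Set ℕ) := by
    ext j
    rw [Set.mem_ofPred_eq, Finset.coe_Icc, Set.mem_Icc]
    exact and_congr_right fun hj => key j hj
  have hcard : numBars w.1 = Nat.find hex := by
    rw [numBars, hset, Set.ncard_coe_finset, Nat.card_Icc, Nat.add_sub_cancel]
  rw [hcard]
  exact key

/-- In the definition of `lamBC` the list of indices is a list of integers. -/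
theorem lamBC_eq (w : Equiv.Perm ℤ) :
    lamBC w = (List.range (numBars w)).map fun k : ℕ => (-w ((k : ℤ) + 1)).toNat := by
  rw [lamBC]
  simp [List.map_eq_flatMap, List.flatMap_assoc]

theorem lamBC_pairwise {w : W X} (hw : Increasing w) : (lamBC w.1).Pairwise (· > ·) := by
  have hb := exists_numBars hw
  rw [lamBC_eq, List.pairwise_map]
  refine List.Pairwise.imp_of_mem ?_ List.pairwise_lt_range
  intro i j hi hj hij
  have h1 := (hb (i + 1) (by omega)).2 (List.mem_range.1 hi)
  have h2 := (hb (j + 1) (by omega)).2 (List.mem_range.1 hj)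
  have h3 := hw ((i : ℤ) + 1) ((j : ℤ) + 1) (by omega) (by omega)
  push_cast at h1 h2
  omega

/-- The parts are the positive members of the sign pattern. -/
theorem mem_lamBC {w : W X} (hw : Increasing w) (k : ℕ) :
    k ∈ lamBC w.1 ↔ 1 ≤ k ∧ (k : ℤ) ∈ negSet w := by
  have hb := exists_numBars hw
  rw [lamBC_eq, List.mem_map, mem_negSet]
  constructor
  · rintro ⟨i, hi, rfl⟩
    have h1 := (hb (i + 1) (by omega)).2 (List.mem_range.1 hi)
    push_cast at h1
    have e : (((-w.1 ((i : ℤ) + 1)).toNat : ℕ) : ℤ) = -w.1 ((i : ℤ) + 1) := by omega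
    refine ⟨by omega, ?_⟩
    rw [e, ← coe_neg, Equiv.symm_apply_apply]
    omega
  · rintro ⟨hk, h⟩
    obtain ⟨j, hj⟩ : ∃ j : ℕ, w.1.symm (k : ℤ) = -((j : ℤ) + 1) :=
      ⟨(-w.1.symm (k : ℤ) - 1).toNat, by omega⟩
    rw [Equiv.symm_apply_eq, coe_neg] at hj
    refine ⟨j, ?_, by omega⟩
    have := (hb (j + 1) (by omega)).1 (by push_cast; omega)
    exact List.mem_range.2 this

end Grassmannian

/-! ### The limit -/

/-- The coefficient of `u_w`, as a polynomial, in `G_{A_{n-1}}(b̄)⁻¹ F_n(x₁) ⋯ F_n(x_N)`, for the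
Grassmannian `w` with sign pattern `J`. -/
def polyCoeff (X : CType) (n N : ℕ) (J : Signs) : P :=
  ascs (MvPolynomial.X Var.beta) X 1 (n - 1) (fun k => MvPolynomial.X (Var.b k))
    (((List.range N).map fun k => (MvPolynomial.X (Var.x k) : P)).foldr
      (fun t f => Fop (MvPolynomial.X Var.beta) X n t f) (delta vac)) J

theorem delta_map {R R' : Type*} [CommRing R] [CommRing R'] (φ : R →+* R') (J : Signs) :
    φ ∘ delta J = delta J := by
  funext J'
  simp only [Function.comp_apply, delta]
  split_ifs <;> simp

theorem foldr_Fop_map {R R' : Type*} [CommRing R] [CommRing R'] (φ : R →+* R') (β₀ : R)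
    (X : CType) (n : ℕ) (L : List R) :
    φ ∘ L.foldr (fun t f => Fop β₀ X n t f) (delta vac) =
      (L.map φ).foldr (fun t f => Fop (φ β₀) X n t f) (delta vac) := by
  induction L with
  | nil => exact delta_map φ vac
  | cons t L ih => rw [List.foldr_cons, Fop_map, ih, List.map_cons, List.foldr_cons]

theorem polyCoeff_map {R : Type*} [CommRing R] (φ : P →+* R) (X : CType) (n N : ℕ) (J : Signs) :
    φ (polyCoeff X n N J) =
      ascs (φ (MvPolynomial.X Var.beta)) X 1 (n - 1) (fun k => φ (MvPolynomial.X (Var.b k)))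
        (((List.range N).map fun k => φ (MvPolynomial.X (Var.x k))).foldr
          (fun t f => Fop (φ (MvPolynomial.X Var.beta)) X n t f) (delta vac)) J := by
  have h := congrFun (ascs_map (β₀ := MvPolynomial.X Var.beta) (X := X) φ 1 (n - 1)
    (fun k => MvPolynomial.X (Var.b k))
    (((List.range N).map fun k => (MvPolynomial.X (Var.x k) : P)).foldr
      (fun t f => Fop (MvPolynomial.X Var.beta) X n t f) (delta vac))) J
  rw [foldr_Fop_map, List.map_map] at h
  exact h

theorem algebraMap_polyCoeff (X : CType) (n N : ℕ) (J : Signs) :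
    algebraMap P K (polyCoeff X n N J) =
      ascs β X 1 (n - 1) b (((List.range N).map x).foldr (fun t f => Fop β X n t f) (delta vac)) J :=
  polyCoeff_map (algebraMap P K) X n N J

theorem trunc_polyCoeff (X : CType) (n : ℕ) {m N : ℕ} (h : m ≤ N) (J : Signs) :
    trunc m (polyCoeff X n N J) = polyCoeff X n m J := by
  have e := polyCoeff_map (trunc m : P →+* P) X n N J
  have hβ : (trunc m : P →+* P) (MvPolynomial.X Var.beta) = MvPolynomial.X Var.beta := by
    simp [trunc]
  have hb : ∀ k, (trunc m : P →+* P) (MvPolynomial.X (Var.b k)) = MvPolynomial.X (Var.b k) :=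
    fun k => by simp [trunc]
  have hx : ∀ k, (trunc m : P →+* P) (MvPolynomial.X (Var.x k)) =
      if k < m then MvPolynomial.X (Var.x k) else 0 := fun k => by simp [trunc]
  simp only [hβ, hb, hx] at e
  refine Eq.trans e ?_
  rw [polyCoeff]
  congr 1
  clear e
  -- The factors `F_n(0) = 1` can be dropped.
  induction N, h using Nat.le_induction with
  | base =>
    congr 1
    exact List.map_congr_left fun k hk => if_pos (List.mem_range.1 hk)
  | succ N hN ih =>
    rw [List.range_succ, List.map_append, List.foldr_append, List.map_singleton,
      if_neg (by omega), List.foldr_cons, List.foldr_nil, Fop_zero, ih]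

theorem symSum_of_le (X : CType) (c : ℕ → K) {n n' : ℕ} (h : n ≤ n') (J : Signs)
    (hJ : ∀ k : ℕ, n < k → (k : ℤ) ∉ J) (V : Finset K) :
    symSum X c n' J V = symSum X c n J V := by
  induction n', h using Nat.le_induction with
  | base => rfl
  | succ n' hn ih => rw [symSum_succ_of_notMem (hJ _ (by omega)), ih]

theorem algebraMap_polyCoeff_eq_symSum (X : CType) {n N : ℕ} (hn : 1 ≤ n)
    (hD : X = CType.D → 2 ≤ n) (hN : X = CType.D → Even N) {J : Signs} (hJ : J ∈ Good X n N) :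
    algebraMap P K (polyCoeff X n N J) = symSum X b n J (varSet N) := by
  have hlen : ((List.range N).map x).length = N := by simp
  rw [algebraMap_polyCoeff]
  refine ascs_foldr_Fop X n hn hD _ (List.Nodup.map x_injective List.nodup_range)
    (generic_varSet N) ?_ b J ?_
  · rwa [hlen]
  · rwa [hlen]

/-- The coefficients do not depend on the rank. -/
theorem polyCoeff_eq (X : CType) {n n' : ℕ} (hn : 1 ≤ n) (hn' : 1 ≤ n')
    (hD : X = CType.D → 2 ≤ n) (hD' : X = CType.D → 2 ≤ n') (h : n ≤ n') (N : ℕ) {w : W X}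
    (hw : w ∈ Wfin X n) (hw' : w ∈ Wfin X n') :
    polyCoeff X n' N (negSet w) = polyCoeff X n N (negSet w) := by
  -- In type `D` the comparison is made for the even number `2 N` of variables.
  have key : polyCoeff X n' (2 * N) (negSet w) = polyCoeff X n (2 * N) (negSet w) := by
    have he : X = CType.D → Even (2 * N) := fun _ => even_two_mul N
    refine IsFractionRing.injective P K ?_
    rw [algebraMap_polyCoeff_eq_symSum X hn hD he (negSet_mem_Good hD he hw),
      algebraMap_polyCoeff_eq_symSum X hn' hD' he (negSet_mem_Good hD' he hw')]
    exact symSum_of_le X b h _ (negSet_mem_Good hD he hw).1 _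
  rw [← trunc_polyCoeff X n' (show N ≤ 2 * N by omega), key,
    trunc_polyCoeff X n (show N ≤ 2 * N by omega)]

/-- The double Grothendieck polynomial of a Grassmannian element exists, and its components are
the symmetrized sums. -/
theorem exists_isDoubleGrothendieck (X : CType) {w : W X} (hw : IsGrassmannian X w) :
    ∃ (f : InvLim) (n : ℕ), IsDoubleGrothendieck X w f ∧ 1 ≤ n ∧
      (∀ N, (X = CType.D → Even N) → negSet w ∈ Good X n N) ∧
      ∀ N, (X = CType.D → Even N) →
        algebraMap P K (f.comp N) = symSum X b n (negSet w) (varSet N) := by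
  obtain ⟨n, hn, hwn⟩ := exists_mem_Wfin w
  refine ⟨⟨fun N => polyCoeff X n N (negSet w), fun m N h => trunc_polyCoeff X n h _⟩, n, ?_,
    by omega, fun N hN => negSet_mem_Good (fun _ => hn) hN hwn, fun N hN => ?_⟩
  · intro n' hn' hD' hw'
    rw [GPoly_eq hw.increasing, ← algebraMap_polyCoeff]
    dsimp only
    rcases le_total n n' with h | h
    · rw [polyCoeff_eq X (by omega) hn' (fun _ => hn) hD' h n' hwn hw']
    · rw [polyCoeff_eq X hn' (by omega) hD' (fun _ => hn) h n' hw' hwn]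
  · exact algebraMap_polyCoeff_eq_symSum X (by omega) (fun _ => hn) hN
      (negSet_mem_Good (fun _ => hn) hN hwn)

theorem mem_lamBC_iff {X : CType} {n N : ℕ} {w : W X} (hw : Increasing w)
    (hJ : negSet w ∈ Good X n N) (k : ℕ) :
    k ∈ lamBC w.1 ↔ 1 ≤ k ∧ k ≤ n ∧ (k : ℤ) ∈ negSet w := by
  rw [mem_lamBC hw]
  refine and_congr_right fun _ => ⟨fun h => ⟨?_, h⟩, And.right⟩
  by_contra hk
  exact hJ.1 k (by omega) h

theorem symSum_eq_symmetrize {X : CType} {c : ℕ → K} {n N : ℕ} {J : Signs} {l lam : List ℕ}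
    (hl : l.Pairwise (· > ·)) (hJ : ∀ k : ℕ, k ∈ l ↔ 1 ≤ k ∧ k ≤ n ∧ (k : ℤ) ∈ J)
    (pow : K → ℕ → K)
    (hpow : lam.map (fun k v => pow v k) = l.map fun k => rowFactor X c (k - 1))
    (hlen : lam.length ≤ N) :
    symSum X c n J (varSet N) = symmetrize pow N lam := by
  rw [symSum_eq_listSum X c n J l hl hJ, symmetrize_eq_listSum pow N lam hlen, hpow]

theorem powP_zeroB (v : K) {k : ℕ} (hk : 1 ≤ k) :
    powP zeroB v k = rowFactor CType.B b (k - 1) v := by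
  obtain ⟨j, rfl⟩ : ∃ j, k = j + 1 := ⟨k - 1, by omega⟩
  rw [powP, Finset.prod_range_succ', Nat.add_sub_cancel, rowFactor, mul_comm]
  congr 1
  rw [zeroB, oplus, wt]
  ring

end KGroth

end

/-- For Grassmannian `w` the limits defining `𝒢^X_w(a, b; x)` and `GP_λ(x|·)` or `GQ_λ(x|·)`
exist and coincide. -/
theorem proposition5 :
    (∀ w : KGroth.W KGroth.CType.B, KGroth.IsGrassmannian KGroth.CType.B w →
      ∃ f : KGroth.InvLim, KGroth.IsDoubleGrothendieck KGroth.CType.B w f ∧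
        KGroth.IsGP (KGroth.lamBC w) KGroth.zeroB f) ∧
    (∀ w : KGroth.W KGroth.CType.C, KGroth.IsGrassmannian KGroth.CType.C w →
      ∃ f : KGroth.InvLim, KGroth.IsDoubleGrothendieck KGroth.CType.C w f ∧
        KGroth.IsGQ (KGroth.lamBC w) KGroth.b f) ∧
    (∀ w : KGroth.W KGroth.CType.D, KGroth.IsGrassmannian KGroth.CType.D w →
      ∃ f : KGroth.InvLim, KGroth.IsDoubleGrothendieck KGroth.CType.D w f ∧
        KGroth.IsGP (KGroth.lamD w) KGroth.b f) := by
  open KGroth in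
  refine ⟨fun w hw => ?_, fun w hw => ?_, fun w hw => ?_⟩
  · obtain ⟨f, n, hf, -, hJ, hsum⟩ := exists_isDoubleGrothendieck CType.B hw
    refine ⟨f, hf, fun m hm => ?_⟩
    rw [hsum _ fun h => nomatch h]
    refine symSum_eq_symmetrize (lamBC_pairwise hw.increasing)
      (mem_lamBC_iff hw.increasing (hJ 0 fun _ => Even.zero)) _ ?_ hm
    refine List.map_congr_left fun k hk => funext fun v => ?_
    exact powP_zeroB v ((mem_lamBC hw.increasing k).1 hk).1
  · obtain ⟨f, n, hf, -, hJ, hsum⟩ := exists_isDoubleGrothendieck CType.C hw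
    refine ⟨f, hf, fun m hm => ?_⟩
    rw [hsum _ fun h => nomatch h]
    exact symSum_eq_symmetrize (lamBC_pairwise hw.increasing)
      (mem_lamBC_iff hw.increasing (hJ 0 fun _ => Even.zero)) _ rfl hm
  · obtain ⟨f, n, hf, hn, hJ, hsum⟩ := exists_isDoubleGrothendieck CType.D hw
    refine ⟨f, hf, fun m hm => ?_⟩
    rw [hsum _ fun _ => even_two_mul m]
    have hG := hJ (2 * m) fun _ => even_two_mul m
    -- The sign pattern without the member `1`, whose part is `0`.
    obtain ⟨J', h1, h2, h3⟩ : ∃ J' : Signs, 1 ∉ J' ∧ (∀ z : ℤ, 2 ≤ z → (z ∈ J' ↔ z ∈ negSet w)) ∧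
        symSum CType.D b n (negSet w) (varSet (2 * m)) =
          symSum CType.D b n J' (varSet (2 * m)) := by
      by_cases h : 1 ∈ negSet w
      · refine ⟨KGroth.flip (negSet w), fun h' => one_mem_flip.1 h' h,
          fun z hz => mem_flip_of_two_le hz, symSum_flip hn _ _ (generic_varSet _) ?_ h⟩
        have hcard : (varSet (2 * m)).card = 2 * m := by
          rw [varSet, List.toFinset_card_of_nodup (List.Nodup.map x_injective List.nodup_range)]
          simp
        rw [hcard]
        exact hG.2 rfl
      · exact ⟨negSet w, h, fun _ _ => Iff.rfl, rfl⟩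
    have hlam : lamD w.1 = ((lamBC w.1).filter fun k => k - 1 ≠ 0).map fun k => k - 1 := by
      rw [lamD, List.filter_map]
      rfl
    rw [h3]
    refine symSum_eq_symmetrize (l := (lamBC w.1).filter fun k => k - 1 ≠ 0)
      ((lamBC_pairwise hw.increasing).filter _) (fun k => ?_) _ ?_ hm
    · rw [List.mem_filter, mem_lamBC_iff hw.increasing hG, decide_eq_true_eq]
      constructor
      · rintro ⟨⟨k1, k2, k3⟩, k4⟩
        exact ⟨k1, k2, (h2 k (by omega)).2 k3⟩
      · rintro ⟨k1, k2, k3⟩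
        have hk : k ≠ 1 := by
          rintro rfl
          exact h1 k3
        exact ⟨⟨k1, k2, (h2 k (by omega)).1 k3⟩, by omega⟩
    · rw [hlam, List.map_map]
      refine List.map_congr_left fun k _ => funext fun v => ?_
      rw [Function.comp_apply, powP, rowFactor, wt, one_mul]
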